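/- Consider the $s$-user MISO broadcast channel ($s\ge 1$) with a transmitter that has $m\ge 1$ antennas. In slot $t$ user $k$ receives $y_k^{(t)}=(\boldsymbol h_k^{(t)})^{T}\boldsymbol x^{(t)}+z_k^{(t)}$, where $\mathbb E\|\boldsymbol x^{(t)}\|^2\le P$, the noises $z_k^{(t)}$ are i.i.d. $\mathcal{CN}(0,1)$, and $\boldsymbol h_k^{(t)}\in\mathbb C^m$ is random fading with $\mathbb E\log(1+\|\boldsymbol h_k^{(t)}\|^2)$ bounded uniformly in $k$, $t$ and $P\ge 1$. The noises, the channel states (channels and estimates) and the messages, which are independent and uniform, are independent of one another. CSIT: in slot $t$ the transmitter knows the channels of all earlier slots exactly (delayed CSIT), and the estimates $\hat{\boldsymbol h}_k^{(i)}$, $i\le t$. The estimation errors $\boldsymbol h_k^{(t)}-\hat{\boldsymbol h}_k^{(t)}$ have circularly symmetric complex Gaussian entries of mean zero and positive variance, i.i.d. within each error vector; the error vectors of different users in the same slot are independent, and jointly independent of the current estimates. Conditioned on the current estimates, the current channels are independent of all previous estimates and estimation errors. The current CSIT has quality exponent $\alpha\in[0,1]$: $-\log\mathbb E\|\boldsymbol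 h_k^{(t)}-\hat{\boldsymbol h}_k^{(t)}\|^2/\log P\to\alpha$ as $P\to\infty$, uniformly in $t$, for each $k$. Side link: over a block of $n$ slots a parallel noiseless link conveys to all users one common value from a set of size at most $e^{nC(P)}$, where $C(P)/\log P\to d_m\ge 0$ as $P\to\infty$; this value may be any function of the messages and of the channel states of the block. At the end of the block, user $k$ decodes its own message from its received signal, the side-link value, and the channels and estimates of all users in the block. For each $P$, a rate tuple $(R_1,\dots,R_s)$ with $R_k\ge 0$ is achievable if, for every $\varepsilon>0$ and all large $n$, there is a code of length $n$ with at least $e^{nR_k}$ messages for each user $k$ and error probability at most $\varepsilon$. The sum-DoF is $d_\Sigma(d_m)=\limsup_{P\to\infty}\sup\{\sum_k R_k : (R_1,\dots,R_s)\text{ achievable at power }P\}/\log P$. Then, with $H_s=\sum_{i=1}^s 1/i$, $$d_\Sigma(d_m)\ \le\ s\alpha+\frac{s}{H_s}\,(1-\alpha+d_m).$$ -/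

import Mathlib

open MeasureTheory ProbabilityTheory Filter Topology
open scoped NNReal ENNReal

namespace MisoBC

noncomputable section

/-- The channels (or channel estimates) of all `s` users in one time slot, with `m` transmit
antennas: entry `k j` is the fading coefficient from antenna `j` to user `k`. -/
abbrev Chan (s m : ℕ) : Type := Fin s → Fin m → ℂ

/-- Channel state of one time slot: true channel `.1` and the transmitter's current estimate `.2`. -/
abbrev State (s m : ℕ) : Type := Chan s m × Chan s m

/-- A realisation of the channel-state process; time slots are numbered `0, 1, 2, …`. -/
abbrev StatePath (s m : ℕ) : Type := ℕ → State s m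

instance instStandardBorelStatePath (s m : ℕ) : StandardBorelSpace (StatePath s m) :=
  have : StandardBorelSpace (State s m) := StandardBorelSpace.prod
  StandardBorelSpace.pi_countable

/-- The estimation error `h - ĥ` of all users in slot `t`. -/
def estErr {s m : ℕ} (t : ℕ) (ω : StatePath s m) : Chan s m := fun k j => (ω t).1 k j - (ω t).2 k j

/-- Squared Euclidean norm of a complex vector. -/
def normSq {m : ℕ} (v : Fin m → ℂ) : ℝ := ∑ j, ‖v j‖ ^ 2

/-- The circularly symmetric complex Gaussian law `CN(0, v)`: independent real and imaginary
parts, each of law `N(0, v / 2)`. -/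
def complexGaussian (v : ℝ≥0) : Measure ℂ :=
  ((gaussianReal 0 (v / 2)).prod (gaussianReal 0 (v / 2))).map (fun p => (⟨p.1, p.2⟩ : ℂ))

/-- `ν P` is the law of the channel-state process at transmit power `P`. The channel has current
estimates of quality exponent `α`. -/
structure IsMixedCSIT {s m : ℕ} (α : ℝ) (ν : ℝ → Measure (StatePath s m))
    [∀ P, IsProbabilityMeasure (ν P)] : Prop where
  /-- In each slot, the estimation errors of the users have independent, circularly symmetric
  complex Gaussian entries, identically distributed within each user's error vector. -/
  gaussian_error : ∀ P : ℝ, 1 ≤ P → ∀ t : ℕ, ∃ v : Fin s → ℝ≥0, (∀ k, 0 < v k) ∧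
    (ν P).map (estErr t) =
      Measure.pi (fun k : Fin s => Measure.pi (fun _ : Fin m => complexGaussian (v k)))
  /-- The estimation error is independent of the current estimate. -/
  indep_error : ∀ P : ℝ, 1 ≤ P → ∀ t : ℕ,
    IndepFun (estErr t) (fun ω : StatePath s m => (ω t).2) (ν P)
  /-- Conditioned on the current estimate, the current channel is independent of the previous
  estimates and estimation errors. -/
  condIndep_past : ∀ P : ℝ, 1 ≤ P → ∀ t : ℕ,
    CondIndepFun
      (MeasurableSpace.comap (fun ω : StatePath s m => (ω t).2) inferInstance)
      (Measurable.comap_le (by fun_prop))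
      (fun ω : StatePath s m => (ω t).1)
      (fun (ω : StatePath s m) (i : Fin t) => ((ω i).2, estErr i ω)) (ν P)
  /-- The mean squared error of each user's estimate scales as `P ^ (-α)`, uniformly in time. -/
  quality : ∀ k : Fin s, TendstoUniformly
    (fun (P : ℝ) (t : ℕ) => -Real.log (∫ ω, normSq (estErr t ω k) ∂(ν P)) / Real.log P)
    (fun _ => α) atTop
  /-- The fading has a bounded logarithmic moment (as it has when its power is bounded). -/
  fading : ∃ B : ℝ, ∀ P : ℝ, 1 ≤ P → ∀ (t : ℕ) (k : Fin s),
    ∫⁻ ω, ENNReal.ofReal (Real.log (1 + normSq ((ω t).1 k))) ∂(ν P) ≤ ENNReal.ofReal B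

/-- A code of block length `n`. User `k` has `M k` messages, and the side link conveys one of `L`
values to all users in the course of the block. -/
structure Code (s m n : ℕ) where
  M : Fin s → ℕ
  L : ℕ
  /-- The signal sent in slot `t`, from all messages, the channels of the slots before `t`, and
  the channel estimates of the slots up to and including `t`. -/
  enc : (t : Fin n) → ((k : Fin s) → Fin (M k)) →
    (Fin t → Chan s m) → (Fin (t + 1) → Chan s m) → (Fin m → ℂ)
  /-- The content of the side link. -/
  side : ((k : Fin s) → Fin (M k)) → (Fin n → State s m) → Fin L
  /-- The decoder of user `k`, from the user's received signal, the side link, and the channels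
  and channel estimates of all users in all slots. -/
  dec : (k : Fin s) → (Fin n → ℂ) → Fin L → (Fin n → State s m) → Fin (M k)
  measurable_enc : ∀ (t : Fin n) w, Measurable
    (fun p : (Fin t → Chan s m) × (Fin (t + 1) → Chan s m) => enc t w p.1 p.2)
  measurable_side : ∀ w, Measurable (side w)
  measurable_dec : ∀ k, Measurable
    (fun p : (Fin n → ℂ) × Fin L × (Fin n → State s m) => dec k p.1 p.2.1 p.2.2)

namespace Code

variable {s m n : ℕ} (c : Code s m n)

/-- Sample space of one block: messages, channel states, receiver noises. -/
abbrev Sample : Type :=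
  ((k : Fin s) → Fin (c.M k)) × StatePath s m × (Fin n → Fin s → ℂ)

/-- The messages are independent and uniform, the noise is i.i.d. `CN(0, 1)` over slots and users,
and messages, channel states (of law `μ`) and noise are independent. -/
def law (μ : Measure (StatePath s m)) : Measure c.Sample :=
  (uniformOn (Set.univ : Set ((k : Fin s) → Fin (c.M k)))).prod
    (μ.prod (Measure.pi (fun _ : Fin n => Measure.pi (fun _ : Fin s => complexGaussian 1))))

/-- The transmitted vector in slot `t`. -/
def sent (t : Fin n) (ξ : c.Sample) : Fin m → ℂ :=
  c.enc t ξ.1 (fun i => (ξ.2.1 i).1) (fun i => (ξ.2.1 i).2)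

/-- The signal `hᵀ x + z` received by user `k` in slot `t`. -/
def received (k : Fin s) (ξ : c.Sample) (t : Fin n) : ℂ :=
  (∑ j, (ξ.2.1 t).1 k j * c.sent t ξ j) + ξ.2.2 t k

/-- The estimate that user `k` forms of its message at the end of the block. -/
def decoded (k : Fin s) (ξ : c.Sample) : Fin (c.M k) :=
  c.dec k (c.received k ξ) (c.side ξ.1 (fun i => ξ.2.1 i)) (fun i => ξ.2.1 i)

/-- The power constraint `E ‖x‖² ≤ P` in each slot. -/
def PowerConstraint (μ : Measure (StatePath s m)) (P : ℝ) : Prop :=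
  ∀ t : Fin n, ∫⁻ ξ, ENNReal.ofReal (normSq (c.sent t ξ)) ∂(c.law μ) ≤ ENNReal.ofReal P

/-- The probability that some user decodes its message wrongly. -/
def errorProb (μ : Measure (StatePath s m)) : ℝ≥0∞ :=
  c.law μ {ξ | ∃ k, c.decoded k ξ ≠ ξ.1 k}

end Code

/-- `R` (in nats per slot) is an achievable rate tuple when the channel states have law `μ`, the
power is `P`, and the side link carries at most `C` nats per slot. -/
def Achievable {s m : ℕ} (μ : Measure (StatePath s m)) (P C : ℝ) (R : Fin s → ℝ) : Prop :=
  (∀ k, 0 ≤ R k) ∧ ∀ ε : ℝ≥0∞, 0 < ε → ∀ᶠ n : ℕ in atTop, ∃ c : Code s m n,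
    (∀ k, Real.exp (n * R k) ≤ c.M k) ∧ Real.log c.L ≤ n * C ∧
    c.PowerConstraint μ P ∧ c.errorProb μ ≤ ε

/-- Sum degrees of freedom: the growth rate, relative to `log P`, of the sum capacity as
`P → ∞`, when at power `P` the channel states have law `ν P` and the side link has capacity
`C P`. -/
def sumDoF {s m : ℕ} (ν : ℝ → Measure (StatePath s m)) (C : ℝ → ℝ) : EReal :=
  limsup (fun P : ℝ => ⨆ R : {R : Fin s → ℝ // Achievable (ν P) P (C P) R},
    (((∑ k, R.1 k) / Real.log P : ℝ) : EReal)) atTop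

end

end MisoBC

namespace MisoBC
noncomputable section

set_option linter.unusedSectionVars false

/-! Fix an order `e` of the users. Let `a k` be the entropy, given the states and the messages of
the first `k` users, of the side-link value and of all outputs of these users (up to the Gaussian
normalisation). Two facts relate `a (k + 1)` to `a k`.

Fano: the next user decodes from its own outputs and the side value, so putting its message into the
conditioning removes about `log M` from the entropy (`Code.hSide_insert_le`).

Exchange: given outputs that do not involve user `i`'s current channel, the current output of user
`j` has at most `Δ`, roughly `log (1 / v i) ≈ α log P`, more entropy than that of user `i`
(`ent_insert_le_ent_insert`). Together with submodularity (`ent_submodular`), the outputs of `k + 1`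
users have at most `(k + 1) / k` times the entropy of those of `k` users, plus `n * Δ`
(`mul_entropy_block_succ_le`). The conditional entropy of the side value only drops when outputs are
added, so `log L` is paid once, at the first user.

Hence `a (k + 1) / (k + 1) ≤ a k / k + (n Δ - log M) / (k + 1)` up to Fano terms. Telescoping gives
`∑ R (e l) / (l + 1) ≤ (1 + d + α (H - 1)) log P + o(log P)` with `H` the harmonic number
(`Code.sum_log_le`, `Achievable.sum_div_le`), and averaging over cyclic orders
(`harmonic_mul_sum_le`) gives the bound.

The exchange step compares densities. At a sample point, the likelihood of a competing input `w'`
for the output of user `i` is a Gaussian bump in `h · d + z`, where `d` is the difference of the two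
signals. The encoder does not know the current error of user `i`, so the error may be redrawn
(`lintegral_resample`); the bump then averages to at most `2 m / (1 + v ‖d‖²)`
(`lintegral_mix_div_smear_le`). For user `j` the bump is replaced by a reference density with the
same quadratic decay, and the two differ by a factor that does not depend on `w'` (`smear_le`).

All entropies are means of minus the logarithm of a finite Gaussian mixture over inputs, and each
inequality is `log r ≤ r - 1` for a likelihood ratio `r` of mean at most one. -/

instance instIsProbabilityMeasureComplexGaussian (v : ℝ≥0) :
    IsProbabilityMeasure (complexGaussian v) :=
  Measure.isProbabilityMeasure_map (Measurable.aemeasurable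
    Complex.measurableEquivRealProd.symm.measurable)

/-! ### Integrals against the complex Gaussian and the heavy-tailed kernel. -/

theorem complexGaussian_eq_withDensity {v : ℝ≥0} (hv : 0 < v) :
    complexGaussian v = (volume : Measure ℂ).withDensity
      (fun z => ENNReal.ofReal ((Real.pi * v)⁻¹ * Real.exp (-‖z‖ ^ 2 / v))) := by
  have hv2 : v / 2 ≠ 0 := (by positivity : 0 < v / 2).ne'
  have hvr : (0 : ℝ) < v := by exact_mod_cast hv
  have hvol : (volume : Measure ℂ) =
      ((volume : Measure (ℝ × ℝ)).map Complex.measurableEquivRealProd.symm) :=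
    (Complex.volume_preserving_equiv_real_prod.symm).map_eq.symm
  have hfun : (fun p : ℝ × ℝ => (⟨p.1, p.2⟩ : ℂ)) = Complex.measurableEquivRealProd.symm := rfl
  rw [complexGaussian, hfun, hvol, gaussianReal_of_var_ne_zero _ hv2,
    prod_withDensity (measurable_gaussianPDF _ _) (measurable_gaussianPDF _ _)]
  ext s hs
  rw [Measure.map_apply Complex.measurableEquivRealProd.symm.measurable hs,
    withDensity_apply _ hs,
    withDensity_apply _ (Complex.measurableEquivRealProd.symm.measurable hs),
    MeasurableEquiv.restrict_map, MeasureTheory.lintegral_map_equiv]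
  refine lintegral_congr fun p => ?_
  rw [gaussianPDF, gaussianPDF, ← ENNReal.ofReal_mul (gaussianPDFReal_nonneg _ _ _)]
  congr 1
  rw [gaussianPDFReal, gaussianPDFReal, Complex.measurableEquivRealProd_symm_apply,
    ← Complex.normSq_eq_norm_sq, Complex.normSq_mk]
  push_cast
  have h1 : (2 * Real.pi * (v / 2 : ℝ)) = Real.pi * v := by ring
  rw [h1, mul_mul_mul_comm, ← Real.exp_add, ← mul_inv, Real.mul_self_sqrt (by positivity)]
  congr 2
  field_simp
  ring

theorem lintegral_complexGaussian {v : ℝ≥0} (hv : 0 < v) {f : ℂ → ℝ≥0∞} (hf : Measurable f) :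
    ∫⁻ z, f z ∂complexGaussian v =
      ∫⁻ z, ENNReal.ofReal ((Real.pi * v)⁻¹ * Real.exp (-‖z‖ ^ 2 / v)) * f z := by
  rw [complexGaussian_eq_withDensity hv, lintegral_withDensity_eq_lintegral_mul _ (by fun_prop) hf]
  rfl

/-- Translating a standard complex Gaussian amounts to a change of density. -/
theorem lintegral_complexGaussian_const_add (m : ℂ) {f : ℂ → ℝ≥0∞} (hf : Measurable f) :
    ∫⁻ z, f (m + z) ∂complexGaussian 1 =
      ∫⁻ y, f y * ENNReal.ofReal (Real.exp (‖y‖ ^ 2 - ‖y - m‖ ^ 2)) ∂complexGaussian 1 := by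
  rw [lintegral_complexGaussian one_pos (by fun_prop),
    lintegral_complexGaussian one_pos (by fun_prop),
    ← lintegral_add_left_eq_self (μ := (volume : Measure ℂ))
      (fun z => ENNReal.ofReal _ * (f z * ENNReal.ofReal _)) m]
  refine lintegral_congr fun z => ?_
  rw [add_sub_cancel_left, mul_comm (f _), ← mul_assoc, ← ENNReal.ofReal_mul (by positivity),
    mul_assoc, ← Real.exp_add]
  congr 4
  push_cast
  ring

/-- Density of the standard complex Gaussian with respect to Lebesgue measure, inverted. -/
theorem lintegral_complexGaussian_mul_exp {k : ℂ → ℝ} (hk : Measurable k) :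
    ∫⁻ y, ENNReal.ofReal (k y * Real.exp (‖y‖ ^ 2)) ∂complexGaussian 1 =
      ENNReal.ofReal Real.pi⁻¹ * ∫⁻ y, ENNReal.ofReal (k y) := by
  rw [lintegral_complexGaussian one_pos (by fun_prop), ← lintegral_const_mul _ (by fun_prop)]
  refine lintegral_congr fun z => ?_
  rw [← ENNReal.ofReal_mul (by positivity), ← ENNReal.ofReal_mul (by positivity)]
  congr 1
  have : Real.exp (‖z‖ ^ 2) ≠ 0 := (Real.exp_pos _).ne'
  simp only [NNReal.coe_one, mul_one, div_one, Real.exp_neg]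
  field_simp

theorem lintegral_exp_neg_mul_norm_sq {b : ℝ} (hb : 0 < b) :
    ∫⁻ z : ℂ, ENNReal.ofReal (Real.exp (-b * ‖z‖ ^ 2)) = ENNReal.ofReal (Real.pi / b) := by
  have h := GaussianFourier.integral_rexp_neg_mul_sq_norm (V := ℂ) hb
  rw [← ofReal_integral_eq_lintegral_ofReal, h]
  · simp [Complex.finrank_real_complex]
  -- A non-integrable function would have Bochner integral 0, against the positive value in `h`.
  · by_contra hc
    rw [integral_undef hc] at h
    have : (0 : ℝ) < (Real.pi / b) ^ ((Module.finrank ℝ ℂ : ℝ) / 2) := by positivity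
    exact absurd h this.ne
  · exact ae_of_all _ fun _ => (Real.exp_pos _).le

/-- Averaging a Gaussian bump over a random complex coefficient. -/
theorem lintegral_exp_neg_norm_add_mul_sq_le {v : ℝ≥0} (hv : 0 < v) (c d : ℂ) :
    ∫⁻ e, ENNReal.ofReal (Real.exp (-‖c + e * d‖ ^ 2)) ∂complexGaussian v ≤
      ENNReal.ofReal (2 / (1 + v * ‖d‖ ^ 2)) := by
  have hvr : (0 : ℝ) < v := by exact_mod_cast hv
  -- If `v ‖d‖² ≤ 1`, the bound by 1 suffices. Otherwise the density of `e` is replaced by its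
  -- maximum `1 / (π v)` and the bump is integrated over the plane, giving `1 / (v ‖d‖²)`. The 2
  -- absorbs the `1 +` of the denominator.
  rcases le_or_gt (v * ‖d‖ ^ 2) 1 with h1 | h1
  · calc _ ≤ ∫⁻ _, 1 ∂complexGaussian v := lintegral_mono fun e => by
          rw [← ENNReal.ofReal_one]
          exact ENNReal.ofReal_le_ofReal (Real.exp_le_one_iff.2 (by simp))
      _ = ENNReal.ofReal 1 := by simp
      _ ≤ _ := ENNReal.ofReal_le_ofReal (by rw [le_div_iff₀ (by positivity)]; linarith)
  · have hd : d ≠ 0 := by rintro rfl; norm_num at h1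
    have hd' : (0 : ℝ) < ‖d‖ ^ 2 := by positivity
    rw [lintegral_complexGaussian hv (by fun_prop)]
    calc _ ≤ ∫⁻ e : ℂ, ENNReal.ofReal (Real.pi * v)⁻¹ *
            ENNReal.ofReal (Real.exp (-‖d‖ ^ 2 * ‖e + c / d‖ ^ 2)) := lintegral_mono fun e => by
          refine mul_le_mul' (ENNReal.ofReal_le_ofReal ?_) (le_of_eq ?_)
          · refine mul_le_of_le_one_right (by positivity) (Real.exp_le_one_iff.2 ?_)
            exact div_nonpos_of_nonpos_of_nonneg (by simp) hvr.le
          · congr 2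
            rw [neg_mul, ← mul_pow, ← norm_mul]
            congr 3
            field_simp
            ring
      _ = ENNReal.ofReal (Real.pi * v)⁻¹ *
            ∫⁻ e : ℂ, ENNReal.ofReal (Real.exp (-‖d‖ ^ 2 * ‖e‖ ^ 2)) := by
          rw [lintegral_const_mul _ (by fun_prop),
            lintegral_add_right_eq_self
              (fun e : ℂ => ENNReal.ofReal (Real.exp (-‖d‖ ^ 2 * ‖e‖ ^ 2)))]
      _ ≤ _ := by
          rw [lintegral_exp_neg_mul_norm_sq hd', ← ENNReal.ofReal_mul (by positivity)]
          refine ENNReal.ofReal_le_ofReal ?_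
          rw [mul_comm, inv_eq_one_div, div_mul_div_comm, div_le_div_iff₀ (by positivity)
            (by positivity)]
          nlinarith [Real.pi_pos, mul_pos Real.pi_pos (mul_pos hvr hd')]

theorem lintegral_norm_sq_complexGaussian (v : ℝ≥0) :
    ∫⁻ z, ENNReal.ofReal (‖z‖ ^ 2) ∂complexGaussian v = v := by
  have hreal : ∫⁻ x, ENNReal.ofReal (x ^ 2) ∂gaussianReal 0 (v / 2) = ((v / 2 : ℝ≥0) : ℝ≥0∞) := by
    have hi : Integrable (fun x : ℝ => x ^ 2) (gaussianReal 0 (v / 2)) :=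
      (memLp_id_gaussianReal' 2 (by simp)).integrable_sq
    rw [← ofReal_integral_eq_lintegral_ofReal hi (ae_of_all _ fun _ => sq_nonneg _)]
    have := variance_fun_id_gaussianReal (μ := 0) (v := v / 2)
    rw [variance_eq_integral measurable_id'.aemeasurable, integral_id_gaussianReal] at this
    simp only [sub_zero] at this
    rw [this]
    rw [ENNReal.ofReal_coe_nnreal]
  have hfun : Measurable (fun p : ℝ × ℝ => (⟨p.1, p.2⟩ : ℂ)) :=
    Complex.measurableEquivRealProd.symm.measurable
  rw [complexGaussian, lintegral_map (by fun_prop) hfun]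
  have : ∀ p : ℝ × ℝ, ENNReal.ofReal (‖(⟨p.1, p.2⟩ : ℂ)‖ ^ 2) =
      ENNReal.ofReal (p.1 ^ 2) + ENNReal.ofReal (p.2 ^ 2) := fun p => by
    rw [← ENNReal.ofReal_add (sq_nonneg _) (sq_nonneg _), ← Complex.normSq_eq_norm_sq,
      Complex.normSq_mk, sq, sq]
  simp_rw [this]
  rw [lintegral_add_left (by fun_prop)]
  rw [lintegral_prod _ (by fun_prop), lintegral_prod _ (by fun_prop)]
  simp only [lintegral_const, measure_univ, mul_one]
  rw [hreal, ← ENNReal.coe_add, add_halves]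

/-- The heavy-tailed kernel `(1 + |z|²) ^ (-(1 + η))` has mass `π / η`. -/
theorem lintegral_one_add_norm_sq_rpow_le {η : ℝ} (hη : 0 < η) :
    ∫⁻ z : ℂ, ENNReal.ofReal ((1 + ‖z‖ ^ 2) ^ (-(1 + η))) ≤ ENNReal.ofReal (Real.pi / η) := by
  -- Polar coordinates reduce the integral to a radial one with an explicit antiderivative.
  have hder : ∀ r ∈ Set.Ioi (0 : ℝ), HasDerivAt (fun r : ℝ => -(2 * η)⁻¹ * (1 + r ^ 2) ^ (-η))
      (r * (1 + r ^ 2) ^ (-(1 + η))) r := by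
    intro r hr
    have h1 : HasDerivAt (fun r : ℝ => 1 + r ^ 2) (2 * r) r := by
      simpa using ((hasDerivAt_pow 2 r).const_add 1)
    have h2 := (h1.rpow_const (p := -η) (Or.inl (by positivity))).const_mul (-(2 * η)⁻¹)
    refine h2.congr_deriv ?_
    rw [show -η - 1 = -(1 + η) by ring]
    field_simp
  have hcont : ContinuousWithinAt (fun r : ℝ => -(2 * η)⁻¹ * (1 + r ^ 2) ^ (-η))
      (Set.Ici 0) 0 := by
    refine ContinuousAt.continuousWithinAt ?_
    refine continuousAt_const.mul (ContinuousAt.rpow_const (by fun_prop) (Or.inl (by norm_num)))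
  have hlim : Tendsto (fun r : ℝ => -(2 * η)⁻¹ * (1 + r ^ 2) ^ (-η)) atTop (𝓝 0) := by
    have : Tendsto (fun r : ℝ => 1 + r ^ 2) atTop atTop :=
      tendsto_atTop_add_const_left _ _ (tendsto_pow_atTop two_ne_zero)
    simpa using ((tendsto_rpow_neg_atTop hη).comp this).const_mul (-(2 * η)⁻¹)
  have hpos : ∀ r ∈ Set.Ioi (0 : ℝ), 0 ≤ r * (1 + r ^ 2) ^ (-(1 + η)) := fun r hr => by
    have : (0 : ℝ) < r := hr
    positivity
  have hint := integrableOn_Ioi_deriv_of_nonneg hcont hder hpos hlim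
  have hval := integral_Ioi_of_hasDerivAt_of_nonneg hcont hder hpos hlim
  have hI : Integrable (fun z : ℂ => (1 + ‖z‖ ^ 2) ^ (-(1 + η))) := by
    rw [integrable_fun_norm_addHaar (E := ℂ) volume (f := fun r : ℝ => (1 + r ^ 2) ^ (-(1 + η)))]
    simpa [Complex.finrank_real_complex] using hint
  rw [← ofReal_integral_eq_lintegral_ofReal hI (ae_of_all _ fun _ => by positivity),
    integral_fun_norm_addHaar (E := ℂ) volume (fun r : ℝ => (1 + r ^ 2) ^ (-(1 + η)))]
  refine ENNReal.ofReal_le_ofReal (le_of_eq ?_)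
  simp only [Complex.finrank_real_complex, smul_eq_mul, Nat.add_one_sub_one, pow_one, hval]
  simp [Measure.real, Complex.volume_ball]
  field_simp


/-! ### Noise vectors: translation as a change of density. -/

/-- The law of i.i.d. standard complex Gaussian noise. -/
def noise (A : Type*) [Fintype A] : Measure (A → ℂ) := Measure.pi fun _ => complexGaussian 1

instance (A : Type*) [Fintype A] : IsProbabilityMeasure (noise A) := by
  unfold noise; infer_instance

section Noise
variable {A : Type*} [Fintype A]

theorem lintegral_noise_eval (a : A) {g : ℂ → ℝ≥0∞} (hg : Measurable g) :
    ∫⁻ y, g (y a) ∂noise A = ∫⁻ x, g x ∂complexGaussian 1 :=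
  (measurePreserving_eval (fun _ : A => complexGaussian 1) a).lintegral_comp hg

theorem lintegral_pi_prod {β : A → Type*} [∀ a, MeasurableSpace (β a)] (μ : ∀ a, Measure (β a))
    [∀ a, IsProbabilityMeasure (μ a)] (g : ∀ a, β a → ℝ≥0∞) (hg : ∀ a, Measurable (g a)) :
    ∫⁻ y, ∏ a, g a (y a) ∂Measure.pi μ = ∏ a, ∫⁻ x, g a x ∂μ a := by
  refine (lintegral_prod_eq_prod_lintegral_of_indepFun Finset.univ
    (fun a (y : ∀ a, β a) => g a (y a))
    (iIndepFun_pi fun a => (hg a).aemeasurable) fun a => by fun_prop).trans ?_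
  exact Finset.prod_congr rfl fun a _ => (measurePreserving_eval μ a).lintegral_comp (hg a)

theorem pi_withDensity {β : A → Type*} [∀ a, MeasurableSpace (β a)] (μ : ∀ a, Measure (β a))
    [∀ a, IsProbabilityMeasure (μ a)] (g : ∀ a, β a → ℝ≥0∞) (hg : ∀ a, Measurable (g a))
    [∀ a, SigmaFinite ((μ a).withDensity (g a))] :
    Measure.pi (fun a => (μ a).withDensity (g a)) =
      (Measure.pi μ).withDensity fun y => ∏ a, g a (y a) := by
  refine Measure.pi_eq fun s hs => ?_
  rw [withDensity_apply _ (MeasurableSet.univ_pi hs),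
    ← lintegral_indicator (MeasurableSet.univ_pi hs)]
  have : ∀ y, (Set.univ.pi s).indicator (fun y => ∏ a, g a (y a)) y =
      ∏ a, (s a).indicator (g a) (y a) := by
    classical
    intro y
    by_cases hy : y ∈ Set.univ.pi s
    · rw [Set.indicator_of_mem hy]
      exact Finset.prod_congr rfl fun a _ => (Set.indicator_of_mem (hy a trivial) _).symm
    · rw [Set.indicator_of_notMem hy]
      simp only [Set.mem_pi, Set.mem_univ, true_imp_iff, not_forall] at hy
      obtain ⟨a, ha⟩ := hy
      exact (Finset.prod_eq_zero (Finset.mem_univ a) (Set.indicator_of_notMem ha _)).symm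
  simp_rw [this]
  rw [lintegral_pi_prod μ _ fun a => (hg a).indicator (hs a)]
  refine Finset.prod_congr rfl fun a _ => ?_
  rw [withDensity_apply _ (hs a), lintegral_indicator (hs a)]

theorem lintegral_noise_const_add (m : A → ℂ) {f : (A → ℂ) → ℝ≥0∞} (hf : Measurable f) :
    ∫⁻ z, f (m + z) ∂noise A =
      ∫⁻ y, f y * ENNReal.ofReal (∏ a, Real.exp (‖y a‖ ^ 2 - ‖y a - m a‖ ^ 2)) ∂noise A := by
  set g : A → ℂ → ℝ≥0∞ := fun a y => ENNReal.ofReal (Real.exp (‖y‖ ^ 2 - ‖y - m a‖ ^ 2))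
  have hg : ∀ a, Measurable (g a) := fun a => by fun_prop
  have hmap : ∀ a, (complexGaussian 1).map (fun z => m a + z) =
      (complexGaussian 1).withDensity (g a) := fun a => by
    ext s hs
    rw [Measure.map_apply (by fun_prop) hs, withDensity_apply _ hs, ← lintegral_indicator_one
      (by exact measurable_const_add (m a) hs), ← lintegral_indicator hs]
    have := lintegral_complexGaussian_const_add (m a) (f := s.indicator 1)
      (measurable_one.indicator hs)
    refine this.trans (lintegral_congr fun y => ?_)
    by_cases hy : y ∈ s <;> simp [hy, g]
  have : ∀ a, IsProbabilityMeasure ((complexGaussian 1).map (fun z => m a + z)) := fun a =>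
    Measure.isProbabilityMeasure_map (by fun_prop)
  have : ∀ a, SigmaFinite ((complexGaussian 1).withDensity (g a)) := fun a => by
    rw [← hmap]; infer_instance
  have key : (noise A).map (fun z => m + z) =
      (noise A).withDensity fun y => ∏ a, g a (y a) := by
    rw [noise, ← pi_withDensity _ _ hg]
    simp_rw [← hmap]
    exact Measure.pi_map_pi (f := fun a z => m a + z) fun a => by fun_prop
  rw [← lintegral_map hf (by fun_prop), key, lintegral_withDensity_eq_lintegral_mul _
    (by fun_prop) hf]
  refine lintegral_congr fun y => ?_
  rw [Pi.mul_apply, mul_comm, ENNReal.ofReal_prod_of_nonneg fun a _ => (Real.exp_pos _).le]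

/-- Likelihood ratio on the coordinates `S` of the noise translated by `m`, against the noise. -/
def tilt (S : Finset A) (m y : A → ℂ) : ℝ := ∏ a ∈ S, Real.exp (‖y a‖ ^ 2 - ‖y a - m a‖ ^ 2)

theorem tilt_nonneg (S : Finset A) (m y : A → ℂ) : 0 ≤ tilt S m y :=
  Finset.prod_nonneg fun _ _ => (Real.exp_pos _).le

@[fun_prop]
theorem measurable_tilt (S : Finset A) (m : A → ℂ) : Measurable (tilt S m) := by
  unfold tilt; fun_prop

variable [DecidableEq A]

theorem prod_exp_piecewise (S : Finset A) (m y : A → ℂ) :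
    ∏ a, Real.exp (‖y a‖ ^ 2 - ‖y a - S.piecewise m 0 a‖ ^ 2) = tilt S m y := by
  rw [tilt, ← Finset.prod_subset (Finset.subset_univ S)]
  · exact Finset.prod_congr rfl fun a ha => by simp [ha]
  · intro a _ ha; simp [ha]

/-- As `f` sees only `S`, translating by `m` on `S` and by 0 elsewhere has the same effect, and
costs only the density on `S`. -/
theorem lintegral_noise_add_of_dependsOn {S : Finset A} (m : A → ℂ) {f : (A → ℂ) → ℝ≥0∞}
    (hf : Measurable f) (hS : DependsOn f S) :
    ∫⁻ z, f (m + z) ∂noise A = ∫⁻ y, f y * ENNReal.ofReal (tilt S m y) ∂noise A := by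
  have h := lintegral_noise_const_add (S.piecewise m 0) hf
  simp_rw [prod_exp_piecewise] at h
  rw [← h]
  refine lintegral_congr fun z => hS fun a ha => ?_
  simp [Finset.mem_coe.1 ha]

/-- Marginalisation: translating only the coordinates in `T` is invisible to `f`. Outputs are
integrated out of a mixture this way. -/
theorem lintegral_noise_mul_tilt_of_dependsOn {T : Finset A} (m : A → ℂ) {f : (A → ℂ) → ℝ≥0∞}
    (hf : Measurable f) (hT : DependsOn f (T : Set A)ᶜ) :
    ∫⁻ y, f y * ENNReal.ofReal (tilt T m y) ∂noise A = ∫⁻ y, f y ∂noise A := by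
  have h := lintegral_noise_const_add (T.piecewise m 0) hf
  simp_rw [prod_exp_piecewise] at h
  rw [← h]
  refine lintegral_congr fun z => hT fun a ha => ?_
  have : a ∉ T := by simpa using ha
  simp [this]

theorem lintegral_tilt (S : Finset A) (m : A → ℂ) :
    ∫⁻ y, ENNReal.ofReal (tilt S m y) ∂noise A = 1 := by
  have := lintegral_noise_mul_tilt_of_dependsOn (T := S) m (f := fun _ => 1) measurable_const
    (fun _ _ _ => rfl)
  simpa using this

end Noise

/-! ### Mixture densities of label and outputs. -/

section Mixture
variable {W K K' A : Type*} [Fintype W] [Fintype A] [DecidableEq K] [DecidableEq K']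

/-- Likelihood of the outputs `S`, up to normalisation, given input `w`. -/
def lik (μ : W → A → ℂ) (S : Finset A) (w : W) (y : A → ℂ) : ℝ :=
  ∏ a ∈ S, Real.exp (-‖y a - μ w a‖ ^ 2)

/-- Inverse Gaussian density of the outputs `S`, up to normalisation. -/
def invRef (S : Finset A) (y : A → ℂ) : ℝ := ∏ a ∈ S, Real.exp (‖y a‖ ^ 2)

/-- Sum of the likelihoods of all inputs with label `c`. -/
def mix (μ : W → A → ℂ) (κ : W → K) (S : Finset A) (c : K) (y : A → ℂ) : ℝ :=
  ∑ w, if κ w = c then lik μ S w y else 0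

variable (μ : W → A → ℂ) (κ : W → K) (S T U : Finset A)

theorem lik_pos (w : W) (y : A → ℂ) : 0 < lik μ S w y :=
  Finset.prod_pos fun _ _ => Real.exp_pos _

theorem lik_le_one (w : W) (y : A → ℂ) : lik μ S w y ≤ 1 :=
  Finset.prod_le_one (fun _ _ => (Real.exp_pos _).le) fun _ _ =>
    Real.exp_le_one_iff.2 (by simp)

theorem invRef_pos (y : A → ℂ) : 0 < invRef S y := Finset.prod_pos fun _ _ => Real.exp_pos _

theorem lik_mul_invRef (w : W) (y : A → ℂ) : lik μ S w y * invRef S y = tilt S (μ w) y := by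
  rw [lik, invRef, tilt, ← Finset.prod_mul_distrib]
  refine Finset.prod_congr rfl fun a _ => ?_
  rw [← Real.exp_add]
  congr 1
  ring

theorem lik_union [DecidableEq A] {S T : Finset A} (h : Disjoint S T) (w : W) (y : A → ℂ) :
    lik μ (S ∪ T) w y = lik μ S w y * lik μ T w y := Finset.prod_union h

theorem invRef_union [DecidableEq A] {S T : Finset A} (h : Disjoint S T) (y : A → ℂ) :
    invRef (S ∪ T) y = invRef S y * invRef T y := Finset.prod_union h

@[fun_prop]
theorem measurable_lik (w : W) : Measurable (lik μ S w) := by unfold lik; fun_prop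

@[fun_prop]
theorem measurable_invRef : Measurable (invRef S) := by unfold invRef; fun_prop

@[fun_prop]
theorem measurable_mix (c : K) : Measurable (mix μ κ S c) := by
  unfold mix
  refine Finset.measurable_sum _ fun w _ => ?_
  split_ifs <;> fun_prop

theorem mix_nonneg (c : K) (y : A → ℂ) : 0 ≤ mix μ κ S c y :=
  Finset.sum_nonneg fun w _ => by split_ifs; exacts [(lik_pos μ S w y).le, le_rfl]

theorem lik_le_mix (w : W) (y : A → ℂ) : lik μ S w y ≤ mix μ κ S (κ w) y := by
  have := Finset.single_le_sum (f := fun w' => if κ w' = κ w then lik μ S w' y else 0)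
    (fun w' _ => by split_ifs; exacts [(lik_pos μ S w' y).le, le_rfl])
    (Finset.mem_univ w)
  simpa [mix] using this

theorem mix_pos (w : W) (y : A → ℂ) : 0 < mix μ κ S (κ w) y :=
  (lik_pos μ S w y).trans_le (lik_le_mix μ κ S w y)

theorem mix_le_card (c : K) (y : A → ℂ) : mix μ κ S c y ≤ Fintype.card W := by
  calc mix μ κ S c y ≤ ∑ _w : W, (1 : ℝ) := Finset.sum_le_sum fun w _ => by
        split_ifs; exacts [lik_le_one μ S w y, zero_le_one]
    _ = _ := by simp

theorem dependsOn_lik (w : W) : DependsOn (lik μ S w) S := fun x y h =>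
  Finset.prod_congr rfl fun a ha => by rw [h a ha]

theorem dependsOn_invRef : DependsOn (invRef S) (S : Set A) := fun x y h =>
  Finset.prod_congr rfl fun a ha => by rw [h a ha]

theorem dependsOn_mix (c : K) : DependsOn (mix μ κ S c) S := fun x y h =>
  Finset.sum_congr rfl fun w _ => by rw [dependsOn_lik μ S w h]

theorem sum_mix [Fintype K] (y : A → ℂ) : ∑ c, mix μ κ S c y = ∑ w, lik μ S w y := by
  simp only [mix]
  rw [Finset.sum_comm]
  simp

theorem lintegral_lik_mul_invRef [DecidableEq A] (w : W) :
    ∫⁻ y, ENNReal.ofReal (lik μ S w y * invRef S y) ∂noise A = 1 := by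
  simp_rw [lik_mul_invRef]
  exact lintegral_tilt S _

/-- The total mass of the joint law of label and outputs. -/
theorem sum_lintegral_mix_mul_invRef [Fintype K] [DecidableEq A] :
    ∑ c, ∫⁻ y, ENNReal.ofReal (mix μ κ S c y * invRef S y) ∂noise A = Fintype.card W := by
  rw [← lintegral_finsetSum _ fun c _ => by fun_prop]
  have : ∀ y, ∑ c, ENNReal.ofReal (mix μ κ S c y * invRef S y) =
      ∑ w, ENNReal.ofReal (lik μ S w y * invRef S y) := fun y => by
    rw [← ENNReal.ofReal_sum_of_nonneg fun c _ =>
        mul_nonneg (mix_nonneg μ κ S c y) (invRef_pos S y).le, ← Finset.sum_mul, sum_mix,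
      Finset.sum_mul, ENNReal.ofReal_sum_of_nonneg fun w _ =>
        mul_nonneg (lik_pos μ S w y).le (invRef_pos S y).le]
  simp_rw [this]
  rw [lintegral_finsetSum _ fun c _ => by fun_prop]
  simp_rw [lintegral_lik_mul_invRef]
  simp

/-- Averaging the ratio of a reference density to the joint density of label and outputs gives at
most the mass of the reference density. -/
theorem sum_lintegral_div_mix_le [Fintype K] [DecidableEq A] {R : K → (A → ℂ) → ℝ}
    (hRm : ∀ c, Measurable (R c)) (hR : ∀ c y, 0 ≤ R c y) (hdep : ∀ c, DependsOn (R c) S) :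
    ∑ w, ∫⁻ z, ENNReal.ofReal (R (κ w) (μ w + z) / mix μ κ S (κ w) (μ w + z)) ∂noise A ≤
      ∑ c, ∫⁻ y, ENNReal.ofReal (R c y * invRef S y) ∂noise A := by
  have h1 : ∀ w, ∫⁻ z, ENNReal.ofReal (R (κ w) (μ w + z) / mix μ κ S (κ w) (μ w + z)) ∂noise A =
      ∫⁻ y, ENNReal.ofReal (R (κ w) y / mix μ κ S (κ w) y * (lik μ S w y * invRef S y))
        ∂noise A := fun w => by
    rw [lintegral_noise_add_of_dependsOn (S := S) (μ w)
      (f := fun y => ENNReal.ofReal (R (κ w) y / mix μ κ S (κ w) y))]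
    · refine lintegral_congr fun y => ?_
      rw [lik_mul_invRef, ← ENNReal.ofReal_mul (div_nonneg (hR _ _) (mix_nonneg _ _ _ _ _))]
    · exact ((hRm _).div (measurable_mix _ _ _ _)).ennreal_ofReal
    · intro x y h
      simp only [hdep _ h, dependsOn_mix μ κ S _ h]
  simp_rw [h1]
  rw [← lintegral_finsetSum _ fun w _ => by
      exact (((hRm _).div (measurable_mix _ _ _ _)).mul (by fun_prop)).ennreal_ofReal,
    ← lintegral_finsetSum _ fun c _ => by
      exact ((hRm _).mul (by fun_prop)).ennreal_ofReal]
  refine lintegral_mono fun y => ?_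
  dsimp only
  have hE := (invRef_pos S y).le
  rw [← ENNReal.ofReal_sum_of_nonneg fun w _ => mul_nonneg (div_nonneg (hR _ _)
      (mix_nonneg _ _ _ _ _)) (mul_nonneg (lik_pos _ _ _ _).le hE),
    ← ENNReal.ofReal_sum_of_nonneg fun c _ => mul_nonneg (hR _ _) hE]
  refine ENNReal.ofReal_le_ofReal ?_
  -- On the fibre of a label the likelihoods add up to the mixture in the denominator. There is only
  -- an inequality because the mixture vanishes at labels that no input has.
  rw [← Finset.sum_fiberwise (s := Finset.univ) (g := κ)]
  refine Finset.sum_le_sum fun c _ => ?_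
  have : ∑ w with κ w = c, R (κ w) y / mix μ κ S (κ w) y * (lik μ S w y * invRef S y) =
      R c y * invRef S y * (mix μ κ S c y / mix μ κ S c y) := by
    calc _ = ∑ w with κ w = c, (R c y * invRef S y / mix μ κ S c y) * lik μ S w y :=
          Finset.sum_congr rfl fun w hw => by rw [(Finset.mem_filter.1 hw).2]; ring
      _ = _ := by
          rw [← Finset.mul_sum, mix, Finset.sum_filter]
          ring
  rw [this]
  exact mul_le_of_le_one_right (mul_nonneg (hR _ _) hE) (div_self_le_one _)

end Mixture

/-! ### Likelihood ratios of mean at most one. -/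

section MixtureBounds
variable {W K K' A B : Type*} [Fintype W] [Fintype K] [Fintype B] [Fintype A] [DecidableEq K]
  [DecidableEq K'] [DecidableEq A] [DecidableEq B]
variable (μ : W → A → ℂ) (κ : W → K)

/-- Conditional mutual information of two disjoint sets of outputs (the first one enlarged by a
finer label) is nonnegative, in the form of a bound on the mean likelihood ratio. -/
theorem sum_lintegral_submodular_le (g : K → K') {S T U : Finset A}
    (hU : Disjoint (S ∪ T) U) :
    ∑ w, ∫⁻ z, ENNReal.ofReal (mix μ κ (S ∪ T) (κ w) (μ w + z) *
        mix μ (g ∘ κ) (S ∪ U) (g (κ w)) (μ w + z) / mix μ (g ∘ κ) S (g (κ w)) (μ w + z) /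
        mix μ κ (S ∪ T ∪ U) (κ w) (μ w + z)) ∂noise A ≤ Fintype.card W := by
  have hSU : Disjoint S U := hU.mono_left Finset.subset_union_left
  -- The reference density makes `U` conditionally independent of the label and `T`, given the
  -- coarse label and `S`.
  set R : K → (A → ℂ) → ℝ := fun c y =>
    mix μ κ (S ∪ T) c y * mix μ (g ∘ κ) (S ∪ U) (g c) y / mix μ (g ∘ κ) S (g c) y with hRdef
  refine (sum_lintegral_div_mix_le μ κ (S ∪ T ∪ U) (R := R) (fun c => by
    simp only [hRdef]; fun_prop) (fun c y => div_nonneg (mul_nonneg (mix_nonneg _ _ _ _ _)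
      (mix_nonneg _ _ _ _ _)) (mix_nonneg _ _ _ _ _)) fun c x y h => ?_).trans ?_
  · simp only [hRdef]
    rw [dependsOn_mix μ κ (S ∪ T) c fun a ha => h a (by simp at ha ⊢; tauto),
      dependsOn_mix μ (g ∘ κ) (S ∪ U) (g c) fun a ha => h a (by simp at ha ⊢; tauto),
      dependsOn_mix μ (g ∘ κ) S (g c) fun a ha => h a (by simp at ha ⊢; tauto)]
  rw [← sum_lintegral_mix_mul_invRef μ κ (S ∪ T)]
  refine Finset.sum_le_sum fun c _ => ?_
  -- The factor on `S ∪ U` is expanded over its inputs `w'`. Each summand then depends on `U` only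
  -- through `tilt U (μ w')`, which integrates to one and leaves `h w'`.
  set h : W → (A → ℂ) → ℝ := fun w' y => (mix μ κ (S ∪ T) c y / mix μ (g ∘ κ) S (g c) y) *
    (if (g ∘ κ) w' = g c then lik μ S w' y else 0) * invRef (S ∪ T) y with hdef
  have hh : ∀ w' y, 0 ≤ h w' y := fun w' y => by
    refine mul_nonneg (mul_nonneg (div_nonneg (mix_nonneg _ _ _ _ _) (mix_nonneg _ _ _ _ _)) ?_)
      (invRef_pos _ _).le
    split_ifs; exacts [(lik_pos _ _ _ _).le, le_rfl]
  have hhm : ∀ w', Measurable (h w') := fun w' => by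
    simp only [hdef]; split_ifs <;> fun_prop
  have hhd : ∀ w', DependsOn (h w') (U : Set A)ᶜ := fun w' x y hxy => by
    have h1 : ∀ a ∈ S ∪ T, x a = y a := fun a ha =>
      hxy a fun haU => Finset.disjoint_left.1 hU ha haU
    have h2 : ∀ a ∈ S, x a = y a := fun a ha => h1 a (Finset.mem_union_left _ ha)
    simp only [hdef]
    rw [dependsOn_mix μ κ (S ∪ T) c h1, dependsOn_mix μ (g ∘ κ) S (g c) h2,
      dependsOn_lik μ S w' h2, dependsOn_invRef (S ∪ T) h1]
  calc ∫⁻ y, ENNReal.ofReal (R c y * invRef (S ∪ T ∪ U) y) ∂noise A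
      = ∫⁻ y, ∑ w', ENNReal.ofReal (h w' y) * ENNReal.ofReal (tilt U (μ w') y) ∂noise A := by
        refine lintegral_congr fun y => ?_
        simp_rw [← fun w' => ENNReal.ofReal_mul (q := tilt U (μ w') y) (hh w' y)]
        rw [← ENNReal.ofReal_sum_of_nonneg fun w' _ => mul_nonneg (hh w' y) (tilt_nonneg _ _ _)]
        congr 1
        simp only [hRdef, hdef]
        rw [invRef_union hU, mix, mix, mix, Finset.mul_sum, Finset.sum_div, Finset.sum_mul]
        refine Finset.sum_congr rfl fun w' _ => ?_
        rw [← lik_mul_invRef]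
        split_ifs
        · rw [lik_union μ hSU]; ring
        · simp
    _ = ∑ w', ∫⁻ y, ENNReal.ofReal (h w' y) ∂noise A := by
        rw [lintegral_finsetSum _ fun w' _ => by
          exact ((hhm w').ennreal_ofReal).mul (measurable_tilt _ _).ennreal_ofReal]
        refine Finset.sum_congr rfl fun w' _ => ?_
        refine lintegral_noise_mul_tilt_of_dependsOn _ (hhm w').ennreal_ofReal ?_
        intro x y hxy
        simp only [hhd w' hxy]
    _ = ∫⁻ y, ENNReal.ofReal (∑ w', h w' y) ∂noise A := by
        rw [← lintegral_finsetSum _ fun w' _ => by exact (hhm w').ennreal_ofReal]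
        simp_rw [ENNReal.ofReal_sum_of_nonneg fun w' _ => hh w' _]
    _ ≤ _ := by
        refine lintegral_mono fun y => ENNReal.ofReal_le_ofReal ?_
        simp only [hdef]
        rw [← Finset.sum_mul, ← Finset.mul_sum]
        refine mul_le_mul_of_nonneg_right ?_ (invRef_pos _ _).le
        change _ / _ * mix μ (g ∘ κ) S (g c) y ≤ _
        rw [div_mul_eq_mul_div, mul_div_assoc]
        exact mul_le_of_le_one_right (mix_nonneg _ _ _ _ _) (div_self_le_one _)

/-- Comparing one more output with a mixture of reference densities `k w'`. -/
theorem sum_lintegral_kernel_le {S : Finset A} {a : A} (ha : a ∉ S) {k : W → ℂ → ℝ}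
    (hkm : ∀ w, Measurable (k w)) (hk : ∀ w y, 0 ≤ k w y)
    (hkint : ∀ w, ∫⁻ y, ENNReal.ofReal (k w y) ≤ ENNReal.ofReal Real.pi) :
    ∑ w, ∫⁻ z, ENNReal.ofReal
        ((∑ w', if κ w' = κ w then lik μ S w' (μ w + z) * k w' ((μ w + z) a) else 0) /
        mix μ κ (insert a S) (κ w) (μ w + z)) ∂noise A ≤ Fintype.card W := by
  set R : K → (A → ℂ) → ℝ := fun c y =>
    ∑ w', if κ w' = c then lik μ S w' y * k w' (y a) else 0 with hRdef
  refine (sum_lintegral_div_mix_le μ κ (insert a S) (R := R) (fun c => ?_) (fun c y => ?_)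
    fun c x y h => ?_).trans ?_
  · simp only [hRdef]
    refine Finset.measurable_sum _ fun w _ => ?_
    have := hkm w
    split_ifs <;> fun_prop
  · refine Finset.sum_nonneg fun w _ => ?_
    split_ifs; exacts [mul_nonneg (lik_pos _ _ _ _).le (hk _ _), le_rfl]
  · simp only [hRdef]
    refine Finset.sum_congr rfl fun w _ => ?_
    rw [dependsOn_lik μ S w fun a ha => h a (by simp at ha ⊢; tauto), h a (by simp)]
  -- The likelihood on `S` is integrated out first; the remaining integral of `k w'` is at most `π`,
  -- which cancels the normalisation of the Gaussian reference.
  have hone : ∀ w', ∫⁻ y, ENNReal.ofReal (lik μ S w' y * k w' (y a) * invRef (insert a S) y)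
      ∂noise A ≤ 1 := fun w' => by
    have hk' := hkm w'
    calc _ = ∫⁻ y, ENNReal.ofReal (k w' (y a) * Real.exp (‖y a‖ ^ 2)) *
            ENNReal.ofReal (tilt S (μ w') y) ∂noise A := by
          refine lintegral_congr fun y => ?_
          rw [← ENNReal.ofReal_mul (mul_nonneg (hk _ _) (Real.exp_pos _).le), ← lik_mul_invRef]
          congr 1
          rw [invRef, Finset.prod_insert ha, ← invRef]
          ring
      _ = ∫⁻ y, ENNReal.ofReal (k w' (y a) * Real.exp (‖y a‖ ^ 2)) ∂noise A := by
          refine lintegral_noise_mul_tilt_of_dependsOn _ (by fun_prop) fun x y hxy => ?_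
          simp only [hxy a (by simpa using ha)]
      _ = ENNReal.ofReal Real.pi⁻¹ * ∫⁻ y, ENNReal.ofReal (k w' y) := by
          rw [lintegral_noise_eval a
            (g := fun y => ENNReal.ofReal (k w' y * Real.exp (‖y‖ ^ 2))) (by fun_prop),
            lintegral_complexGaussian_mul_exp hk']
      _ ≤ ENNReal.ofReal Real.pi⁻¹ * ENNReal.ofReal Real.pi := mul_le_mul_right (hkint w') _
      _ = 1 := by
          rw [← ENNReal.ofReal_mul (by positivity), inv_mul_cancel₀ Real.pi_ne_zero,
            ENNReal.ofReal_one]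
  calc _ = ∑ c, ∑ w', if κ w' = c then ∫⁻ y, ENNReal.ofReal
            (lik μ S w' y * k w' (y a) * invRef (insert a S) y) ∂noise A else 0 := by
        refine Finset.sum_congr rfl fun c _ => ?_
        have : ∀ y, ENNReal.ofReal (R c y * invRef (insert a S) y) = ∑ w', if κ w' = c then
            ENNReal.ofReal (lik μ S w' y * k w' (y a) * invRef (insert a S) y) else 0 := by
          intro y
          simp only [hRdef]
          rw [Finset.sum_mul, ENNReal.ofReal_sum_of_nonneg]
          · refine Finset.sum_congr rfl fun w' _ => ?_
            split_ifs <;> simp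
          · intro w' _
            split_ifs
            · exact mul_nonneg (mul_nonneg (lik_pos _ _ _ _).le (hk _ _)) (invRef_pos _ _).le
            · simp
        simp_rw [this]
        rw [lintegral_finsetSum]
        · refine Finset.sum_congr rfl fun w' _ => ?_
          split_ifs <;> simp
        · intro w' _
          have := hkm w'
          split_ifs <;> fun_prop
    _ = ∑ w', ∫⁻ y, ENNReal.ofReal
            (lik μ S w' y * k w' (y a) * invRef (insert a S) y) ∂noise A := by
        rw [Finset.sum_comm]
        simp
    _ ≤ ∑ _w' : W, 1 := Finset.sum_le_sum fun w' _ => hone w'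
    _ = _ := by simp

/-- Comparing a finer label `(κ, b)` with a conditional reference law `q` of `b`. -/
theorem sum_lintegral_refine_le {S : Finset A} (b : W → B) {q : K → (A → ℂ) → B → ℝ}
    (hqm : ∀ c b, Measurable fun y => q c y b) (hq : ∀ c y b, 0 ≤ q c y b)
    (hq1 : ∀ c y, ∑ b, q c y b ≤ 1) (hqd : ∀ c, DependsOn (q c) S) :
    ∑ w, ∫⁻ z, ENNReal.ofReal (mix μ κ S (κ w) (μ w + z) * q (κ w) (μ w + z) (b w) /
        mix μ (fun w => (κ w, b w)) S (κ w, b w) (μ w + z)) ∂noise A ≤ Fintype.card W := by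
  refine (sum_lintegral_div_mix_le μ (fun w => (κ w, b w)) S
    (R := fun c y => mix μ κ S c.1 y * q c.1 y c.2) (fun c => ?_) (fun c y => ?_)
    fun c x y h => ?_).trans ?_
  · have := hqm c.1 c.2
    fun_prop
  · exact mul_nonneg (mix_nonneg _ _ _ _ _) (hq _ _ _)
  · simp only [dependsOn_mix μ κ S c.1 h, hqd c.1 h]
  rw [← sum_lintegral_mix_mul_invRef μ κ S, Fintype.sum_prod_type]
  refine Finset.sum_le_sum fun c _ => ?_
  rw [← lintegral_finsetSum _ fun b _ => by
    have := hqm c b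
    fun_prop]
  refine lintegral_mono fun y => ?_
  dsimp only
  rw [← ENNReal.ofReal_sum_of_nonneg fun b _ => mul_nonneg (mul_nonneg (mix_nonneg _ _ _ _ _)
    (hq _ _ _)) (invRef_pos _ _).le]
  refine ENNReal.ofReal_le_ofReal ?_
  rw [← Finset.sum_mul, ← Finset.mul_sum]
  exact mul_le_mul_of_nonneg_right (mul_le_of_le_one_right (mix_nonneg _ _ _ _ _) (hq1 _ _))
    (invRef_pos _ _).le

end MixtureBounds

/-! ### From mean likelihood ratios to mean logarithms. -/

/-- A real function below a measurable function of bounded mean has bounded integral. -/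
theorem integral_le_of_le_of_lintegral_le {Ω : Type*} [MeasurableSpace Ω] {ρ : Measure Ω}
    {X T : Ω → ℝ} {c : ℝ} (hc : 0 ≤ c) (hX : Integrable X ρ) (h : ∀ ξ, X ξ ≤ T ξ)
    (hT : ∫⁻ ξ, ENNReal.ofReal (T ξ) ∂ρ ≤ ENNReal.ofReal c) : ∫ ξ, X ξ ∂ρ ≤ c := by
  calc ∫ ξ, X ξ ∂ρ ≤ ∫ ξ, max (X ξ) 0 ∂ρ :=
        integral_mono hX hX.pos_part fun ξ => le_max_left _ _
    _ = (∫⁻ ξ, ENNReal.ofReal (max (X ξ) 0) ∂ρ).toReal :=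
        integral_eq_lintegral_of_nonneg_ae (ae_of_all _ fun ξ => le_max_right _ _)
          hX.pos_part.aestronglyMeasurable
    _ ≤ (ENNReal.ofReal c).toReal := by
        refine ENNReal.toReal_mono ENNReal.ofReal_ne_top (le_trans (lintegral_mono fun ξ => ?_) hT)
        rcases le_total (X ξ) 0 with h0 | h0
        · simp [h0]
        · rw [max_eq_left h0]; exact ENNReal.ofReal_le_ofReal (h ξ)
    _ = c := ENNReal.toReal_ofReal hc

/-- Jensen's inequality in the form `log r ≤ r - 1`. The shift by 1 compares `X + 1` with the
nonnegative `r`, so only the lower integral of `r` matters. -/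
theorem integral_nonpos_of_le_log {Ω : Type*} [MeasurableSpace Ω] {ρ : Measure Ω}
    [IsProbabilityMeasure ρ] {X r : Ω → ℝ} (hX : Integrable X ρ) (hr : ∀ ξ, 0 < r ξ)
    (h : ∀ ξ, X ξ ≤ Real.log (r ξ)) (hint : ∫⁻ ξ, ENNReal.ofReal (r ξ) ∂ρ ≤ 1) :
    ∫ ξ, X ξ ∂ρ ≤ 0 := by
  have := integral_le_of_le_of_lintegral_le (ρ := ρ) zero_le_one (X := fun ξ => X ξ + 1) (T := r)
    (hX.add (integrable_const 1)) (fun ξ => by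
      have := Real.log_le_sub_one_of_pos (hr ξ)
      linarith [h ξ]) (by simpa using hint)
  rw [integral_add hX (integrable_const 1)] at this
  simp only [integral_const, probReal_univ, smul_eq_mul, mul_one] at this
  linarith

/-! ### Entropies of labels and outputs given the state. -/

section Model
variable {W Θ K K' B A : Type*} [Fintype W] [Nonempty W] [MeasurableSpace W]
  [MeasurableSingletonClass W] [MeasurableSpace Θ] [Fintype A]

/-- The law of a uniform input, an independent state of law `ν` and independent noise. -/
def mlaw (W A : Type*) [Fintype A] [MeasurableSpace W] (ν : Measure Θ) :
    Measure (W × Θ × (A → ℂ)) :=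
  (uniformOn (Set.univ : Set W)).prod (ν.prod (noise A))

/-- Outputs with means `μ` and additive noise. -/
def out (μ : Θ → W → A → ℂ) (ξ : W × Θ × (A → ℂ)) : A → ℂ := μ ξ.2.1 ξ.1 + ξ.2.2

variable (ν : Measure Θ) [IsProbabilityMeasure ν]

instance : IsProbabilityMeasure (mlaw W A ν) := by
  have : IsProbabilityMeasure (uniformOn (Set.univ : Set W)) :=
    isProbabilityMeasure_uniformOn Set.finite_univ Set.univ_nonempty
  unfold mlaw; infer_instance

theorem lintegral_mlaw {f : W × Θ × (A → ℂ) → ℝ≥0∞} (hf : Measurable f) :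
    ∫⁻ ξ, f ξ ∂mlaw W A ν =
      (Fintype.card W : ℝ≥0∞)⁻¹ * ∑ w, ∫⁻ θ, ∫⁻ z, f (w, θ, z) ∂noise A ∂ν := by
  have : IsProbabilityMeasure (uniformOn (Set.univ : Set W)) :=
    isProbabilityMeasure_uniformOn Set.finite_univ Set.univ_nonempty
  rw [mlaw, lintegral_prod _ hf.aemeasurable, uniformOn, ProbabilityTheory.cond,
    lintegral_smul_measure, Measure.restrict_univ, lintegral_fintype]
  congr 1
  · rw [Measure.count_apply_finite _ Set.finite_univ]
    simp
  · refine Finset.sum_congr rfl fun w _ => ?_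
    rw [Measure.count_singleton, mul_one, lintegral_prod]
    exact (hf.comp measurable_prodMk_left).aemeasurable

theorem lintegral_mlaw_le_one {f : W × Θ × (A → ℂ) → ℝ≥0∞} (hf : Measurable f)
    (h : ∀ θ, ∑ w, ∫⁻ z, f (w, θ, z) ∂noise A ≤ Fintype.card W) :
    ∫⁻ ξ, f ξ ∂mlaw W A ν ≤ 1 := by
  have hN : (Fintype.card W : ℝ≥0∞) ≠ 0 := by simp
  rw [lintegral_mlaw ν hf, ← lintegral_finsetSum]
  · calc _ ≤ (Fintype.card W : ℝ≥0∞)⁻¹ * ∫⁻ _, (Fintype.card W : ℝ≥0∞) ∂ν :=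
          mul_le_mul_right (lintegral_mono fun θ => h θ) _
      _ = 1 := by
          rw [lintegral_const, measure_univ, mul_one, ENNReal.inv_mul_cancel hN (by simp)]
  · intro w _
    exact Measurable.lintegral_prod_right' (f := fun p : Θ × (A → ℂ) => f (w, p.1, p.2))
      (hf.comp measurable_prodMk_left)

theorem lintegral_mlaw_noise {g : (A → ℂ) → ℝ≥0∞} (hg : Measurable g) :
    ∫⁻ ξ, g ξ.2.2 ∂mlaw W A ν = ∫⁻ z, g z ∂noise A := by
  have hN : (Fintype.card W : ℝ≥0∞) ≠ 0 := by simp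
  rw [lintegral_mlaw ν (by fun_prop)]
  simp only [lintegral_const, measure_univ, mul_one, Finset.sum_const, Finset.card_univ,
    nsmul_eq_mul]
  rw [← mul_assoc, ENNReal.inv_mul_cancel hN (by simp), one_mul]

theorem lintegral_mlaw_state {g : Θ → ℝ≥0∞} (hg : Measurable g) :
    ∫⁻ ξ, g ξ.2.1 ∂mlaw W A ν = ∫⁻ θ, g θ ∂ν := by
  have hN : (Fintype.card W : ℝ≥0∞) ≠ 0 := by simp
  rw [lintegral_mlaw ν (by fun_prop)]
  simp only [lintegral_const, measure_univ, mul_one, Finset.sum_const, Finset.card_univ,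
    nsmul_eq_mul]
  rw [← mul_assoc, ENNReal.inv_mul_cancel hN (by simp), one_mul]

theorem lintegral_mlaw_noise_norm_sq (a : A) :
    ∫⁻ ξ, ENNReal.ofReal (‖ξ.2.2 a‖ ^ 2) ∂mlaw W A ν = 1 := by
  rw [lintegral_mlaw_noise ν (g := fun z => ENNReal.ofReal (‖z a‖ ^ 2)) (by fun_prop),
    lintegral_noise_eval a (g := fun x => ENNReal.ofReal (‖x‖ ^ 2)) (by fun_prop),
    lintegral_norm_sq_complexGaussian, ENNReal.coe_one]

theorem integrable_noise_norm_sq (a : A) :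
    Integrable (fun ξ : W × Θ × (A → ℂ) => ‖ξ.2.2 a‖ ^ 2) (mlaw W A ν) := by
  refine ⟨(by fun_prop : Measurable _).aestronglyMeasurable, ?_⟩
  rw [hasFiniteIntegral_iff_ofReal (ae_of_all _ fun _ => sq_nonneg _),
    lintegral_mlaw_noise_norm_sq]
  exact ENNReal.one_lt_top

/-- Minus the logarithm of the joint density of the label and the outputs `S`, up to the
normalisation of the Gaussian density. -/
def info [DecidableEq K] (μ : Θ → W → A → ℂ) (κ : Θ → W → K) (S : Finset A)
    (ξ : W × Θ × (A → ℂ)) : ℝ :=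
  Real.log (Fintype.card W) - Real.log (mix (μ ξ.2.1) (κ ξ.2.1) S (κ ξ.2.1 ξ.1) (out μ ξ))

/-- Joint entropy of the label `κ` and the outputs `S` given the state, shifted by
`S.card * log π`. -/
def ent [DecidableEq K] (μ : Θ → W → A → ℂ) (κ : Θ → W → K) (S : Finset A) : ℝ :=
  ∫ ξ, info μ κ S ξ ∂mlaw W A ν

variable [DecidableEq K] [DecidableEq K'] [DecidableEq B] [MeasurableSpace K]
  [MeasurableSpace K'] [MeasurableSpace B] [DiscreteMeasurableSpace K]
  [DiscreteMeasurableSpace K'] [DiscreteMeasurableSpace B] [Countable K] [Countable K']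
  [Countable B]
  {μ : Θ → W → A → ℂ} (hμ : ∀ w a, Measurable fun θ => μ θ w a)
  {κ : Θ → W → K} (hκ : ∀ w, Measurable fun θ => κ θ w)

include hμ in
theorem measurable_out : Measurable (out μ : W × Θ × (A → ℂ) → A → ℂ) := by
  refine measurable_from_prod_countable_right fun w => measurable_pi_lambda _ fun a => ?_
  have := hμ w a
  simp only [out, Pi.add_apply]
  fun_prop

include hμ in
theorem measurable_lik_out (S : Finset A) (w : W) :
    Measurable fun ξ : W × Θ × (A → ℂ) => lik (μ ξ.2.1) S w (out μ ξ) := by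
  have h1 := measurable_out hμ
  unfold lik
  refine Finset.measurable_prod _ fun a _ => ?_
  have h2 := hμ w a
  fun_prop

include hκ in
theorem measurableSet_label_eq (w : W) :
    MeasurableSet {ξ : W × Θ × (A → ℂ) | κ ξ.2.1 w = κ ξ.2.1 ξ.1} := by
  have h2 : Measurable fun ξ : W × Θ × (A → ℂ) => κ ξ.2.1 ξ.1 :=
    measurable_from_prod_countable_right fun w => (hκ w).comp measurable_fst
  exact measurableSet_eq_fun ((hκ w).comp (by fun_prop)) h2

include hμ hκ in
theorem measurable_mix_out (S : Finset A) : Measurable fun ξ : W × Θ × (A → ℂ) =>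
    mix (μ ξ.2.1) (κ ξ.2.1) S (κ ξ.2.1 ξ.1) (out μ ξ) := by
  unfold mix
  exact Finset.measurable_sum _ fun w _ => Measurable.ite (measurableSet_label_eq hκ w)
    (measurable_lik_out hμ S w) measurable_const

theorem info_nonneg (S : Finset A) (ξ : W × Θ × (A → ℂ)) : 0 ≤ info μ κ S ξ :=
  sub_nonneg.2 (Real.log_le_log (mix_pos _ _ _ _ _) (mix_le_card _ _ _ _ _))

/-- The true input alone contributes `exp (-∑ ‖z a‖²)` to the mixture. With `info_nonneg` this makes
every `info` integrable, whatever the size of the means. -/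
theorem info_le (S : Finset A) (ξ : W × Θ × (A → ℂ)) :
    info μ κ S ξ ≤ Real.log (Fintype.card W) + ∑ a ∈ S, ‖ξ.2.2 a‖ ^ 2 := by
  have h := Real.log_le_log (lik_pos (μ ξ.2.1) S ξ.1 (out μ ξ))
    (lik_le_mix (μ ξ.2.1) (κ ξ.2.1) S ξ.1 (out μ ξ))
  have h2 : Real.log (lik (μ ξ.2.1) S ξ.1 (out μ ξ)) = -∑ a ∈ S, ‖ξ.2.2 a‖ ^ 2 := by
    rw [lik, ← Real.exp_sum, Real.log_exp, Finset.sum_neg_distrib]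
    simp [out]
  rw [info]
  linarith

include hμ hκ in
theorem measurable_info (S : Finset A) : Measurable (info μ κ S) :=
  measurable_const.sub (measurable_mix_out hμ hκ S).log

include hμ hκ in
theorem integrable_info (S : Finset A) : Integrable (info μ κ S) (mlaw W A ν) := by
  refine Integrable.mono' (g := fun ξ => Real.log (Fintype.card W) + ∑ a ∈ S, ‖ξ.2.2 a‖ ^ 2)
    ((integrable_const _).add (integrable_finsetSum _ fun a _ => integrable_noise_norm_sq ν a))
    (measurable_info hμ hκ S).aestronglyMeasurable (ae_of_all _ fun ξ => ?_)
  rw [Real.norm_of_nonneg (info_nonneg S ξ)]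
  exact info_le S ξ

/-- The joint entropy depends on the label only through the partition it induces. -/
theorem ent_congr {κ' : Θ → W → K'} (S : Finset A)
    (h : ∀ θ w w', κ θ w' = κ θ w ↔ κ' θ w' = κ' θ w) : ent ν μ κ S = ent ν μ κ' S := by
  unfold ent info mix
  simp_rw [h]

-- Holds pointwise: a coarser label adds more likelihoods into the mixture.
include hμ hκ in
theorem ent_le_ent_of_refines {κ' : Θ → W → K'} (hκ' : ∀ w, Measurable fun θ => κ' θ w)
    (S : Finset A) (h : ∀ θ w w', κ θ w' = κ θ w → κ' θ w' = κ' θ w) :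
    ent ν μ κ' S ≤ ent ν μ κ S := by
  refine integral_mono (integrable_info ν hμ hκ' S) (integrable_info ν hμ hκ S) fun ξ => ?_
  refine sub_le_sub_left (Real.log_le_log (mix_pos _ _ _ _ _) ?_) _
  refine Finset.sum_le_sum fun w _ => ?_
  by_cases hw : κ ξ.2.1 w = κ ξ.2.1 ξ.1
  · rw [if_pos hw, if_pos (h _ _ _ hw)]
  · rw [if_neg hw]
    split_ifs
    exacts [(lik_pos _ _ _ _).le, le_rfl]

include hμ hκ in
/-- Outputs do not decrease the (shifted) joint entropy. -/
theorem ent_empty_le (S : Finset A) : ent ν μ κ ∅ ≤ ent ν μ κ S := by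
  refine integral_mono (integrable_info ν hμ hκ ∅) (integrable_info ν hμ hκ S) fun ξ => ?_
  refine sub_le_sub_left (Real.log_le_log (mix_pos _ _ _ _ _) ?_) _
  refine Finset.sum_le_sum fun w _ => ?_
  split_ifs
  exacts [(lik_le_one _ _ _ _).trans (by simp [lik]), le_rfl]

variable [DecidableEq A] [Fintype K] [Fintype B]

-- Nonnegativity of the conditional mutual information of `(κ, T)` and `U` given `(g κ, S)`. With `g
-- = id` it is submodularity in the outputs; with `T = ∅` it says that further outputs cannot raise
-- the conditional entropy of `κ` given `g κ`.
include hμ hκ in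
theorem ent_submodular (g : K → K') {S T U : Finset A} (hU : Disjoint (S ∪ T) U) :
    ent ν μ κ (S ∪ T ∪ U) + ent ν μ (fun θ w => g (κ θ w)) S ≤
      ent ν μ κ (S ∪ T) + ent ν μ (fun θ w => g (κ θ w)) (S ∪ U) := by
  have hg : ∀ w, Measurable fun θ => g (κ θ w) := fun w =>
    (measurable_of_countable g).comp (hκ w)
  have i1 := integrable_info ν hμ hκ (S ∪ T ∪ U)
  have i2 := integrable_info ν hμ hg S
  have i3 := integrable_info ν hμ hκ (S ∪ T)
  have i4 := integrable_info ν hμ hg (S ∪ U)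
  have m1 := measurable_mix_out hμ hκ (S ∪ T ∪ U)
  have m2 := measurable_mix_out hμ hg S
  have m3 := measurable_mix_out hμ hκ (S ∪ T)
  have m4 := measurable_mix_out hμ hg (S ∪ U)
  have p1 := fun ξ : W × Θ × (A → ℂ) =>
    mix_pos (μ ξ.2.1) (κ ξ.2.1) (S ∪ T ∪ U) ξ.1 (out μ ξ)
  have p2 := fun ξ : W × Θ × (A → ℂ) =>
    mix_pos (μ ξ.2.1) (fun w => g (κ ξ.2.1 w)) S ξ.1 (out μ ξ)
  have p3 := fun ξ : W × Θ × (A → ℂ) => mix_pos (μ ξ.2.1) (κ ξ.2.1) (S ∪ T) ξ.1 (out μ ξ)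
  have p4 := fun ξ : W × Θ × (A → ℂ) =>
    mix_pos (μ ξ.2.1) (fun w => g (κ ξ.2.1 w)) (S ∪ U) ξ.1 (out μ ξ)
  have key := integral_nonpos_of_le_log (((i1.add i2).sub i3).sub i4)
    (r := fun ξ => mix (μ ξ.2.1) (κ ξ.2.1) (S ∪ T) (κ ξ.2.1 ξ.1) (out μ ξ) *
      mix (μ ξ.2.1) (fun w => g (κ ξ.2.1 w)) (S ∪ U) (g (κ ξ.2.1 ξ.1)) (out μ ξ) /
      mix (μ ξ.2.1) (fun w => g (κ ξ.2.1 w)) S (g (κ ξ.2.1 ξ.1)) (out μ ξ) /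
      mix (μ ξ.2.1) (κ ξ.2.1) (S ∪ T ∪ U) (κ ξ.2.1 ξ.1) (out μ ξ))
    (fun ξ => div_pos (div_pos (mul_pos (p3 ξ) (p4 ξ)) (p2 ξ)) (p1 ξ)) (fun ξ => ?_) ?_
  · rw [integral_sub' ((i1.add i2).sub i3) i4, integral_sub' (i1.add i2) i3,
      integral_add' i1 i2] at key
    unfold ent
    linarith
  · rw [Real.log_div (div_pos (mul_pos (p3 ξ) (p4 ξ)) (p2 ξ)).ne' (p1 ξ).ne',
      Real.log_div (mul_pos (p3 ξ) (p4 ξ)).ne' (p2 ξ).ne', Real.log_mul (p3 ξ).ne' (p4 ξ).ne']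
    simp only [Pi.add_apply, Pi.sub_apply, info]
    linarith
  · refine lintegral_mlaw_le_one ν (((m3.mul m4).div m2).div m1).ennreal_ofReal fun θ => ?_
    exact sum_lintegral_submodular_le (μ θ) (κ θ) g hU

include hμ hκ in
/-- Gibbs' inequality for a refinement of the label: the entropy grows at most by the mean of
`-log q` for any conditional law `q` of the refinement. -/
theorem ent_refine_le {S : Finset A} {b : Θ → W → B} (hb : ∀ w, Measurable fun θ => b θ w)
    {q : Θ → K → (A → ℂ) → B → ℝ}
    (hqm : ∀ c b, Measurable fun p : Θ × (A → ℂ) => q p.1 c p.2 b)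
    (hq : ∀ θ c y b, 0 < q θ c y b) (hq1 : ∀ θ c y, ∑ b, q θ c y b ≤ 1)
    (hqd : ∀ θ c, DependsOn (q θ c) S) {F : W × Θ × (A → ℂ) → ℝ}
    (hF : Integrable F (mlaw W A ν))
    (hqF : ∀ ξ, -Real.log (q ξ.2.1 (κ ξ.2.1 ξ.1) (out μ ξ) (b ξ.2.1 ξ.1)) ≤ F ξ) :
    ent ν μ (fun θ w => (κ θ w, b θ w)) S ≤ ent ν μ κ S + ∫ ξ, F ξ ∂mlaw W A ν := by
  have hκb : ∀ w, Measurable fun θ => (κ θ w, b θ w) := fun w => (hκ w).prodMk (hb w)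
  have i1 := integrable_info ν hμ hκb S
  have i2 := integrable_info ν hμ hκ S
  have m1 := measurable_mix_out hμ hκb S
  have m2 := measurable_mix_out hμ hκ S
  have p1 := fun ξ : W × Θ × (A → ℂ) =>
    mix_pos (μ ξ.2.1) (fun w => (κ ξ.2.1 w, b ξ.2.1 w)) S ξ.1 (out μ ξ)
  have p2 := fun ξ : W × Θ × (A → ℂ) => mix_pos (μ ξ.2.1) (κ ξ.2.1) S ξ.1 (out μ ξ)
  have m3 : Measurable fun ξ : W × Θ × (A → ℂ) =>
      q ξ.2.1 (κ ξ.2.1 ξ.1) (out μ ξ) (b ξ.2.1 ξ.1) := by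
    refine measurable_from_prod_countable_right fun w => ?_
    have h1 : Measurable fun p : (Θ × (A → ℂ)) × (K × B) => q p.1.1 p.2.1 p.1.2 p.2.2 :=
      measurable_from_prod_countable_left fun cb => hqm cb.1 cb.2
    have h2 : Measurable fun p : Θ × (A → ℂ) => out μ (w, p) :=
      (measurable_out hμ).comp measurable_prodMk_left
    exact h1.comp ((measurable_fst.prodMk h2).prodMk
      (((hκ w).comp measurable_fst).prodMk ((hb w).comp measurable_fst)))
  have key := integral_nonpos_of_le_log ((i1.sub i2).sub hF)
    (r := fun ξ => mix (μ ξ.2.1) (κ ξ.2.1) S (κ ξ.2.1 ξ.1) (out μ ξ) *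
      q ξ.2.1 (κ ξ.2.1 ξ.1) (out μ ξ) (b ξ.2.1 ξ.1) /
      mix (μ ξ.2.1) (fun w => (κ ξ.2.1 w, b ξ.2.1 w)) S (κ ξ.2.1 ξ.1, b ξ.2.1 ξ.1) (out μ ξ))
    (fun ξ => div_pos (mul_pos (p2 ξ) (hq _ _ _ _)) (p1 ξ)) (fun ξ => ?_) ?_
  · rw [integral_sub' (i1.sub i2) hF, integral_sub' i1 i2] at key
    unfold ent
    linarith
  · rw [Real.log_div (mul_pos (p2 ξ) (hq _ _ _ _)).ne' (p1 ξ).ne',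
      Real.log_mul (p2 ξ).ne' (hq _ _ _ _).ne']
    simp only [Pi.sub_apply, info]
    linarith [hqF ξ]
  · refine lintegral_mlaw_le_one ν ((m2.mul m3).div m1).ennreal_ofReal fun θ => ?_
    exact sum_lintegral_refine_le (μ θ) (κ θ) (b θ) (q := q θ)
      (fun c b => (hqm c b).comp measurable_prodMk_left) (fun c y b => (hq _ _ _ _).le) (hq1 θ)
      (hqd θ)

include hμ hκ in
theorem ent_refine_le_add_log_card [Nonempty B] (S : Finset A) {b : Θ → W → B}
    (hb : ∀ w, Measurable fun θ => b θ w) :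
    ent ν μ (fun θ w => (κ θ w, b θ w)) S ≤ ent ν μ κ S + Real.log (Fintype.card B) := by
  have hN : (0 : ℝ) < Fintype.card B := by exact_mod_cast Fintype.card_pos
  have h := ent_refine_le ν hμ hκ (S := S) hb (q := fun _ _ _ _ => (Fintype.card B : ℝ)⁻¹)
    (fun _ _ => measurable_const) (fun _ _ _ _ => inv_pos.2 hN)
    (fun _ _ _ => by simp) (fun _ _ _ _ _ => rfl)
    (F := fun _ => Real.log (Fintype.card B)) (integrable_const _) (fun ξ => by simp)
  simpa using h

include hμ hκ in
/-- Fano's inequality. -/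
theorem ent_refine_le_of_decoder [Nonempty B] {S : Finset A} {b : Θ → W → B}
    (hb : ∀ w, Measurable fun θ => b θ w) {g : Θ → K → (A → ℂ) → B}
    (hgm : ∀ c, Measurable fun p : Θ × (A → ℂ) => g p.1 c p.2)
    (hgd : ∀ θ c, DependsOn (g θ c) S) :
    ent ν μ (fun θ w => (κ θ w, b θ w)) S ≤ ent ν μ κ S + Real.log 2 +
      (mlaw W A ν).real {ξ | g ξ.2.1 (κ ξ.2.1 ξ.1) (out μ ξ) ≠ b ξ.2.1 ξ.1} *
        Real.log (Fintype.card B) := by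
  have hN : (0 : ℝ) < Fintype.card B := by exact_mod_cast Fintype.card_pos
  have hN1 : (1 : ℝ) ≤ Fintype.card B := by exact_mod_cast Fintype.card_pos
  set E : Set (W × Θ × (A → ℂ)) := {ξ | g ξ.2.1 (κ ξ.2.1 ξ.1) (out μ ξ) ≠ b ξ.2.1 ξ.1} with hE
  have hEm : MeasurableSet E := by
    have h3 : Measurable fun ξ : W × Θ × (A → ℂ) => g ξ.2.1 (κ ξ.2.1 ξ.1) (out μ ξ) := by
      refine measurable_from_prod_countable_right fun w => ?_
      have h1 : Measurable fun p : (Θ × (A → ℂ)) × K => g p.1.1 p.2 p.1.2 :=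
        measurable_from_prod_countable_left fun c => hgm c
      have h2 : Measurable fun p : Θ × (A → ℂ) => out μ (w, p) :=
        (measurable_out hμ).comp measurable_prodMk_left
      exact h1.comp ((measurable_fst.prodMk h2).prodMk ((hκ w).comp measurable_fst))
    have h4 : Measurable fun ξ : W × Θ × (A → ℂ) => b ξ.2.1 ξ.1 :=
      measurable_from_prod_countable_right fun w => (hb w).comp measurable_fst
    exact (measurableSet_eq_fun h3 h4).compl
  have hFi : Integrable (E.indicator fun _ => Real.log (Fintype.card B)) (mlaw W A ν) :=
    (integrable_const _).indicator hEm
  -- `q` puts half of its mass on the decoded value and spreads the other half uniformly: the cost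
  -- is at most `log 2` when decoding succeeds and `log 2 + log |B|` otherwise.
  have h := ent_refine_le ν hμ hκ (S := S) hb
    (q := fun θ c y b => (if g θ c y = b then 1 / 2 else 0) + 1 / 2 * (Fintype.card B : ℝ)⁻¹)
    (fun c b => ?_) (fun θ c y b => ?_) (fun θ c y => ?_) (fun θ c x y hxy => ?_)
    (F := fun ξ => Real.log 2 + E.indicator (fun _ => Real.log (Fintype.card B)) ξ)
    ((integrable_const _).add hFi) (fun ξ => ?_)
  · rw [integral_add (integrable_const _) hFi, integral_indicator_const _ hEm] at h
    simpa [add_assoc] using h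
  · refine Measurable.add (Measurable.ite ?_ measurable_const measurable_const) measurable_const
    exact (hgm c) (measurableSet_singleton b)
  · have : (0 : ℝ) < 1 / 2 * (Fintype.card B : ℝ)⁻¹ := by positivity
    split_ifs <;> linarith
  · rw [Finset.sum_add_distrib]
    simp only [Finset.sum_ite_eq, Finset.mem_univ, if_true, Finset.sum_const, Finset.card_univ,
      nsmul_eq_mul]
    rw [mul_left_comm, mul_inv_cancel₀ hN.ne']
    norm_num
  · simp only [hgd θ c hxy]
  · by_cases hξ : ξ ∈ E
    · rw [Set.indicator_of_mem hξ]
      have : ¬ g ξ.2.1 (κ ξ.2.1 ξ.1) (out μ ξ) = b ξ.2.1 ξ.1 := hξ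
      rw [if_neg this, zero_add, Real.log_mul (by norm_num) (inv_pos.2 hN).ne']
      simp
      linarith
    · rw [Set.indicator_of_notMem hξ]
      have : g ξ.2.1 (κ ξ.2.1 ξ.1) (out μ ξ) = b ξ.2.1 ξ.1 := not_not.1 hξ
      rw [if_pos this, add_zero, neg_le, ← Real.log_inv]
      refine Real.log_le_log (by norm_num) ?_
      have : (0 : ℝ) < 1 / 2 * (Fintype.card B : ℝ)⁻¹ := by positivity
      linarith

/-- The joint density of label and outputs with the likelihood of output `a` replaced by the
reference densities `k`. -/
def kernelMix (μ : Θ → W → A → ℂ) (κ : Θ → W → K) (S : Finset A) (a : A) (k : Θ → W → ℂ → ℝ)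
    (ξ : W × Θ × (A → ℂ)) : ℝ :=
  ∑ w', if κ ξ.2.1 w' = κ ξ.2.1 ξ.1 then lik (μ ξ.2.1) S w' (out μ ξ) * k ξ.2.1 w' (out μ ξ a)
    else 0

include hμ hκ in
theorem measurable_kernelMix {S : Finset A} {a : A} {k : Θ → W → ℂ → ℝ}
    (hkm : ∀ w, Measurable fun p : Θ × ℂ => k p.1 w p.2) :
    Measurable (kernelMix μ κ S a k) := by
  refine Finset.measurable_sum _ fun w _ => Measurable.ite (measurableSet_label_eq hκ w)
    ((measurable_lik_out hμ S w).mul ?_) measurable_const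
  exact (hkm w).comp ((by fun_prop : Measurable fun ξ : W × Θ × (A → ℂ) => ξ.2.1).prodMk
    ((measurable_pi_apply a).comp (measurable_out hμ)))

include hμ hκ in
theorem lintegral_kernelMix_div_le {S : Finset A} {a : A} (ha : a ∉ S) {k : Θ → W → ℂ → ℝ}
    (hkm : ∀ w, Measurable fun p : Θ × ℂ => k p.1 w p.2) (hk : ∀ θ w y, 0 ≤ k θ w y)
    (hkint : ∀ θ w, ∫⁻ y, ENNReal.ofReal (k θ w y) ≤ ENNReal.ofReal Real.pi) :
    ∫⁻ ξ, ENNReal.ofReal (kernelMix μ κ S a k ξ /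
      mix (μ ξ.2.1) (κ ξ.2.1) (insert a S) (κ ξ.2.1 ξ.1) (out μ ξ)) ∂mlaw W A ν ≤ 1 := by
  refine lintegral_mlaw_le_one ν ((measurable_kernelMix hμ hκ hkm).div
    (measurable_mix_out hμ hκ _)).ennreal_ofReal fun θ => ?_
  have h := sum_lintegral_kernel_le (μ θ) (κ θ) ha (k := k θ)
    (fun w => (hkm w).comp measurable_prodMk_left) (hk θ) (hkint θ)
  simpa only [kernelMix, out] using h

include hμ hκ in
/-- One more output adds at most the mean of `-log k` for any reference density `k`. -/
theorem ent_insert_le {S : Finset A} {a : A} (ha : a ∉ S) {k : ℂ → ℝ} (hkm : Measurable k)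
    (hk : ∀ y, 0 < k y) (hkint : ∫⁻ y, ENNReal.ofReal (k y) ≤ ENNReal.ofReal Real.pi)
    {F : W × Θ × (A → ℂ) → ℝ} (hF0 : ∀ ξ, 0 ≤ F ξ) {c : ℝ} (hc : 0 ≤ c)
    (hF : ∫⁻ ξ, ENNReal.ofReal (F ξ) ∂mlaw W A ν ≤ ENNReal.ofReal c)
    (hkF : ∀ ξ, -Real.log (k (out μ ξ a)) ≤ F ξ) :
    ent ν μ κ (insert a S) ≤ ent ν μ κ S + c := by
  have i1 := integrable_info ν hμ hκ (insert a S)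
  have i2 := integrable_info ν hμ hκ S
  have m1 := measurable_mix_out hμ hκ (insert a S)
  have p1 := fun ξ : W × Θ × (A → ℂ) =>
    mix_pos (μ ξ.2.1) (κ ξ.2.1) (insert a S) ξ.1 (out μ ξ)
  have p2 := fun ξ : W × Θ × (A → ℂ) => mix_pos (μ ξ.2.1) (κ ξ.2.1) S ξ.1 (out μ ξ)
  have hkm' : ∀ w : W, Measurable fun p : Θ × ℂ => (fun (_ : Θ) (_ : W) y => k y) p.1 w p.2 :=
    fun w => hkm.comp measurable_snd
  have hmix : ∀ ξ, kernelMix μ κ S a (fun _ _ y => k y) ξ =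
      mix (μ ξ.2.1) (κ ξ.2.1) S (κ ξ.2.1 ξ.1) (out μ ξ) * k (out μ ξ a) := fun ξ => by
    rw [kernelMix, mix, Finset.sum_mul]
    exact Finset.sum_congr rfl fun w _ => by split_ifs <;> simp
  have hq := lintegral_kernelMix_div_le ν hμ hκ ha (k := fun _ _ y => k y) hkm' (fun _ _ y => (hk y).le)
    (fun _ _ => hkint)
  have m3 := (measurable_kernelMix hμ hκ (S := S) (a := a) (k := fun _ _ y => k y) hkm').div m1
  -- Adding 1 to the difference of the two `info` turns `log r ≤ r - 1` into the bound `r + F`, with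
  -- `r` of mean at most 1 and `F` of mean at most `c`.
  have key := integral_le_of_le_of_lintegral_le (add_nonneg zero_le_one hc)
    ((i1.sub i2).add (integrable_const 1))
    (T := fun ξ => kernelMix μ κ S a (fun _ _ y => k y) ξ /
      mix (μ ξ.2.1) (κ ξ.2.1) (insert a S) (κ ξ.2.1 ξ.1) (out μ ξ) + F ξ) (fun ξ => ?_) ?_
  · rw [integral_add' (i1.sub i2) (integrable_const 1), integral_sub' i1 i2] at key
    simp only [integral_const, probReal_univ, smul_eq_mul, mul_one] at key
    unfold ent
    linarith
  · have h1 := Real.log_le_sub_one_of_pos (div_pos (mul_pos (p2 ξ) (hk (out μ ξ a))) (p1 ξ))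
    rw [Real.log_div (mul_pos (p2 ξ) (hk _)).ne' (p1 ξ).ne',
      Real.log_mul (p2 ξ).ne' (hk _).ne'] at h1
    rw [hmix]
    simp only [Pi.add_apply, Pi.sub_apply, info]
    linarith [hkF ξ]
  · have hr0 : ∀ ξ, 0 ≤ kernelMix μ κ S a (fun _ _ y => k y) ξ /
      mix (μ ξ.2.1) (κ ξ.2.1) (insert a S) (κ ξ.2.1 ξ.1) (out μ ξ) := fun ξ => by
      rw [hmix]; exact (div_pos (mul_pos (p2 ξ) (hk _)) (p1 ξ)).le
    simp_rw [fun ξ => ENNReal.ofReal_add (hr0 ξ) (hF0 ξ)]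
    rw [lintegral_add_left (by exact m3.ennreal_ofReal), ENNReal.ofReal_add zero_le_one hc,
      ENNReal.ofReal_one]
    exact add_le_add hq hF

end Model

/-! ### Redrawing the current estimation error of one user. -/

theorem lintegral_pi_update {ι : Type*} [Fintype ι] [DecidableEq ι] {X : ι → Type*}
    [∀ i, MeasurableSpace (X i)] (μ : ∀ i, Measure (X i)) [∀ i, IsProbabilityMeasure (μ i)]
    (i : ι) {f : (∀ i, X i) → ℝ≥0∞} (hf : Measurable f) :
    ∫⁻ y, f y ∂Measure.pi μ = ∫⁻ y, ∫⁻ x, f (Function.update y i x) ∂μ i ∂Measure.pi μ := by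
  have h : (∫⋯∫⁻_{i}, f ∂μ) = fun y => ∫⁻ x, f (Function.update y i x) ∂μ i := by
    funext y
    rw [lmarginal_singleton]
  rw [← h]
  refine lintegral_eq_of_lmarginal_eq {i} hf (hf.lmarginal μ) ?_
  rw [lmarginal_singleton (∫⋯∫⁻_{i}, f ∂μ)]
  funext y
  rw [h]
  simp

/-- Adding to a signal `k` an independent error, conditionally on which the result is independent
of `g` given `k`: the error is then independent of `(k, g)`. -/
theorem lintegral_of_condIndepFun {Ω E G : Type*} [MeasurableSpace Ω] [StandardBorelSpace Ω]
    [AddCommGroup E] [MeasurableSpace E] [MeasurableAdd₂ E] [MeasurableSub₂ E]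
    [StandardBorelSpace E]
    [MeasurableSpace G] [StandardBorelSpace G] [Nonempty G]
    {μ : Measure Ω} [IsProbabilityMeasure μ] {k f : Ω → E} {g : Ω → G} (hk : Measurable k)
    (hf : Measurable f) (hg : Measurable g) (hind : IndepFun (fun ω => f ω - k ω) k μ)
    (hcond : CondIndepFun (MeasurableSpace.comap k inferInstance) hk.comap_le f g μ)
    {F : (E × G) × E → ℝ≥0∞} (hF : Measurable F) :
    ∫⁻ ω, F ((k ω, g ω), f ω) ∂μ =
      ∫⁻ ω, ∫⁻ e, F ((k ω, g ω), k ω + e) ∂(μ.map fun ω => f ω - k ω) ∂μ := by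
  have : Nonempty E := ⟨0⟩
  set Q := μ.map fun ω => f ω - k ω with hQ
  have hfk : Measurable fun ω => f ω - k ω := hf.sub hk
  have : IsProbabilityMeasure Q := Measure.isProbabilityMeasure_map hfk.aemeasurable
  -- `κ x` is the law of `x` plus a fresh error. Independence of error and `k` makes it the
  -- conditional law of `f` given `k`.
  set κ : Kernel E E := (Kernel.id ×ₖ Kernel.const E Q).map (fun p : E × E => p.1 + p.2) with hκ
  have hκm : IsMarkovKernel κ := Kernel.IsMarkovKernel.map _ (by fun_prop)
  have hκint : ∀ (x : E) (h : E → ℝ≥0∞), Measurable h → ∫⁻ y, h y ∂κ x = ∫⁻ e, h (x + e) ∂Q := by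
    intro x h hh
    rw [hκ, Kernel.lintegral_map _ (by fun_prop) _ hh, Kernel.prod_apply,
      lintegral_prod _ (by fun_prop), Kernel.id_apply,
      lintegral_dirac' _ (by
        exact Measurable.lintegral_prod_right' (f := fun p : E × E => h (p.1 + p.2))
          (by fun_prop))]
    simp
  have h1 : condDistrib f k μ =ᵐ[μ.map k] κ := by
    refine condDistrib_ae_eq_of_measure_eq_compProd k hf.aemeasurable ?_
    refine Measure.ext_of_lintegral _ fun h hh => ?_
    rw [lintegral_map hh (by fun_prop), Measure.lintegral_compProd hh, lintegral_map
      (by exact hh.lintegral_kernel_prod_right') hk]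
    have h2 := (indepFun_iff_map_prod_eq_prod_map_map hfk.aemeasurable hk.aemeasurable).1 hind
    have h3 : ∫⁻ ω, h (k ω, f ω) ∂μ =
        ∫⁻ p, h (p.2, p.2 + p.1) ∂(μ.map fun ω => (f ω - k ω, k ω)) := by
      rw [lintegral_map (by fun_prop) (by fun_prop)]
      simp
    rw [h3, h2, lintegral_prod_symm _ (by fun_prop), lintegral_map _ hk]
    · refine lintegral_congr fun ω => ?_
      rw [hκint _ _ (by fun_prop)]
    · exact Measurable.lintegral_prod_left' (f := fun p : E × E => h (p.2, p.2 + p.1))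
        (by fun_prop)
  -- Conditional independence: conditioning on `g` besides `k` leaves the conditional law of `f`
  -- unchanged.
  have h2 := (condIndepFun_iff_condDistrib_prod_ae_eq_prodMkRight hf hg hk).1 hcond.symm
  have h3 : ∀ᵐ ω ∂μ, condDistrib f (fun ω => (k ω, g ω)) μ (k ω, g ω) = κ (k ω) := by
    have a1 := ae_of_ae_map hk.aemeasurable h1
    have a2 := ae_of_ae_map (hk.prodMk hg).aemeasurable h2
    filter_upwards [a1, a2] with ω b1 b2
    rw [b2, Kernel.prodMkRight_apply, b1]
  have h4 := compProd_map_condDistrib (mβ := inferInstance) (X := fun ω => (k ω, g ω)) (Y := f) (μ := μ)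
    hf.aemeasurable
  have h5 : ∫⁻ ω, F ((k ω, g ω), f ω) ∂μ = ∫⁻ p, F p ∂(μ.map fun ω => ((k ω, g ω), f ω)) := by
    rw [lintegral_map hF (by fun_prop)]
  rw [h5, ← h4, Measure.lintegral_compProd hF,
    lintegral_map (by exact hF.lintegral_kernel_prod_right') (by fun_prop)]
  refine lintegral_congr_ae ?_
  filter_upwards [h3] with ω hω
  rw [hω, hκint _ _ (by fun_prop)]

section Resample
variable {s m : ℕ}

/-- The state path `ω` with the error of user `i`'s estimate in slot `t` replaced by `e`. -/
def resample (t : ℕ) (i : Fin s) (e : Fin m → ℂ) (ω : StatePath s m) : StatePath s m :=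
  Function.update ω t (Function.update (ω t).1 i ((ω t).2 i + e), (ω t).2)

@[fun_prop]
theorem measurable_estErr (t : ℕ) : Measurable (estErr t : StatePath s m → Chan s m) := by
  unfold estErr; fun_prop

variable {α : ℝ} {ν : ℝ → Measure (StatePath s m)} [∀ P, IsProbabilityMeasure (ν P)]

/-- Resampling the estimation error of one user in the last slot does not change the law of the
state path. -/
theorem lintegral_resample (hν : IsMixedCSIT α ν) {P : ℝ} (hP : 1 ≤ P) (t : ℕ) {v : Fin s → ℝ≥0}
    (hv : (ν P).map (estErr t) =
      Measure.pi (fun k : Fin s => Measure.pi (fun _ : Fin m => complexGaussian (v k))))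
    (i : Fin s) {f : StatePath s m → ℝ≥0∞} (hf : Measurable f) (hft : DependsOn f (Set.Iic t)) :
    ∫⁻ ω, f ω ∂ν P = ∫⁻ ω, ∫⁻ e, f (resample t i e ω)
      ∂Measure.pi (fun _ : Fin m => complexGaussian (v i)) ∂ν P := by
  have : StandardBorelSpace (Chan s m × Chan s m) := StandardBorelSpace.prod
  have : StandardBorelSpace (Fin t → Chan s m × Chan s m) := StandardBorelSpace.pi_countable
  set past : StatePath s m → (Fin t → Chan s m × Chan s m) := fun ω i => ((ω i).2, estErr i ω) with hpast
  have hpm : Measurable past := by fun_prop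
  have hres : ∀ ω : StatePath s m, estErr t ω = (ω t).1 - (ω t).2 := fun ω => rfl
  -- `rec` rebuilds the path up to slot `t` from the current estimate, the past estimates and
  -- errors, and the current channel. Later slots get a copy of slot `t`, which is harmless since
  -- `f` does not see them.
  set rec : (Chan s m × (Fin t → Chan s m × Chan s m)) × Chan s m → StatePath s m := fun p j =>
    if hj : j < t then ((p.1.2 ⟨j, hj⟩).1 + (p.1.2 ⟨j, hj⟩).2, (p.1.2 ⟨j, hj⟩).1)
    else (p.2, p.1.1) with hrec
  have hrm : Measurable rec := by
    refine measurable_pi_lambda _ fun j => ?_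
    by_cases hj : j < t
    · simp only [hrec, hj, dite_true]; fun_prop
    · simp only [hrec, hj, dite_false]; fun_prop
  have hfr : ∀ (ω : StatePath s m) (x : Chan s m),
      f (rec (((ω t).2, past ω), x)) = f (Function.update ω t (x, (ω t).2)) := fun ω x => by
    refine hft fun j hj => ?_
    rcases lt_or_eq_of_le (Set.mem_Iic.1 hj) with h | h
    · simp only [hrec, h, dite_true, Function.update_of_ne h.ne, hpast]
      ext <;> simp [estErr]
    · subst h; simp [hrec]
  have main := fun {F : (Chan s m × (Fin t → Chan s m × Chan s m)) × Chan s m → ℝ≥0∞} (hF : Measurable F) =>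
    lintegral_of_condIndepFun (μ := ν P) (k := fun ω : StatePath s m => (ω t).2)
      (f := fun ω : StatePath s m => (ω t).1) (g := past) (by fun_prop) (by fun_prop) hpm
      (hν.indep_error P hP t) (hν.condIndep_past P hP t) hF
  have hQ : ((ν P).map fun ω : StatePath s m => (ω t).1 - (ω t).2) =
    Measure.pi (fun k : Fin s => Measure.pi (fun _ : Fin m => complexGaussian (v k))) := hv
  rw [hQ] at main
  have e1 : ∫⁻ ω, f ω ∂ν P = ∫⁻ ω, (f ∘ rec) (((ω t).2, past ω), (ω t).1) ∂ν P := by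
    refine lintegral_congr fun ω => ?_
    rw [Function.comp_apply, hfr, Prod.mk.eta, Function.update_eq_self]
  have hG : Measurable fun p : (Chan s m × (Fin t → Chan s m × Chan s m)) × Chan s m => ∫⁻ e,
      (f ∘ rec) (p.1, Function.update p.2 i (p.1.1 i + e))
        ∂Measure.pi (fun _ : Fin m => complexGaussian (v i)) := by
    refine Measurable.lintegral_prod_right' (f := fun q : ((Chan s m × (Fin t → Chan s m × Chan s m)) × Chan s m) ×
      (Fin m → ℂ) => (f ∘ rec) (q.1.1, Function.update q.1.2 i (q.1.1.1 i + q.2))) ?_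
    refine (hf.comp hrm).comp (Measurable.prodMk (by fun_prop) (measurable_pi_lambda _ fun k => ?_))
    by_cases hk : k = i
    · subst hk; simp only [Function.update_self]; fun_prop
    · simp only [Function.update_of_ne hk]; fun_prop
  -- `main` is applied to `f` and then to its average over the redrawn error. Both sides become
  -- integrals over fresh errors of all users, whose product law is unchanged when coordinate `i` is
  -- redrawn.
  rw [e1, main (hf.comp hrm)]
  have e2 : ∀ ω : StatePath s m, ∫⁻ e, f (resample t i e ω)
      ∂Measure.pi (fun _ : Fin m => complexGaussian (v i)) =
      (fun p : (Chan s m × (Fin t → Chan s m × Chan s m)) × Chan s m => ∫⁻ e,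
      (f ∘ rec) (p.1, Function.update p.2 i (p.1.1 i + e))
        ∂Measure.pi (fun _ : Fin m => complexGaussian (v i))) (((ω t).2, past ω), (ω t).1) := by
    intro ω
    refine lintegral_congr fun e => ?_
    rw [Function.comp_apply, hfr]
    rfl
  simp_rw [e2]
  rw [main hG]
  refine lintegral_congr fun ω => ?_
  have hFm : Measurable fun e : Chan s m => (f ∘ rec) (((ω t).2, past ω), (ω t).2 + e) :=
    (hf.comp hrm).comp (by fun_prop)
  rw [lintegral_pi_update _ i hFm]
  refine lintegral_congr fun e => lintegral_congr fun x => ?_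
  congr 2
  funext k
  by_cases hk : k = i
  · subst hk; simp
  · simp [hk]

end Resample

/-! ### Norm estimates, averaged bumps and the reference density. -/

theorem normSq_nonneg {m : ℕ} (v : Fin m → ℂ) : 0 ≤ normSq v :=
  Finset.sum_nonneg fun _ _ => sq_nonneg _

@[fun_prop]
theorem measurable_normSq {m : ℕ} : Measurable (normSq : (Fin m → ℂ) → ℝ) := by
  unfold normSq; fun_prop

theorem norm_sum_mul_sq_le {m : ℕ} (h d : Fin m → ℂ) :
    ‖∑ j, h j * d j‖ ^ 2 ≤ normSq h * normSq d := by
  calc ‖∑ j, h j * d j‖ ^ 2 ≤ (∑ j, ‖h j‖ * ‖d j‖) ^ 2 := by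
        gcongr
        exact (norm_sum_le _ _).trans (le_of_eq (by simp))
    _ ≤ _ := Finset.sum_mul_sq_le_sq_mul_sq _ _ _

theorem one_add_norm_add_sq_le (a z : ℂ) : 1 + ‖a + z‖ ^ 2 ≤ 2 * (1 + ‖z‖ ^ 2) * (1 + ‖a‖ ^ 2) := by
  have h := norm_add_le a z
  have h0 := norm_nonneg (a + z)
  nlinarith [sq_nonneg (‖a‖ - ‖z‖), mul_nonneg (sq_nonneg ‖a‖) (sq_nonneg ‖z‖),
    norm_nonneg a, norm_nonneg z]

/-- Averaging a Gaussian bump over a random complex coefficient vector. -/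
theorem lintegral_exp_neg_norm_add_sum_sq_le {m : ℕ} (hm : 1 ≤ m) {v : ℝ≥0} (hv : 0 < v) (c : ℂ)
    (d : Fin m → ℂ) :
    ∫⁻ e, ENNReal.ofReal (Real.exp (-‖c + ∑ j, e j * d j‖ ^ 2))
        ∂Measure.pi (fun _ : Fin m => complexGaussian v) ≤
      ENNReal.ofReal (2 * m / (1 + v * normSq d)) := by
  have hvr : (0 : ℝ) < v := by exact_mod_cast hv
  have : Nonempty (Fin m) := ⟨⟨0, hm⟩⟩
  -- Averaging over the error entry at the largest coordinate of `d` suffices, since `‖d j‖² ≥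
  -- normSq d / m`; this is where the factor `m` arises.
  obtain ⟨j, -, hj⟩ := Finset.exists_max_image Finset.univ (fun j => ‖d j‖ ^ 2)
    Finset.univ_nonempty
  have hd : normSq d ≤ m * ‖d j‖ ^ 2 := by
    calc normSq d ≤ ∑ _j : Fin m, ‖d j‖ ^ 2 := Finset.sum_le_sum fun i hi => hj i hi
      _ = _ := by simp
  rw [lintegral_pi_update _ j (by fun_prop)]
  have hm1 : (1 : ℝ) ≤ m := by exact_mod_cast hm
  calc _ ≤ ∫⁻ _e, ENNReal.ofReal (2 * m / (1 + v * normSq d))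
        ∂Measure.pi (fun _ : Fin m => complexGaussian v) := by
        refine lintegral_mono fun e => ?_
        have hsum : ∀ x, c + ∑ i, Function.update e j x i * d i =
            (c + ∑ i ∈ Finset.univ.erase j, e i * d i) + x * d j := fun x => by
          rw [← Finset.add_sum_erase _ _ (Finset.mem_univ j), Function.update_self, add_assoc,
            add_comm (x * d j)]
          congr 2
          exact Finset.sum_congr rfl fun i hi => by
            rw [Function.update_of_ne (Finset.ne_of_mem_erase hi)]
        simp_rw [hsum]
        refine (lintegral_exp_neg_norm_add_mul_sq_le hv _ _).trans (ENNReal.ofReal_le_ofReal ?_)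
        have := normSq_nonneg d
        rw [div_le_div_iff₀ (by positivity) (by positivity)]
        nlinarith [mul_le_mul_of_nonneg_left hd hvr.le, sq_nonneg ‖d j‖]
    _ = _ := by simp

section Kernels

/-- Heavy-tailed reference density centred at `c`. -/
def tailKernel (η : ℝ) (c y : ℂ) : ℝ := η / 2 * ((1 + ‖y - c‖ ^ 2)⁻¹ * (1 + ‖y‖ ^ 2) ^ (-η))

theorem tailKernel_pos {η : ℝ} (hη : 0 < η) (c y : ℂ) : 0 < tailKernel η c y := by
  unfold tailKernel; positivity

/-- Replacing the larger of `a` and `b` by the smaller only increases the product. -/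
theorem inv_mul_rpow_neg_le {a b η : ℝ} (ha : 0 < a) (hb : 0 < b) (hη : 0 < η) :
    a⁻¹ * b ^ (-η) ≤ a ^ (-(1 + η)) + b ^ (-(1 + η)) := by
  have h : ∀ x : ℝ, 0 < x → x ^ (-(1 + η)) = x⁻¹ * x ^ (-η) := fun x hx => by
    rw [neg_add, Real.rpow_add hx, Real.rpow_neg_one]
  rcases le_total a b with hab | hab
  · have : a⁻¹ * b ^ (-η) ≤ a⁻¹ * a ^ (-η) := by
      gcongr ?_ * ?_
      exact Real.rpow_le_rpow_of_nonpos ha hab (by linarith)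
    rw [h a ha]
    have : 0 ≤ b ^ (-(1 + η)) := by positivity
    linarith
  · have : a⁻¹ * b ^ (-η) ≤ b⁻¹ * b ^ (-η) := by
      gcongr
    rw [h b hb]
    have : 0 ≤ a ^ (-(1 + η)) := by positivity
    linarith

/-- The factor `(1 + ‖y - c‖²)⁻¹` is needed to match the averaged bump, but is not integrable on the
plane. Integrability comes from the factor `(1 + ‖y‖²) ^ (-η)`, centred at 0 rather than at `c`, so
that its cost in `smear_le` is the same for all competing inputs. The kernel is dominated by two
copies of the integrable one, centred at `c` and at 0. -/
theorem lintegral_tailKernel_le {η : ℝ} (hη : 0 < η) (c : ℂ) :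
    ∫⁻ y, ENNReal.ofReal (tailKernel η c y) ≤ ENNReal.ofReal Real.pi := by
  calc ∫⁻ y, ENNReal.ofReal (tailKernel η c y)
      ≤ ∫⁻ y, (ENNReal.ofReal (η / 2) * ENNReal.ofReal ((1 + ‖y - c‖ ^ 2) ^ (-(1 + η))) +
          ENNReal.ofReal (η / 2) * ENNReal.ofReal ((1 + ‖y‖ ^ 2) ^ (-(1 + η)))) := by
        refine lintegral_mono fun y => ?_
        dsimp only
        rw [← mul_add, ← ENNReal.ofReal_add (by positivity) (by positivity),
          ← ENNReal.ofReal_mul (by positivity)]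
        refine ENNReal.ofReal_le_ofReal (mul_le_mul_of_nonneg_left ?_ (by positivity))
        exact inv_mul_rpow_neg_le (by positivity) (by positivity) hη
    _ = ENNReal.ofReal (η / 2) * (∫⁻ y : ℂ, ENNReal.ofReal ((1 + ‖y‖ ^ 2) ^ (-(1 + η)))) +
        ENNReal.ofReal (η / 2) * (∫⁻ y : ℂ, ENNReal.ofReal ((1 + ‖y‖ ^ 2) ^ (-(1 + η)))) := by
        rw [lintegral_add_left (by fun_prop), lintegral_const_mul _ (by fun_prop),
          lintegral_const_mul _ (by fun_prop),
          lintegral_sub_right_eq_self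
            (fun y : ℂ => ENNReal.ofReal ((1 + ‖y‖ ^ 2) ^ (-(1 + η)))) c]
    _ ≤ ENNReal.ofReal (η / 2) * ENNReal.ofReal (Real.pi / η) +
        ENNReal.ofReal (η / 2) * ENNReal.ofReal (Real.pi / η) := by
        gcongr <;> exact lintegral_one_add_norm_sq_rpow_le hη
    _ = ENNReal.ofReal Real.pi := by
        have := Real.pi_pos
        rw [← ENNReal.ofReal_mul (by positivity),
          ← ENNReal.ofReal_add (by positivity) (by positivity)]
        congr 1
        field_simp
        ring

end Kernels

/-! ### Outputs of power-limited causal signals. -/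

section Signal
variable {s m n : ℕ} {W : Type*} [Fintype W] [Nonempty W] [MeasurableSpace W]
  [MeasurableSingletonClass W]

/-- Mean of the output of user `a.2` in slot `a.1` when the signals `x` are sent. -/
def mean (x : Fin n → W → StatePath s m → (Fin m → ℂ)) (θ : StatePath s m) (w : W)
    (a : Fin n × Fin s) : ℂ :=
  ∑ j, (θ a.1).1 a.2 j * x a.1 w θ j

variable {x : Fin n → W → StatePath s m → (Fin m → ℂ)} (hx : ∀ t w, Measurable (x t w))

include hx in
theorem measurable_mean (w : W) (a : Fin n × Fin s) : Measurable fun θ => mean x θ w a := by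
  unfold mean
  refine Finset.measurable_sum _ fun j _ => ?_
  have := hx a.1 w
  fun_prop

/-- Signals that depend on the channels of earlier slots and the estimates up to now. -/
def Causal (x : Fin n → W → StatePath s m → (Fin m → ℂ)) : Prop :=
  ∀ (t : Fin n) w θ θ', (∀ i < (t : ℕ), θ i = θ' i) → (θ t).2 = (θ' t).2 → x t w θ = x t w θ'

variable (ν : Measure (StatePath s m)) [IsProbabilityMeasure ν]

theorem log_one_add_norm_out_sq_le (ξ : W × StatePath s m × (Fin n × Fin s → ℂ))
    (a : Fin n × Fin s) :
    Real.log (1 + ‖out (mean x) ξ a‖ ^ 2) ≤ Real.log 2 +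
      Real.log (1 + normSq ((ξ.2.1 a.1).1 a.2)) +
      Real.log (1 + normSq (x a.1 ξ.1 ξ.2.1)) + ‖ξ.2.2 a‖ ^ 2 := by
  have hG := normSq_nonneg ((ξ.2.1 a.1).1 a.2)
  have hX := normSq_nonneg (x a.1 ξ.1 ξ.2.1)
  have h1 := one_add_norm_add_sq_le (mean x ξ.2.1 ξ.1 a) (ξ.2.2 a)
  have h2 : 1 + ‖mean x ξ.2.1 ξ.1 a‖ ^ 2 ≤
      (1 + normSq ((ξ.2.1 a.1).1 a.2)) * (1 + normSq (x a.1 ξ.1 ξ.2.1)) := by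
    have := norm_sum_mul_sq_le ((ξ.2.1 a.1).1 a.2) (x a.1 ξ.1 ξ.2.1)
    rw [mean]
    nlinarith
  have h3 : 1 + ‖out (mean x) ξ a‖ ^ 2 ≤ 2 * (1 + ‖ξ.2.2 a‖ ^ 2) *
      ((1 + normSq ((ξ.2.1 a.1).1 a.2)) * (1 + normSq (x a.1 ξ.1 ξ.2.1))) :=
    h1.trans (mul_le_mul_of_nonneg_left h2 (by positivity))
  have h4 := Real.log_le_log (by positivity) h3
  rw [Real.log_mul (by positivity) (by positivity), Real.log_mul (by positivity) (by positivity),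
    Real.log_mul (by positivity) (by positivity)] at h4
  have h5 := Real.log_le_sub_one_of_pos (show 0 < 1 + ‖ξ.2.2 a‖ ^ 2 by positivity)
  linarith

/-- The tangent to the logarithm at `1 + P`: it turns a bound on mean power into one on the mean
logarithm. -/
theorem log_one_add_le {P u : ℝ} (hP : 0 ≤ P) (hu : 0 ≤ u) :
    Real.log (1 + u) ≤ Real.log (1 + P) + (1 + P)⁻¹ * u := by
  have h := Real.log_le_sub_one_of_pos (show 0 < (1 + u) / (1 + P) by positivity)
  rw [Real.log_div (by positivity) (by positivity)] at h
  have : (1 + u) / (1 + P) - 1 ≤ (1 + P)⁻¹ * u := by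
    rw [div_sub_one (by positivity), inv_mul_eq_div]
    gcongr
    linarith
  linarith

-- The logarithm separates channel, signal and noise, so a logarithmic moment of the fading is
-- enough and no independence of signal and channel is needed.
include hx in
theorem lintegral_log_one_add_norm_out_sq_le {P B : ℝ} (hP : 0 ≤ P) (hB : 0 ≤ B)
    (a : Fin n × Fin s)
    (hpow : ∫⁻ ξ, ENNReal.ofReal (normSq (x a.1 ξ.1 ξ.2.1)) ∂mlaw W (Fin n × Fin s) ν ≤
      ENNReal.ofReal P)
    (hfad : ∫⁻ θ, ENNReal.ofReal (Real.log (1 + normSq ((θ a.1).1 a.2))) ∂ν ≤ ENNReal.ofReal B) :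
    ∫⁻ ξ, ENNReal.ofReal (Real.log (1 + ‖out (mean x) ξ a‖ ^ 2)) ∂mlaw W (Fin n × Fin s) ν ≤
      ENNReal.ofReal (B + Real.log (1 + P) + 3) := by
  have hxm : Measurable fun ξ : W × StatePath s m × (Fin n × Fin s → ℂ) => x a.1 ξ.1 ξ.2.1 :=
    measurable_from_prod_countable_right fun w => (hx a.1 w).comp measurable_fst
  have hnx := (measurable_normSq.comp hxm).ennreal_ofReal
  simp only [Function.comp_apply] at hnx
  have hlP : 0 ≤ Real.log (1 + P) := Real.log_nonneg (by linarith)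
  have hl2 : 0 ≤ Real.log 2 := Real.log_nonneg (by norm_num)
  have hlG : ∀ θ : StatePath s m, 0 ≤ Real.log (1 + normSq ((θ a.1).1 a.2)) := fun θ =>
    Real.log_nonneg (by linarith [normSq_nonneg ((θ a.1).1 a.2)])
  calc _ ≤ ∫⁻ ξ, (ENNReal.ofReal (Real.log 2 + Real.log (1 + P)) +
          ENNReal.ofReal (Real.log (1 + normSq ((ξ.2.1 a.1).1 a.2))) +
          ENNReal.ofReal (1 + P)⁻¹ * ENNReal.ofReal (normSq (x a.1 ξ.1 ξ.2.1)) +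
          ENNReal.ofReal (‖ξ.2.2 a‖ ^ 2)) ∂mlaw W (Fin n × Fin s) ν := by
        refine lintegral_mono fun ξ => ?_
        have hX := normSq_nonneg (x a.1 ξ.1 ξ.2.1)
        have hG := hlG ξ.2.1
        dsimp only
        rw [← ENNReal.ofReal_mul (by positivity), ← ENNReal.ofReal_add (by positivity) hG,
          ← ENNReal.ofReal_add (by positivity) (by positivity),
          ← ENNReal.ofReal_add (by positivity) (by positivity)]
        refine ENNReal.ofReal_le_ofReal ?_
        have h1 := log_one_add_norm_out_sq_le (x := x) ξ a
        have h2 := log_one_add_le hP hX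
        linarith
    _ = ENNReal.ofReal (Real.log 2 + Real.log (1 + P)) +
          ∫⁻ θ, ENNReal.ofReal (Real.log (1 + normSq ((θ a.1).1 a.2))) ∂ν +
          ENNReal.ofReal (1 + P)⁻¹ * ∫⁻ ξ, ENNReal.ofReal (normSq (x a.1 ξ.1 ξ.2.1))
            ∂mlaw W (Fin n × Fin s) ν + 1 := by
        rw [lintegral_add_right _ (by fun_prop), lintegral_add_right _ (by exact hnx.const_mul _),
          lintegral_add_left measurable_const, lintegral_const, measure_univ, mul_one,
          lintegral_const_mul _ hnx, lintegral_mlaw_noise_norm_sq,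
          lintegral_mlaw_state ν
            (g := fun θ => ENNReal.ofReal (Real.log (1 + normSq ((θ a.1).1 a.2)))) (by fun_prop)]
    _ ≤ ENNReal.ofReal (Real.log 2 + Real.log (1 + P)) + ENNReal.ofReal B +
          ENNReal.ofReal (1 + P)⁻¹ * ENNReal.ofReal P + ENNReal.ofReal 1 := by
        rw [ENNReal.ofReal_one]; gcongr
    _ ≤ _ := by
        rw [← ENNReal.ofReal_mul (by positivity),
          ← ENNReal.ofReal_add (by positivity) (by positivity),
          ← ENNReal.ofReal_add (by positivity) (by positivity),
          ← ENNReal.ofReal_add (by positivity) (by positivity)]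
        refine ENNReal.ofReal_le_ofReal ?_
        have h1 : (1 + P)⁻¹ * P ≤ 1 := by
          rw [inv_mul_eq_div, div_le_one (by positivity)]; linarith
        have h2 := Real.log_two_lt_d9
        linarith

variable {K : Type*} [DecidableEq K] [MeasurableSpace K] [DiscreteMeasurableSpace K] [Fintype K]

include hx in
/-- One more output of a power-limited signal adds essentially at most `log P` to the entropy. -/
theorem ent_insert_le_of_power {κ : StatePath s m → W → K}
    (hκ : ∀ w, Measurable fun θ => κ θ w) {P B η : ℝ} (hP : 0 ≤ P) (hB : 0 ≤ B) (hη : 0 < η)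
    (hη1 : η ≤ 1) {S : Finset (Fin n × Fin s)} {a : Fin n × Fin s} (ha : a ∉ S)
    (hpow : ∫⁻ ξ, ENNReal.ofReal (normSq (x a.1 ξ.1 ξ.2.1)) ∂mlaw W (Fin n × Fin s) ν ≤
      ENNReal.ofReal P)
    (hfad : ∫⁻ θ, ENNReal.ofReal (Real.log (1 + normSq ((θ a.1).1 a.2))) ∂ν ≤ ENNReal.ofReal B) :
    ent ν (mean x) κ (insert a S) ≤ ent ν (mean x) κ S +
      (-Real.log η + (1 + η) * (B + Real.log (1 + P) + 3)) := by
  have hμ := measurable_mean hx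
  have hlP : 0 ≤ Real.log (1 + P) := Real.log_nonneg (by linarith)
  have hlη : 0 ≤ -Real.log η := neg_nonneg.2 (Real.log_nonpos hη.le hη1)
  have hlog : ∀ y : ℂ, 0 ≤ Real.log (1 + ‖y‖ ^ 2) := fun y =>
    Real.log_nonneg (by linarith [sq_nonneg ‖y‖])
  have hout := measurable_out (A := Fin n × Fin s) hμ
  -- The factor `η` gives the kernel mass at most `π`. Its cost `-log η + (1 + η) log (1 + ‖y‖²)`
  -- has leading term `log P` once `η` is taken to be `1 / log P`.
  refine ent_insert_le ν hμ hκ ha (k := fun y => η * (1 + ‖y‖ ^ 2) ^ (-(1 + η))) (by fun_prop)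
    (fun y => by positivity) ?_
    (F := fun ξ => -Real.log η + (1 + η) * Real.log (1 + ‖out (mean x) ξ a‖ ^ 2))
    (fun ξ => add_nonneg hlη (mul_nonneg (by positivity) (hlog _)))
    (by positivity) ?_ fun ξ => ?_
  · simp_rw [ENNReal.ofReal_mul hη.le]
    rw [lintegral_const_mul _ (by fun_prop)]
    refine (mul_le_mul_right (lintegral_one_add_norm_sq_rpow_le hη) _).trans (le_of_eq ?_)
    rw [← ENNReal.ofReal_mul hη.le]
    congr 1
    field_simp
  · simp_rw [fun ξ => ENNReal.ofReal_add hlη (mul_nonneg (by positivity : 0 ≤ 1 + η)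
      (hlog (out (mean x) ξ a))), ENNReal.ofReal_mul (by positivity : 0 ≤ 1 + η)]
    rw [lintegral_add_left measurable_const, lintegral_const, measure_univ, mul_one,
      lintegral_const_mul _ (by fun_prop), ENNReal.ofReal_add hlη (by positivity),
      ENNReal.ofReal_mul (by positivity)]
    gcongr
    exact lintegral_log_one_add_norm_out_sq_le hx ν hP hB a hpow hfad
  · rw [Real.log_mul hη.ne' (by positivity), Real.log_rpow (by positivity)]
    linarith

end Signal

/-! ### Exchanging two users in one slot. -/

section Comparison
variable {s m n : ℕ} {W : Type*} [Fintype W] [Nonempty W] [MeasurableSpace W]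
  [MeasurableSingletonClass W] {x : Fin n → W → StatePath s m → (Fin m → ℂ)}
  (hx : ∀ t w, Measurable (x t w)) (hxc : Causal x)
  {K : Type*} [DecidableEq K] [MeasurableSpace K] [DiscreteMeasurableSpace K] [Fintype K]

theorem resample_of_lt {t : ℕ} {i : Fin s} {e : Fin m → ℂ} {θ : StatePath s m} {j : ℕ}
    (h : j < t) : resample t i e θ j = θ j := by
  simp [resample, h.ne]

-- The encoder sees the channel of slot `t` only from slot `t + 1` on; until then it has just the
-- estimate, which `resample` keeps.
include hxc in
theorem signal_resample {t : Fin n} (i : Fin s) (e : Fin m → ℂ) (θ : StatePath s m) {t' : Fin n}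
    (h : t' ≤ t) (w : W) : x t' w (resample t i e θ) = x t' w θ := by
  refine hxc t' w _ _ (fun j hj => resample_of_lt (hj.trans_le h)) ?_
  rcases h.lt_or_eq with h | h
  · rw [resample_of_lt h]
  · subst h; simp [resample]

-- Only the channel of user `i` in slot `t` is changed, so outputs of earlier slots and of other
-- users in slot `t` keep their means.
include hxc in
theorem mean_resample {t : Fin n} {i : Fin s} (e : Fin m → ℂ) (θ : StatePath s m)
    {a : Fin n × Fin s} (ha : a.1 < t ∨ a.1 = t ∧ a.2 ≠ i) (w : W) :
    mean x (resample t i e θ) w a = mean x θ w a := by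
  have hle : a.1 ≤ t := ha.elim le_of_lt fun h => h.1.le
  unfold mean
  rw [signal_resample hxc i e θ hle]
  refine Finset.sum_congr rfl fun j _ => ?_
  congr 1
  rcases ha with h | ⟨h, h'⟩
  · rw [resample_of_lt h]
  · rw [h]; simp [resample, h']

include hxc in
theorem mean_resample_self (t : Fin n) (i : Fin s) (e : Fin m → ℂ) (θ : StatePath s m) (w : W) :
    mean x (resample t i e θ) w (t, i) = ∑ j, ((θ t).2 i j + e j) * x t w θ j := by
  unfold mean
  rw [signal_resample hxc i e θ le_rfl]
  simp [resample]

include hxc in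
theorem mean_congr {θ θ' : StatePath s m} {t : Fin n} (h : ∀ j ≤ (t : ℕ), θ j = θ' j)
    {a : Fin n × Fin s} (ha : a.1 ≤ t) (w : W) : mean x θ w a = mean x θ' w a := by
  unfold mean
  rw [h a.1 ha, hxc a.1 w θ θ' (fun j hj => h j (hj.le.trans ha)) (by rw [h a.1 ha])]

theorem lik_out_congr {μ μ' : StatePath s m → W → (Fin n × Fin s) → ℂ} {θ θ' : StatePath s m}
    {S : Finset (Fin n × Fin s)} (h : ∀ a ∈ S, ∀ w, μ θ w a = μ' θ' w a) (w w' : W)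
    (z : Fin n × Fin s → ℂ) :
    lik (μ θ) S w' (out μ (w, θ, z)) = lik (μ' θ') S w' (out μ' (w, θ', z)) := by
  unfold lik out
  refine Finset.prod_congr rfl fun a ha => ?_
  simp only [Pi.add_apply, h a ha]

/-- Upper bound for the mean of the joint density over the estimation error of the last output. -/
def smear (x : Fin n → W → StatePath s m → (Fin m → ℂ)) (κ : W → K) (v : ℝ≥0)
    (S : Finset (Fin n × Fin s)) (t : Fin n) (ξ : W × StatePath s m × (Fin n × Fin s → ℂ)) : ℝ :=
  ∑ w', if κ w' = κ ξ.1 then lik (mean x ξ.2.1) S w' (out (mean x) ξ) *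
    (2 * m / (1 + v * normSq (x t ξ.1 ξ.2.1 - x t w' ξ.2.1))) else 0

include hx in
theorem measurable_smear (κ : W → K) (v : ℝ≥0) (S : Finset (Fin n × Fin s)) (t : Fin n) :
    Measurable (smear x κ v S t) := by
  have hxm : Measurable fun ξ : W × StatePath s m × (Fin n × Fin s → ℂ) => x t ξ.1 ξ.2.1 :=
    measurable_from_prod_countable_right fun w => (hx t w).comp measurable_fst
  refine Finset.measurable_sum _ fun w _ => Measurable.ite
    (measurableSet_label_eq (κ := fun _ => κ) (fun _ => measurable_const) w)
    ((measurable_lik_out (measurable_mean hx) S w).mul ?_) measurable_const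
  have h1 : Measurable fun ξ : W × StatePath s m × (Fin n × Fin s → ℂ) =>
      normSq (x t ξ.1 ξ.2.1 - x t w ξ.2.1) :=
    measurable_normSq.comp (hxm.sub ((hx t w).comp (measurable_fst.comp measurable_snd)))
  exact ((h1.const_mul _).const_add _).const_div _

theorem smear_pos (hm : 1 ≤ m) (κ : W → K) (v : ℝ≥0) (S : Finset (Fin n × Fin s)) (t : Fin n)
    (ξ : W × StatePath s m × (Fin n × Fin s → ℂ)) : 0 < smear x κ v S t ξ := by
  have hm' : (0 : ℝ) < m := by exact_mod_cast hm
  have hpos : ∀ w', 0 < lik (mean x ξ.2.1) S w' (out (mean x) ξ) *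
      (2 * m / (1 + v * normSq (x t ξ.1 ξ.2.1 - x t w' ξ.2.1))) := fun w' => by
    have := normSq_nonneg (x t ξ.1 ξ.2.1 - x t w' ξ.2.1)
    exact mul_pos (lik_pos _ _ _ _) (by positivity)
  refine Finset.sum_pos' (fun w' _ => ?_) ⟨ξ.1, Finset.mem_univ _, ?_⟩
  · split_ifs; exacts [(hpos w').le, le_rfl]
  · rw [if_pos rfl]; exact hpos _

/-- Fubini with the state innermost, so that the error can be redrawn at fixed input and noise. -/
theorem lintegral_mlaw_le_of_state {A Θ : Type*} [Fintype A] [MeasurableSpace Θ]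
    (ν : Measure Θ) [IsProbabilityMeasure ν] {f : W × Θ × (A → ℂ) → ℝ≥0∞} (hf : Measurable f)
    (h : ∀ w z, ∫⁻ θ, f (w, θ, z) ∂ν ≤ 1) : ∫⁻ ξ, f ξ ∂mlaw W A ν ≤ 1 := by
  have hN : (Fintype.card W : ℝ≥0∞) ≠ 0 := by simp
  have hsw : ∀ w, ∫⁻ θ, ∫⁻ z, f (w, θ, z) ∂noise A ∂ν ≤ 1 := fun w => by
    rw [lintegral_lintegral_swap (f := fun θ z => f (w, θ, z))
      (hf.comp measurable_prodMk_left).aemeasurable]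
    calc _ ≤ ∫⁻ _, 1 ∂noise A := lintegral_mono fun z => h w z
      _ = 1 := by simp
  rw [lintegral_mlaw ν hf]
  calc _ ≤ (Fintype.card W : ℝ≥0∞)⁻¹ * ∑ _w : W, 1 :=
        mul_le_mul_right (Finset.sum_le_sum fun w _ => hsw w) _
    _ = 1 := by
        simp only [Finset.sum_const, Finset.card_univ, nsmul_eq_mul, mul_one]
        exact ENNReal.inv_mul_cancel hN (by simp)

-- At fixed input and noise, redrawing the error of user `i` leaves `smear` and the likelihoods on
-- `S` unchanged. Only the bumps for the output `(t, i)` move, and their averages are bounded by the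
-- weights in `smear`.
include hx hxc in
theorem lintegral_mix_div_smear_le (hm : 1 ≤ m) {α : ℝ} {ν : ℝ → Measure (StatePath s m)}
    [∀ P, IsProbabilityMeasure (ν P)] (hν : IsMixedCSIT α ν) {P : ℝ} (hP : 1 ≤ P) (t : Fin n)
    {v : Fin s → ℝ≥0} (hv0 : ∀ k, 0 < v k) (hv : (ν P).map (estErr t) =
      Measure.pi (fun k : Fin s => Measure.pi (fun _ : Fin m => complexGaussian (v k))))
    (i : Fin s) (κ : W → K) {S : Finset (Fin n × Fin s)}
    (hS : ∀ a ∈ S, a.1 < t ∨ a.1 = t ∧ a.2 ≠ i) :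
    ∫⁻ ξ, ENNReal.ofReal (mix (mean x ξ.2.1) κ (insert (t, i) S) (κ ξ.1) (out (mean x) ξ) /
      smear x κ (v i) S t ξ) ∂mlaw W (Fin n × Fin s) (ν P) ≤ 1 := by
  have hmix := measurable_mix_out (A := Fin n × Fin s) (measurable_mean hx)
    (κ := fun _ : StatePath s m => κ) (fun _ => measurable_const) (insert (t, i) S)
  have hmeas := (hmix.div (measurable_smear hx κ (v i) S t)).ennreal_ofReal
  have hti : (t, i) ∉ S := fun h => by
    rcases hS _ h with h | ⟨-, h⟩
    · exact lt_irrefl _ h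
    · exact h rfl
  refine lintegral_mlaw_le_of_state (ν P) hmeas fun w z => ?_
  have hSle : ∀ a ∈ S, a.1 ≤ t := fun a ha => (hS a ha).elim le_of_lt fun h => h.1.le
  have hdep : DependsOn (fun θ : StatePath s m => ENNReal.ofReal
      (mix (mean x θ) κ (insert (t, i) S) (κ w) (out (mean x) (w, θ, z)) /
        smear x κ (v i) S t (w, θ, z))) (Set.Iic (t : ℕ)) := by
    intro θ θ' h
    have h1 : ∀ a ∈ insert (t, i) S, ∀ w, mean x θ w a = mean x θ' w a := fun a ha w =>
      mean_congr hxc (t := t) (fun j hj => h j hj)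
        ((Finset.mem_insert.1 ha).elim (fun h => by rw [h]) (hSle a)) w
    have h2 : ∀ w', x t w' θ = x t w' θ' := fun w' =>
      hxc t w' θ θ' (fun j hj => h j hj.le) (by rw [h t (Set.mem_Iic.2 le_rfl)])
    dsimp only
    unfold mix smear
    congr 2
    · exact Finset.sum_congr rfl fun w' _ => by rw [lik_out_congr h1]
    · refine Finset.sum_congr rfl fun w' _ => ?_
      dsimp only
      rw [lik_out_congr fun a ha => h1 a (Finset.mem_insert_of_mem ha), h2, h2]
  have hres := lintegral_resample hν hP t hv i (hmeas.comp
    (measurable_prodMk_left.comp measurable_prodMk_right)) hdep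
  refine hres.trans_le ?_
  calc _ ≤ ∫⁻ _θ, 1 ∂ν P := lintegral_mono fun θ => ?_
    _ = 1 := by simp
  change ∫⁻ e, ENNReal.ofReal (mix (mean x (resample t i e θ)) κ (insert (t, i) S) (κ w)
    (out (mean x) (w, resample t i e θ, z)) / smear x κ (v i) S t (w, resample t i e θ, z))
    ∂Measure.pi (fun _ : Fin m => complexGaussian (v i)) ≤ 1
  have hsm : ∀ e, smear x κ (v i) S t (w, resample t i e θ, z) = smear x κ (v i) S t (w, θ, z) := by
    intro e
    unfold smear
    refine Finset.sum_congr rfl fun w' _ => ?_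
    dsimp only
    rw [lik_out_congr fun a ha w => mean_resample hxc e θ (hS a ha) w,
      signal_resample hxc i e θ le_rfl, signal_resample hxc i e θ le_rfl]
  -- The output minus the mean under `w'` is the noise plus `(ĥ + e) · d` with `d` the difference of
  -- the two signals: affine in the redrawn error `e`.
  have hmx : ∀ e, mix (mean x (resample t i e θ)) κ (insert (t, i) S) (κ w)
      (out (mean x) (w, resample t i e θ, z)) = ∑ w', if κ w' = κ w then
        lik (mean x θ) S w' (out (mean x) (w, θ, z)) *
        Real.exp (-‖(z (t, i) + ∑ j, (θ t).2 i j * (x t w θ - x t w' θ) j) +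
          ∑ j, e j * (x t w θ - x t w' θ) j‖ ^ 2) else 0 := by
    intro e
    unfold mix
    refine Finset.sum_congr rfl fun w' _ => ?_
    split_ifs
    · rw [lik, Finset.prod_insert hti, ← lik,
        lik_out_congr fun a ha w => mean_resample hxc e θ (hS a ha) w, mul_comm]
      congr 5
      simp only [out, Pi.add_apply, mean_resample_self hxc, Pi.sub_apply, add_mul, mul_sub,
        Finset.sum_add_distrib, Finset.sum_sub_distrib]
      ring
    · rfl
  have hs0 := smear_pos (x := x) hm κ (v i) S t (w, θ, z)
  simp_rw [hsm, hmx, ENNReal.ofReal_div_of_pos hs0]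
  simp_rw [div_eq_mul_inv]
  rw [lintegral_mul_const']
  · rw [← div_eq_mul_inv]
    refine ENNReal.div_le_of_le_mul ?_
    rw [one_mul]
    have hL : ∀ w', 0 ≤ lik (mean x θ) S w' (out (mean x) (w, θ, z)) := fun w' =>
      (lik_pos _ _ _ _).le
    have hterm : ∀ w', 0 ≤ lik (mean x θ) S w' (out (mean x) (w, θ, z)) *
        (2 * m / (1 + v i * normSq (x t w θ - x t w' θ))) := fun w' => by
      have := normSq_nonneg (x t w θ - x t w' θ)
      exact mul_nonneg (hL w') (by positivity)
    unfold smear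
    rw [ENNReal.ofReal_sum_of_nonneg fun w' _ => by
      split_ifs; exacts [hterm w', le_rfl]]
    have hsum : ∀ e : Fin m → ℂ, ENNReal.ofReal (∑ w', if κ w' = κ w then
        lik (mean x θ) S w' (out (mean x) (w, θ, z)) *
        Real.exp (-‖(z (t, i) + ∑ j, (θ t).2 i j * (x t w θ - x t w' θ) j) +
          ∑ j, e j * (x t w θ - x t w' θ) j‖ ^ 2) else 0) = ∑ w', if κ w' = κ w then
        ENNReal.ofReal (lik (mean x θ) S w' (out (mean x) (w, θ, z))) *
        ENNReal.ofReal (Real.exp (-‖(z (t, i) + ∑ j, (θ t).2 i j * (x t w θ - x t w' θ) j) +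
          ∑ j, e j * (x t w θ - x t w' θ) j‖ ^ 2)) else 0 := fun e => by
      rw [ENNReal.ofReal_sum_of_nonneg fun w' _ => by
        split_ifs; exacts [mul_nonneg (hL w') (Real.exp_pos _).le, le_rfl]]
      refine Finset.sum_congr rfl fun w' _ => ?_
      split_ifs
      exacts [ENNReal.ofReal_mul (hL w'), ENNReal.ofReal_zero]
    simp_rw [hsum]
    rw [lintegral_finsetSum _ fun w' _ => by split_ifs <;> fun_prop]
    refine Finset.sum_le_sum fun w' _ => ?_
    split_ifs
    · rw [lintegral_const_mul _ (by fun_prop), ENNReal.ofReal_mul (hL w')]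
      gcongr
      exact lintegral_exp_neg_norm_add_sum_sq_le hm (hv0 i) _ _
    · simp
  · exact ENNReal.inv_ne_top.2 (ENNReal.ofReal_pos.2 hs0).ne'

/-- Bound for the ratio between the averaged density for user `i` and the reference density for
user `j`. -/
def gap (x : Fin n → W → StatePath s m → (Fin m → ℂ)) (v : ℝ≥0) (η : ℝ) (t : Fin n) (j : Fin s)
    (ξ : W × StatePath s m × (Fin n × Fin s → ℂ)) : ℝ :=
  (Real.log (8 * m / η) + Real.log (1 + (v : ℝ)⁻¹)) + ‖ξ.2.2 (t, j)‖ ^ 2 +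
    Real.log (1 + normSq ((ξ.2.1 t).1 j)) + η * Real.log (1 + ‖out (mean x) ξ (t, j)‖ ^ 2)

/-- Term by term: under `w'` the output of user `j` is off its mean by `h · d + z`, so up to
channel, noise and variance factors the kernel at `j` decays no faster than `1 / (1 + v ‖d‖²)`. The
factor `exp gap` does not involve `w'` and comes out of the sum. -/
theorem smear_le (hm : 1 ≤ m) {v : ℝ≥0} (hv : 0 < v) {η : ℝ} (hη : 0 < η) (κ : W → K)
    (S : Finset (Fin n × Fin s)) (t : Fin n) (j : Fin s)
    (ξ : W × StatePath s m × (Fin n × Fin s → ℂ)) :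
    smear x κ v S t ξ ≤ Real.exp (gap x v η t j ξ) * kernelMix (mean x) (fun _ => κ) S (t, j)
      (fun θ w' y => tailKernel η (mean x θ w' (t, j)) y) ξ := by
  have hvr : (0 : ℝ) < v := by exact_mod_cast hv
  have hm' : (0 : ℝ) < m := by exact_mod_cast hm
  rw [smear, kernelMix, Finset.mul_sum]
  refine Finset.sum_le_sum fun w' _ => ?_
  split_ifs
  swap; · simp
  rw [mul_left_comm]
  refine mul_le_mul_of_nonneg_left ?_ (lik_pos _ _ _ _).le
  set Y := out (mean x) ξ (t, j) with hY
  set d := x t ξ.1 ξ.2.1 - x t w' ξ.2.1 with hd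
  set h := (ξ.2.1 t).1 j with hh
  have hd0 := normSq_nonneg d
  have hh0 := normSq_nonneg h
  have hYd : Y - mean x ξ.2.1 w' (t, j) = (∑ l, h l * d l) + ξ.2.2 (t, j) := by
    simp only [hY, out, Pi.add_apply, mean, hd, Pi.sub_apply, mul_sub, Finset.sum_sub_distrib, hh]
    ring
  -- `8 m / η` collects `2 m` from `smear`, the 2 of `one_add_norm_add_sq_le` and the inverse `2 /
  -- η` of the constant in `tailKernel`.
  have hgap : 8 * m / η * (1 + (v : ℝ)⁻¹) * (1 + ‖ξ.2.2 (t, j)‖ ^ 2) * (1 + normSq h) *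
      (1 + ‖Y‖ ^ 2) ^ η ≤ Real.exp (gap x v η t j ξ) := by
    rw [gap, Real.exp_add, Real.exp_add, Real.exp_add, Real.exp_add, Real.exp_log (by positivity),
      Real.exp_log (by positivity), Real.exp_log (by positivity), mul_comm η, Real.exp_mul,
      Real.exp_log (by positivity)]
    have := Real.add_one_le_exp (‖ξ.2.2 (t, j)‖ ^ 2)
    gcongr
    linarith
  -- The factor `1 + v⁻¹` is the price for passing from `‖d‖²` to `v ‖d‖²`; its logarithm is the `α
  -- log P` of the theorem.
  have hnum : 1 + ‖Y - mean x ξ.2.1 w' (t, j)‖ ^ 2 ≤ 2 * (1 + ‖ξ.2.2 (t, j)‖ ^ 2) *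
      ((1 + normSq h) * ((1 + (v : ℝ)⁻¹) * (1 + v * normSq d))) := by
    rw [hYd]
    refine (one_add_norm_add_sq_le _ _).trans (mul_le_mul_of_nonneg_left ?_ (by positivity))
    have h1 := norm_sum_mul_sq_le h d
    have h2 : normSq d ≤ (1 + (v : ℝ)⁻¹) * (1 + v * normSq d) - 1 := by
      have : (v : ℝ)⁻¹ * (v * normSq d) = normSq d := by field_simp
      have h3 : 0 < (v : ℝ)⁻¹ := by positivity
      nlinarith [mul_nonneg hvr.le hd0]
    nlinarith [mul_nonneg hh0 hd0]
  calc 2 * (m : ℝ) / (1 + v * normSq d)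
      ≤ (8 * m / η * (1 + (v : ℝ)⁻¹) * (1 + ‖ξ.2.2 (t, j)‖ ^ 2) * (1 + normSq h) *
        (1 + ‖Y‖ ^ 2) ^ η) * tailKernel η (mean x ξ.2.1 w' (t, j)) Y := by
        have hpos : 0 < 1 + ‖Y - mean x ξ.2.1 w' (t, j)‖ ^ 2 := by positivity
        have e : (8 * m / η * (1 + (v : ℝ)⁻¹) * (1 + ‖ξ.2.2 (t, j)‖ ^ 2) * (1 + normSq h) *
            (1 + ‖Y‖ ^ 2) ^ η) * tailKernel η (mean x ξ.2.1 w' (t, j)) Y =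
            2 * m * (2 * (1 + ‖ξ.2.2 (t, j)‖ ^ 2) * ((1 + normSq h) * (1 + (v : ℝ)⁻¹))) /
              (1 + ‖Y - mean x ξ.2.1 w' (t, j)‖ ^ 2) := by
          rw [tailKernel, Real.rpow_neg (by positivity)]
          have : (1 + ‖Y‖ ^ 2) ^ η ≠ 0 := by positivity
          field_simp
          ring
        rw [e, div_le_div_iff₀ (by positivity) hpos]
        have := mul_le_mul_of_nonneg_left hnum (by positivity : (0 : ℝ) ≤ 2 * m)
        nlinarith
    _ ≤ _ := by
        gcongr
        exact (tailKernel_pos hη _ _).le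

include hx hxc in
/-- Replacing the output of user `i` by that of user `j` in the current slot, given any outputs
not involving the current channel of user `i`, changes the entropy by at most the logarithm of
the inverse error variance, up to lower-order terms. -/
theorem ent_insert_le_ent_insert (hm : 1 ≤ m) {α : ℝ} {ν : ℝ → Measure (StatePath s m)}
    [∀ P, IsProbabilityMeasure (ν P)] (hν : IsMixedCSIT α ν) {P B η : ℝ} (hP : 1 ≤ P)
    (hB : 0 ≤ B) (hη : 0 < η) (hη1 : η ≤ 1) (t : Fin n)
    {v : Fin s → ℝ≥0} (hv0 : ∀ k, 0 < v k) (hv : (ν P).map (estErr t) =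
      Measure.pi (fun k : Fin s => Measure.pi (fun _ : Fin m => complexGaussian (v k))))
    (i j : Fin s) (κ : W → K) {S : Finset (Fin n × Fin s)}
    (hS : ∀ a ∈ S, a.1 < t ∨ a.1 = t ∧ a.2 ≠ i) (hj : (t, j) ∉ S)
    (hpow : ∫⁻ ξ, ENNReal.ofReal (normSq (x t ξ.1 ξ.2.1)) ∂mlaw W (Fin n × Fin s) (ν P) ≤
      ENNReal.ofReal P)
    (hfad : ∫⁻ θ, ENNReal.ofReal (Real.log (1 + normSq ((θ t).1 j))) ∂ν P ≤
      ENNReal.ofReal B) :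
    ent (ν P) (mean x) (fun _ => κ) (insert (t, j) S) ≤
      ent (ν P) (mean x) (fun _ => κ) (insert (t, i) S) +
        (Real.log (8 * m / η) + Real.log (1 + (v i : ℝ)⁻¹) + 1 + B +
          η * (B + Real.log (1 + P) + 3)) := by
  have hm1 : (1 : ℝ) ≤ m := by exact_mod_cast hm
  have hμ := measurable_mean hx
  have hκ : ∀ w : W, Measurable fun _ : StatePath s m => κ w := fun _ => measurable_const
  have hvr : (0 : ℝ) < v i := by exact_mod_cast hv0 i
  have hout := measurable_out (A := Fin n × Fin s) hμ
  have ij := integrable_info (ν P) hμ hκ (insert (t, j) S)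
  have ii := integrable_info (ν P) hμ hκ (insert (t, i) S)
  have hkm : ∀ w : W, Measurable fun p : StatePath s m × ℂ =>
      tailKernel η (mean x p.1 w (t, j)) p.2 := fun w => by
    have := hμ w (t, j)
    unfold tailKernel
    fun_prop
  have hr := lintegral_kernelMix_div_le (ν P) hμ hκ hj
    (k := fun θ w' y => tailKernel η (mean x θ w' (t, j)) y) hkm
    (fun θ w y => (tailKernel_pos hη _ _).le) (fun θ w => lintegral_tailKernel_le hη _)
  have hq := lintegral_mix_div_smear_le hx hxc hm hν hP t hv0 hv i κ hS
  obtain ⟨L, hLdef⟩ : ∃ L, L = Real.log (8 * m / η) + Real.log (1 + (v i : ℝ)⁻¹) := ⟨_, rfl⟩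
  rw [← hLdef]
  have hL : 0 ≤ L := by
    rw [hLdef]
    refine add_nonneg (Real.log_nonneg ?_) (Real.log_nonneg ?_)
    · rw [le_div_iff₀ hη]; linarith
    · have : 0 < (v i : ℝ)⁻¹ := by positivity
      linarith
  have hlogG : ∀ θ : StatePath s m, 0 ≤ Real.log (1 + normSq ((θ t).1 j)) := fun θ =>
    Real.log_nonneg (by linarith [normSq_nonneg ((θ t).1 j)])
  have hlogY : ∀ ξ : W × StatePath s m × (Fin n × Fin s → ℂ),
      0 ≤ η * Real.log (1 + ‖out (mean x) ξ (t, j)‖ ^ 2) := fun ξ =>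
    mul_nonneg hη.le (Real.log_nonneg (by linarith [sq_nonneg ‖out (mean x) ξ (t, j)‖]))
  have hlP : 0 ≤ Real.log (1 + P) := Real.log_nonneg (by linarith)
  have hgap0 : ∀ ξ : W × StatePath s m × (Fin n × Fin s → ℂ), 0 ≤ gap x (v i) η t j ξ := fun ξ => by
    rw [gap, ← hLdef]
    exact add_nonneg (add_nonneg (add_nonneg hL (sq_nonneg _)) (hlogG _)) (hlogY ξ)
  have hgap : ∫⁻ ξ, ENNReal.ofReal (gap x (v i) η t j ξ) ∂mlaw W (Fin n × Fin s) (ν P) ≤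
      ENNReal.ofReal (L + 1 + B + η * (B + Real.log (1 + P) + 3)) := by
    have hY := lintegral_log_one_add_norm_out_sq_le hx (ν P) (zero_le_one.trans hP) hB (t, j)
      hpow hfad
    have e : ∀ ξ : W × StatePath s m × (Fin n × Fin s → ℂ), ENNReal.ofReal (gap x (v i) η t j ξ) =
        ENNReal.ofReal L + ENNReal.ofReal (‖ξ.2.2 (t, j)‖ ^ 2) +
        ENNReal.ofReal (Real.log (1 + normSq ((ξ.2.1 t).1 j))) +
        ENNReal.ofReal η * ENNReal.ofReal (Real.log (1 + ‖out (mean x) ξ (t, j)‖ ^ 2)) := fun ξ => by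
      rw [gap, ← hLdef, ENNReal.ofReal_add (add_nonneg (add_nonneg hL (sq_nonneg _)) (hlogG _)) (hlogY ξ),
        ENNReal.ofReal_add (add_nonneg hL (sq_nonneg _)) (hlogG _),
        ENNReal.ofReal_add hL (sq_nonneg _), ENNReal.ofReal_mul hη.le]
    simp_rw [e]
    rw [lintegral_add_left (by fun_prop), lintegral_add_left (by fun_prop),
      lintegral_add_left (by fun_prop), lintegral_const, measure_univ, mul_one,
      lintegral_const_mul _ (by fun_prop), lintegral_mlaw_noise_norm_sq,
      lintegral_mlaw_state (ν P)
        (g := fun θ => ENNReal.ofReal (Real.log (1 + normSq ((θ t).1 j)))) (by fun_prop),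
      ENNReal.ofReal_add (by positivity) (by positivity),
      ENNReal.ofReal_add (by positivity) hB, ENNReal.ofReal_add hL zero_le_one,
      ENNReal.ofReal_one, ENNReal.ofReal_mul hη.le]
    gcongr
  have mj := measurable_mix_out (A := Fin n × Fin s) hμ hκ (insert (t, j) S)
  have mi := measurable_mix_out (A := Fin n × Fin s) hμ hκ (insert (t, i) S)
  have mq := measurable_smear hx κ (v i) S t
  have mr := measurable_kernelMix (A := Fin n × Fin s) hμ hκ (S := S) (a := (t, j))
    (k := fun θ w' y => tailKernel η (mean x θ w' (t, j)) y) hkm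
  have pj := fun ξ : W × StatePath s m × (Fin n × Fin s → ℂ) =>
    mix_pos (mean x ξ.2.1) κ (insert (t, j) S) ξ.1 (out (mean x) ξ)
  have pi := fun ξ : W × StatePath s m × (Fin n × Fin s → ℂ) =>
    mix_pos (mean x ξ.2.1) κ (insert (t, i) S) ξ.1 (out (mean x) ξ)
  have pq := smear_pos (x := x) hm κ (v i) S t
  have hle := smear_le (x := x) hm (hv0 i) hη κ S t j
  have pr : ∀ ξ, 0 < kernelMix (mean x) (fun _ => κ) S (t, j)
      (fun θ w' y => tailKernel η (mean x θ w' (t, j)) y) ξ := fun ξ =>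
    pos_of_mul_pos_right ((pq ξ).trans_le (hle ξ)) (Real.exp_pos _).le
  have hc : 0 ≤ L + 1 + B + η * (B + Real.log (1 + P) + 3) := by positivity
  -- The difference of logarithms passes from the mixture at `i` to `smear`, to `kernelMix`, to the
  -- mixture at `j`. The outer two passages are ratios of mean at most 1, hence the shift by 2; the
  -- middle one costs `gap`.
  have key := integral_le_of_le_of_lintegral_le (add_nonneg zero_le_two hc)
    ((ij.sub ii).add (integrable_const 2))
    (T := fun ξ => mix (mean x ξ.2.1) κ (insert (t, i) S) (κ ξ.1) (out (mean x) ξ) /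
        smear x κ (v i) S t ξ +
      kernelMix (mean x) (fun _ => κ) S (t, j)
        (fun θ w' y => tailKernel η (mean x θ w' (t, j)) y) ξ /
        mix (mean x ξ.2.1) κ (insert (t, j) S) (κ ξ.1) (out (mean x) ξ) +
      gap x (v i) η t j ξ) (fun ξ => ?_) ?_
  · rw [integral_add' (ij.sub ii) (integrable_const 2), integral_sub' ij ii] at key
    simp only [integral_const, probReal_univ, smul_eq_mul, one_mul] at key
    unfold ent
    linarith
  · have h1 := Real.log_le_sub_one_of_pos (div_pos (pi ξ) (pq ξ))
    have h2 := Real.log_le_sub_one_of_pos (div_pos (pr ξ) (pj ξ))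
    have h3 := Real.log_le_log (pq ξ) (hle ξ)
    rw [Real.log_div (pi ξ).ne' (pq ξ).ne'] at h1
    rw [Real.log_div (pr ξ).ne' (pj ξ).ne'] at h2
    rw [Real.log_mul (Real.exp_pos _).ne' (pr ξ).ne', Real.log_exp] at h3
    simp only [Pi.add_apply, Pi.sub_apply, info]
    linarith
  · simp_rw [fun ξ => ENNReal.ofReal_add (add_nonneg (div_pos (pi ξ) (pq ξ)).le
      (div_pos (pr ξ) (pj ξ)).le) (hgap0 ξ),
      fun ξ => ENNReal.ofReal_add (div_pos (pi ξ) (pq ξ)).le (div_pos (pr ξ) (pj ξ)).le]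
    rw [lintegral_add_left (by exact (mi.div mq).ennreal_ofReal.add (mr.div mj).ennreal_ofReal),
      lintegral_add_left (by exact (mi.div mq).ennreal_ofReal), ENNReal.ofReal_add zero_le_two hc,
      ← one_add_one_eq_two, ENNReal.ofReal_add zero_le_one zero_le_one, ENNReal.ofReal_one]
    exact add_le_add (add_le_add hq hr) hgap

end Comparison

/-! ### Submodular functions on time slots and users. -/

section Slots
variable {n s : ℕ}

/-- Outputs of the users `e 0, …, e (k - 1)` in the slots before `t`. -/
def block (e : ℕ → Fin s) (t k : ℕ) : Finset (Fin n × Fin s) :=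
  Finset.univ.filter fun a => (a.1 : ℕ) < t ∧ ∃ l < k, a.2 = e l

/-- The outputs `block e t k` and those of the users `e 0, …, e (i - 1)` in slot `t`. -/
def stair (e : ℕ → Fin s) (t k i : ℕ) : Finset (Fin n × Fin s) :=
  Finset.univ.filter fun a => ((a.1 : ℕ) < t ∧ ∃ l < k, a.2 = e l) ∨
    ((a.1 : ℕ) = t ∧ ∃ l < i, a.2 = e l)

theorem stair_zero (e : ℕ → Fin s) (t k : ℕ) : (stair e t k 0 : Finset (Fin n × Fin s)) =
    block e t k := by
  ext a; simp [stair, block]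

theorem stair_self (e : ℕ → Fin s) (t k : ℕ) : (stair e t k k : Finset (Fin n × Fin s)) =
    block e (t + 1) k := by
  ext a; simp only [stair, block, Finset.mem_filter, Finset.mem_univ, true_and,
    Nat.lt_succ_iff_lt_or_eq, or_and_right]

theorem stair_succ (e : ℕ → Fin s) (t : Fin n) (k i : ℕ) :
    stair e t k (i + 1) = insert (t, e i) (stair e t k i) := by
  ext ⟨a, b⟩
  simp only [stair, Finset.mem_filter, Finset.mem_univ, true_and, Finset.mem_insert,
    Nat.lt_succ_iff_lt_or_eq, Prod.mk.injEq, Fin.ext_iff (a := a)]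
  constructor
  · rintro (h | ⟨h, l, hl | rfl, h'⟩)
    exacts [Or.inr (Or.inl h), Or.inr (Or.inr ⟨h, l, hl, h'⟩), Or.inl ⟨h, h'⟩]
  · rintro (⟨h, h'⟩ | h | ⟨h, l, hl, h'⟩)
    exacts [Or.inr ⟨h, i, Or.inr rfl, h'⟩, Or.inl h, Or.inr ⟨h, l, Or.inl hl, h'⟩]

theorem stair_mono (e : ℕ → Fin s) (t k : ℕ) {i j : ℕ} (h : i ≤ j) :
    (stair e t k i : Finset (Fin n × Fin s)) ⊆ stair e t k j := by
  intro a
  simp only [stair, Finset.mem_filter, Finset.mem_univ, true_and]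
  rintro (h' | ⟨h', l, hl, h''⟩)
  exacts [Or.inl h', Or.inr ⟨h', l, hl.trans_le h, h''⟩]

theorem block_zero_left (e : ℕ → Fin s) (k : ℕ) : (block e 0 k : Finset (Fin n × Fin s)) = ∅ := by
  ext a; simp [block]

theorem block_mono (e : ℕ → Fin s) (t : ℕ) {i j : ℕ} (h : i ≤ j) :
    (block e t i : Finset (Fin n × Fin s)) ⊆ block e t j := by
  rw [← stair_zero, ← stair_zero]
  intro a
  simp only [stair, Finset.mem_filter, Finset.mem_univ, true_and]
  rintro (⟨h', l, hl, h''⟩ | h')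
  exacts [Or.inl ⟨h', l, hl.trans_le h, h''⟩, Or.inr h']

variable {H : Finset (Fin n × Fin s) → ℝ}
  (hsub : ∀ S T U, Disjoint (S ∪ T) U → H (S ∪ T ∪ U) + H S ≤ H (S ∪ T) + H (S ∪ U))

include hsub in
theorem submodular_of_subset {X Y C : Finset (Fin n × Fin s)} (h : X ⊆ Y) (hC : Disjoint Y C) :
    H (Y ∪ C) + H X ≤ H Y + H (X ∪ C) := by
  have := hsub X (Y \ X) C
  rw [Finset.union_sdiff_of_subset h] at this
  exact this hC

include hsub in
/-- If in each slot every pair of users is exchangeable up to `Δ`, one more user in a group of `k`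
increases the entropy by at most a fraction `1 / k`, up to `n * Δ`. -/
theorem mul_entropy_block_succ_le {Δ : ℝ}
    (hex : ∀ (t : Fin n) (i j : Fin s) (S : Finset (Fin n × Fin s)),
      (∀ a ∈ S, a.1 < t ∨ a.1 = t ∧ a.2 ≠ i) → (t, j) ∉ S →
      H (insert (t, j) S) ≤ H (insert (t, i) S) + Δ)
    {e : ℕ → Fin s} {k : ℕ} (he : Set.InjOn e (Set.Iic k)) :
    k * (H (block e n (k + 1)) - H ∅) ≤ (k + 1) * (H (block e n k) - H ∅) + n * (k * Δ) := by
  have hnot : ∀ (t : Fin n) (i j : ℕ), i ≤ j → j ≤ k → (t, e j) ∉ stair e t (k + 1) i := by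
    intro t i j hij hjk h
    simp only [stair, Finset.mem_filter, Finset.mem_univ, true_and, lt_irrefl, false_and,
      false_or] at h
    obtain ⟨l, hl, h⟩ := h
    have := he (Set.mem_Iic.2 hjk) (Set.mem_Iic.2 (by omega)) h
    omega
  -- Within slot `t`, what user `e k` adds last is at most what it would add in place of `e i`
  -- (submodularity), hence at most what `e i` adds plus `Δ` (exchange); this is summed over `i <
  -- k`. The past contains all `k + 1` users.
  have hslot : ∀ t : Fin n, k * (H (stair e t (k + 1) (k + 1)) - H (stair e t (k + 1) k)) ≤
      H (stair e t (k + 1) k) - H (stair e t (k + 1) 0) + k * Δ := by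
    intro t
    have hstep : ∀ i ∈ Finset.range k,
        H (stair e t (k + 1) (k + 1)) - H (stair e t (k + 1) k) ≤
        (H (stair e t (k + 1) (i + 1)) - H (stair e t (k + 1) i)) + Δ := by
      intro i hi
      have hi := Finset.mem_range.1 hi
      have h1 := submodular_of_subset hsub (stair_mono e t (k + 1) hi.le)
        (Finset.disjoint_singleton_right.2 (hnot t k k le_rfl le_rfl))
      rw [Finset.union_comm, ← Finset.insert_eq, ← stair_succ, Finset.union_comm _ {_},
        ← Finset.insert_eq] at h1
      have h2 := hex t (e i) (e k) (stair e t (k + 1) i) (fun a ha => ?_)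
        (hnot t i k hi.le le_rfl)
      · rw [← stair_succ e t (k + 1) i] at h2
        linarith
      · simp only [stair, Finset.mem_filter, Finset.mem_univ, true_and] at ha
        rcases ha with ha | ⟨ha, l, hl, h'⟩
        · exact Or.inl ha.1
        · refine Or.inr ⟨Fin.ext ha, fun h => ?_⟩
          rw [h'] at h
          have := he (Set.mem_Iic.2 (by omega)) (Set.mem_Iic.2 hi.le) h
          omega
    have := Finset.sum_le_sum hstep
    rw [Finset.sum_const, Finset.card_range, nsmul_eq_mul, Finset.sum_add_distrib,
      Finset.sum_range_sub (fun i => H (stair e t (k + 1) i)), Finset.sum_const,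
      Finset.card_range, nsmul_eq_mul] at this
    exact this
  -- By submodularity, removing the past outputs of `e k` from the conditioning does not lower the
  -- increment of the other `k` users.
  have hpast : ∀ t : Fin n, H (stair e t (k + 1) k) - H (stair e t (k + 1) 0) ≤
      H (block e (t + 1) k) - H (block e t k) := by
    intro t
    have hsb : (block e t k : Finset (Fin n × Fin s)) ⊆ block e (t + 1) k := by
      rw [← stair_zero, ← stair_self]; exact stair_mono e t k (Nat.zero_le _)
    have h1 := submodular_of_subset hsub hsb
      (C := block e t (k + 1) \ block e t k) ?_
    · rw [Finset.union_sdiff_of_subset (block_mono e t (Nat.le_succ k))] at h1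
      have h2 : (block e (t + 1) k ∪ block e t (k + 1) \ block e t k :
          Finset (Fin n × Fin s)) = stair e t (k + 1) k := by
        ext a
        simp only [block, stair, Finset.mem_union, Finset.mem_sdiff, Finset.mem_filter,
          Finset.mem_univ, true_and]
        constructor
        · rintro (⟨h, l, hl, h'⟩ | ⟨h, -⟩)
          · rcases Nat.lt_succ_iff_lt_or_eq.1 h with h | h
            · exact Or.inl ⟨h, l, hl.trans (Nat.lt_succ_self k), h'⟩
            · exact Or.inr ⟨h, l, hl, h'⟩
          · exact Or.inl h
        · rintro (⟨h, l, hl, h'⟩ | ⟨h, l, hl, h'⟩)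
          · by_cases hc : ∃ l < k, a.2 = e l
            · exact Or.inl ⟨h.trans (Nat.lt_succ_self _), hc⟩
            · exact Or.inr ⟨⟨h, l, hl, h'⟩, fun hh => hc hh.2⟩
          · exact Or.inl ⟨by omega, l, hl, h'⟩
      rw [h2] at h1
      rw [stair_zero]
      linarith
    · rw [Finset.disjoint_left]
      intro a ha hb
      simp only [block, Finset.mem_sdiff, Finset.mem_filter, Finset.mem_univ, true_and] at ha hb
      exact hb.2 ⟨hb.1.1, ha.2⟩
  -- Summed over slots, `hslot` and `hpast` telescope: one slot adds `k` times the left increment of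
  -- `hpast` to both sides of `hslot`.
  have hsum : ∀ T : ℕ, T ≤ n → k * (H (block e T (k + 1)) - H ∅) ≤
      (k + 1) * (H (block e T k) - H ∅) + T * (k * Δ) := by
    intro T
    induction T with
    | zero => intro _; simp [block_zero_left]
    | succ T ih =>
      intro hT
      have h0 := ih (by omega)
      have h1 := hslot ⟨T, hT⟩
      have h2 := hpast ⟨T, hT⟩
      simp only [stair_self, stair_zero] at h1 h2
      push_cast
      nlinarith
  exact hsum n le_rfl

end Slots

/-! ### Messages of a group of users as labels. -/

section Labels
variable {s : ℕ} {M : Fin s → ℕ} (w₀ : ∀ k, Fin (M k))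

/-- The messages of the users in `J`. -/
def msgs (J : Finset (Fin s)) (w : ∀ k, Fin (M k)) : ∀ k, Fin (M k) := J.piecewise w w₀

theorem msgs_eq_iff (J : Finset (Fin s)) (w w' : ∀ k, Fin (M k)) :
    msgs w₀ J w' = msgs w₀ J w ↔ ∀ k ∈ J, w' k = w k := by
  constructor
  · intro h k hk
    have := congrFun h k
    simpa [msgs, hk] using this
  · intro h
    funext k
    by_cases hk : k ∈ J <;> simp [msgs, hk]
    exact h k hk

/-- Independent uniform messages in counting form: fixing the message of `u` as well divides the
number of matching tuples by `M u`. -/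
theorem sum_msgs_insert {J : Finset (Fin s)} {u : Fin s} (hu : u ∉ J) (w : ∀ k, Fin (M k)) :
    (∑ w' : ∀ k, Fin (M k), if msgs w₀ J w' = msgs w₀ J w then (1 : ℝ) else 0) =
      M u * ∑ w', if msgs w₀ (insert u J) w' = msgs w₀ (insert u J) w then (1 : ℝ) else 0 := by
  simp only [msgs_eq_iff]
  have h1 : ∀ w' : ∀ k, Fin (M k), (if ∀ k ∈ J, w' k = w k then (1 : ℝ) else 0) =
      ∑ b : Fin (M u), if w' u = b ∧ ∀ k ∈ J, w' k = w k then (1 : ℝ) else 0 := by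
    intro w'
    by_cases h : ∀ k ∈ J, w' k = w k
    · simp only [eq_true h, and_true, if_true, Finset.sum_ite_eq, Finset.mem_univ]
    · simp only [eq_false h, and_false, if_false, Finset.sum_const_zero]
  simp_rw [h1]
  rw [Finset.sum_comm]
  have h2 : ∀ b : Fin (M u), (∑ w' : ∀ k, Fin (M k),
      if w' u = b ∧ ∀ k ∈ J, w' k = w k then (1 : ℝ) else 0) =
      ∑ w' : ∀ k, Fin (M k), if ∀ k ∈ insert u J, w' k = w k then (1 : ℝ) else 0 := by
    intro b
    -- Swapping `b` and `w u` in coordinate `u` matches the tuples with value `b` there to those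
    -- with value `w u`.
    refine Fintype.sum_equiv (Equiv.piCongrRight fun k => if h : k = u then
      Equiv.swap (h ▸ b) (w k) else Equiv.refl _) _ _ fun w' => ?_
    have key : (w' u = b ∧ ∀ k ∈ J, w' k = w k) ↔ ∀ k ∈ insert u J,
      (Equiv.piCongrRight (fun k => if h : k = u then
      Equiv.swap (h ▸ b) (w k) else Equiv.refl (Fin (M k))) w') k = w k := by
      simp only [Finset.forall_mem_insert, Equiv.piCongrRight_apply, Pi.map_apply, dite_true]
      refine and_congr ?_ (forall₂_congr fun k hk => ?_)
      · rw [← Equiv.eq_symm_apply]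
        simp
      · have : k ≠ u := fun h => hu (h ▸ hk)
        simp [this]
    simp only [key]
  simp_rw [h2]
  simp

end Labels

theorem measurePreserving_uncurry_noise (n s : ℕ) :
    MeasurePreserving (fun (z : Fin n → Fin s → ℂ) (a : Fin n × Fin s) => z a.1 a.2)
      (Measure.pi fun _ => Measure.pi fun _ => complexGaussian 1) (noise (Fin n × Fin s)) := by
  refine ⟨by fun_prop, ?_⟩
  refine (Measure.pi_eq fun S hS => ?_).symm
  rw [Measure.map_apply (by fun_prop) (MeasurableSet.univ_pi hS)]
  have : (fun (z : Fin n → Fin s → ℂ) (a : Fin n × Fin s) => z a.1 a.2) ⁻¹' Set.univ.pi S =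
      Set.univ.pi fun t => Set.univ.pi fun k => S (t, k) := by
    ext z; simp [Set.mem_pi, Prod.forall]
  rw [this, Measure.pi_pi, Fintype.prod_prod_type]
  exact Finset.prod_congr rfl fun t _ => Measure.pi_pi _ _

/-- The recursion for `a k / k` telescopes from `k = 1`. The term `f 0` enters through `h0`, so `D`
is paid only for the `s - 1` later users. -/
theorem sum_range_succ_le_harmonic {a f : ℕ → ℝ} {C D : ℝ} {s : ℕ} (hs : 1 ≤ s)
    (h0 : a 1 ≤ C - f 0)
    (hstep : ∀ k, 1 ≤ k → k < s → a (k + 1) / (k + 1) ≤ a k / k + (D - f k) / (k + 1))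
    (hend : 0 ≤ a s) :
    ∑ l ∈ Finset.range s, f l / (l + 1) ≤ C + D * ∑ l ∈ Finset.range (s - 1), 1 / ((l : ℝ) + 2) := by
  have key : ∀ k, k < s → a (k + 1) / (k + 1) + ∑ l ∈ Finset.range (k + 1), f l / (l + 1) ≤
      C + D * ∑ l ∈ Finset.range k, 1 / ((l : ℝ) + 2) := by
    intro k
    induction k with
    | zero => intro _; simp; linarith
    | succ k ih =>
      intro hk
      have h1 := ih (by omega)
      have h2 := hstep (k + 1) (by omega) hk
      rw [Finset.sum_range_succ, Finset.sum_range_succ (fun l : ℕ => 1 / ((l : ℝ) + 2)) k, mul_add]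
      push_cast at h2 ⊢
      have h3 : (D - f (k + 1)) / ((k : ℝ) + 1 + 1) =
          D * (1 / ((k : ℝ) + 2)) - f (k + 1) / ((k : ℝ) + 1 + 1) := by
        rw [show (k : ℝ) + 2 = k + 1 + 1 by ring]; ring
      linarith
  obtain ⟨k, rfl⟩ : ∃ k, s = k + 1 := ⟨s - 1, by omega⟩
  have := key k (by omega)
  have h4 : 0 ≤ a (k + 1) / ((k : ℝ) + 1) := div_nonneg hend (by positivity)
  rw [Nat.add_sub_cancel]
  linarith

/-! ### The converse for a single code. -/

namespace Code
variable {s m n : ℕ} (c : Code s m n)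

/-- The signals sent by the code. -/
def signal (t : Fin n) (w : (k : Fin s) → Fin (c.M k)) (θ : StatePath s m) : Fin m → ℂ :=
  c.enc t w (fun i => (θ i).1) (fun i => (θ i).2)

/-- The value of the side link. -/
def sideValue (θ : StatePath s m) (w : (k : Fin s) → Fin (c.M k)) : Fin c.L :=
  c.side w fun i => θ i

theorem measurable_signal (t : Fin n) (w) : Measurable (c.signal t w) := by
  have : Measurable fun θ : StatePath s m =>
      ((fun i : Fin t => (θ i).1, fun i : Fin (t + 1) => (θ i).2) :
        (Fin t → Chan s m) × (Fin (t + 1) → Chan s m)) := by fun_prop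
  exact (c.measurable_enc t w).comp this

theorem measurable_sideValue (w) : Measurable fun θ => c.sideValue θ w :=
  (c.measurable_side w).comp (by fun_prop)

theorem causal_signal : Causal c.signal := by
  intro t w θ θ' h h'
  unfold signal
  congr 1
  · funext i
    rw [h i i.2]
  · funext i
    rcases Nat.lt_succ_iff_lt_or_eq.1 i.2 with hi | hi
    · rw [h i hi]
    · rw [hi, h']

/-- Flattening of the noise of a sample. -/
def flatten (ξ : c.Sample) :
    ((k : Fin s) → Fin (c.M k)) × StatePath s m × (Fin n × Fin s → ℂ) :=
  (ξ.1, ξ.2.1, fun a => ξ.2.2 a.1 a.2)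

theorem measurePreserving_flatten [∀ k, NeZero (c.M k)] (μ : Measure (StatePath s m))
    [IsProbabilityMeasure μ] : MeasurePreserving c.flatten (c.law μ) (mlaw _ (Fin n × Fin s) μ) := by
  have : IsProbabilityMeasure (uniformOn (Set.univ : Set ((k : Fin s) → Fin (c.M k)))) :=
    isProbabilityMeasure_uniformOn Set.finite_univ Set.univ_nonempty
  exact (MeasurePreserving.id _).prod
    ((MeasurePreserving.id μ).prod (measurePreserving_uncurry_noise n s))

theorem measurableSet_error [∀ k, NeZero (c.M k)] (k : Fin s) :
    MeasurableSet {ξ : ((k : Fin s) → Fin (c.M k)) × StatePath s m × (Fin n × Fin s → ℂ) |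
      c.dec k (fun t => out (mean c.signal) ξ (t, k)) (c.sideValue ξ.2.1 ξ.1) (fun i => ξ.2.1 i) ≠
        ξ.1 k} := by
  have ho := measurable_out (A := Fin n × Fin s) (measurable_mean c.measurable_signal)
  have h1 : Measurable fun ξ : ((k : Fin s) → Fin (c.M k)) × StatePath s m × (Fin n × Fin s → ℂ) =>
      c.dec k (fun t => out (mean c.signal) ξ (t, k)) (c.sideValue ξ.2.1 ξ.1)
        (fun i => ξ.2.1 i) := by
    have h2 : Measurable fun ξ : ((k : Fin s) → Fin (c.M k)) × StatePath s m ×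
        (Fin n × Fin s → ℂ) => c.sideValue ξ.2.1 ξ.1 :=
      measurable_from_prod_countable_right fun w => (c.measurable_sideValue w).comp measurable_fst
    exact (c.measurable_dec k).comp
      ((measurable_pi_lambda _ fun t => (measurable_pi_apply _).comp ho).prodMk
        (h2.prodMk (by fun_prop)))
  exact (measurableSet_eq_fun h1 (by fun_prop)).compl

theorem error_le [∀ k, NeZero (c.M k)] (μ : Measure (StatePath s m)) [IsProbabilityMeasure μ]
    {ε : ℝ} (hε : 0 ≤ ε) (h : c.errorProb μ ≤ ENNReal.ofReal ε) (k : Fin s) :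
    (mlaw _ (Fin n × Fin s) μ).real
      {ξ : ((k : Fin s) → Fin (c.M k)) × StatePath s m × (Fin n × Fin s → ℂ) |
      c.dec k (fun t => out (mean c.signal) ξ (t, k)) (c.sideValue ξ.2.1 ξ.1) (fun i => ξ.2.1 i) ≠
        ξ.1 k} ≤ ε := by
  rw [Measure.real, ← (c.measurePreserving_flatten μ).measure_preimage
    (c.measurableSet_error k).nullMeasurableSet]
  refine ENNReal.toReal_le_of_le_ofReal hε (le_trans (measure_mono fun ξ hξ => ?_) h)
  exact ⟨k, hξ⟩

theorem lintegral_signal_le [∀ k, NeZero (c.M k)] (μ : Measure (StatePath s m))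
    [IsProbabilityMeasure μ] {P : ℝ} (h : c.PowerConstraint μ P) (t : Fin n) :
    ∫⁻ ξ, ENNReal.ofReal (normSq (c.signal t ξ.1 ξ.2.1)) ∂mlaw _ (Fin n × Fin s) μ ≤
      ENNReal.ofReal P := by
  have hm : Measurable fun ξ : ((k : Fin s) → Fin (c.M k)) × StatePath s m ×
      (Fin n × Fin s → ℂ) => ENNReal.ofReal (normSq (c.signal t ξ.1 ξ.2.1)) :=
    (measurable_normSq.comp (measurable_from_prod_countable_right fun w =>
      (c.measurable_signal t w).comp measurable_fst)).ennreal_ofReal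
  rw [← (c.measurePreserving_flatten μ).lintegral_comp hm]
  exact h t

section Converse
variable [∀ k, NeZero (c.M k)] (μ : Measure (StatePath s m)) [IsProbabilityMeasure μ]

/-- Entropy of the messages of the users in `J` and the outputs `S`. -/
def hMsg (J : Finset (Fin s)) (S : Finset (Fin n × Fin s)) : ℝ :=
  ent μ (mean c.signal) (fun _ => msgs (fun _ => 0) J) S

/-- Entropy of the messages of the users in `J`, the side link, and the outputs `S`. -/
def hSide (J : Finset (Fin s)) (S : Finset (Fin n × Fin s)) : ℝ :=
  ent μ (mean c.signal) (fun θ w => (msgs (fun _ => 0) J w, c.sideValue θ w)) S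

theorem measurable_label (J : Finset (Fin s)) (w) : Measurable fun θ : StatePath s m =>
    (msgs (fun _ => 0) J w, c.sideValue θ w) :=
  measurable_const.prodMk (c.measurable_sideValue w)

theorem hMsg_le_hSide (J : Finset (Fin s)) (S : Finset (Fin n × Fin s)) :
    c.hMsg μ J S ≤ c.hSide μ J S := by
  unfold hMsg hSide
  exact ent_le_ent_of_refines μ (A := Fin n × Fin s)
    (κ := fun θ w => (msgs (fun _ => 0) J w, c.sideValue θ w))
    (κ' := fun _ => msgs (fun _ => 0) J) (measurable_mean c.measurable_signal)
    (c.measurable_label J) (fun _ => measurable_const) S fun _ _ _ h => (Prod.mk.inj h).1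

theorem hMsg_empty_le (J : Finset (Fin s)) (S : Finset (Fin n × Fin s)) :
    c.hMsg μ J ∅ ≤ c.hMsg μ J S := by
  unfold hMsg
  exact ent_empty_le μ (A := Fin n × Fin s) (κ := fun _ => msgs (fun _ => 0) J)
    (measurable_mean c.measurable_signal) (fun _ => measurable_const) S

/-- The difference is the conditional entropy of the side value given messages and outputs, and
conditioning on more outputs reduces it. -/
theorem hSide_sub_hMsg_anti (J : Finset (Fin s)) {S T : Finset (Fin n × Fin s)} (h : S ⊆ T) :
    c.hSide μ J T - c.hMsg μ J T ≤ c.hSide μ J S - c.hMsg μ J S := by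
  have := ent_submodular μ (measurable_mean c.measurable_signal) (c.measurable_label J)
    Prod.fst (S := S) (T := ∅) (U := T \ S) (by
      rw [Finset.union_empty]; exact Finset.disjoint_sdiff)
  rw [Finset.union_empty, Finset.union_sdiff_of_subset h] at this
  unfold hSide hMsg
  linarith

/-- Without outputs the entropy just counts message tuples, so a further independent message adds
exactly `log M`. -/
theorem hMsg_insert_empty {J : Finset (Fin s)} {u : Fin s} (hu : u ∉ J) :
    c.hMsg μ (insert u J) ∅ = c.hMsg μ J ∅ + Real.log (c.M u) := by
  have hM : (c.M u : ℝ) ≠ 0 := by exact_mod_cast NeZero.ne (c.M u)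
  have hi := integrable_info μ (A := Fin n × Fin s) (measurable_mean c.measurable_signal)
    (κ := fun _ => msgs (fun _ => 0) J) (fun _ => measurable_const) ∅
  have : ∀ ξ, info (mean c.signal) (fun _ => msgs (fun _ => 0) (insert u J)) ∅ ξ =
      info (mean c.signal) (fun _ => msgs (fun _ => 0) J) ∅ ξ + Real.log (c.M u) := by
    intro ξ
    have h1 := sum_msgs_insert (fun _ => 0) hu ξ.1
    have h2 := (mix_pos (mean c.signal ξ.2.1) (msgs (fun _ => 0) (insert u J)) ∅ ξ.1
      (out (mean c.signal) ξ)).ne'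
    simp only [info, mix, lik, Finset.prod_empty] at h2 ⊢
    rw [h1, Real.log_mul hM h2]
    ring
  rw [hMsg, ent, integral_congr_ae (ae_of_all _ this), integral_add hi (integrable_const _)]
  simp [hMsg, ent]

/-- Fano's inequality: user `u` decodes from its own outputs, the side value and the states, all
present in the conditioning. -/
theorem hSide_insert_le {ε : ℝ} (hε : 0 ≤ ε) (herr : c.errorProb μ ≤ ENNReal.ofReal ε)
    (J : Finset (Fin s)) (u : Fin s) {S : Finset (Fin n × Fin s)} (hS : ∀ t, (t, u) ∈ S) :
    c.hSide μ (insert u J) S ≤ c.hSide μ J S + Real.log 2 + ε * Real.log (c.M u) := by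
  have h1 : c.hSide μ (insert u J) S = ent μ (mean c.signal)
      (fun θ w => ((msgs (fun _ => 0) J w, c.sideValue θ w), w u)) S := by
    refine ent_congr μ S fun θ w w' => ?_
    simp only [Prod.mk.injEq, msgs_eq_iff, Finset.forall_mem_insert]
    tauto
  have h2 := ent_refine_le_of_decoder μ (measurable_mean c.measurable_signal)
    (c.measurable_label J) (S := S) (b := fun _ w => w u) (fun _ => measurable_const)
    (g := fun θ l y => c.dec u (fun t => y (t, u)) l.2 fun i => θ i)
    (fun l => (c.measurable_dec u).comp (g := fun p : (Fin n → ℂ) × Fin c.L × (Fin n → State s m) =>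
      c.dec u p.1 p.2.1 p.2.2)
      (f := fun p : StatePath s m × (Fin n × Fin s → ℂ) =>
        (fun t => p.2 (t, u), l.2, fun i : Fin n => p.1 i)) (by fun_prop))
    (fun θ l y y' h => by
      have : (fun t => y (t, u)) = fun t => y' (t, u) := funext fun t => h _ (hS t)
      simp only [this])
  rw [h1]
  refine h2.trans (add_le_add le_rfl ?_)
  rw [Fintype.card_fin]
  exact mul_le_mul_of_nonneg_right (c.error_le μ hε herr u) (Real.log_natCast_nonneg _)

theorem hSide_empty_le : c.hSide μ ∅ ∅ ≤ c.hMsg μ ∅ ∅ + Real.log c.L := by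
  have : Nonempty (Fin c.L) := ⟨c.side (fun _ => 0) fun _ => 0⟩
  have := ent_refine_le_add_log_card μ (A := Fin n × Fin s) (measurable_mean c.measurable_signal)
    (κ := fun _ => msgs (fun _ => 0) ∅) (fun _ => measurable_const) ∅ c.measurable_sideValue
  rwa [Fintype.card_fin] at this

end Converse

/-- The converse bound for a single code and a given order `e` of the users. -/
theorem sum_log_le [∀ k, NeZero (c.M k)] (hs : 1 ≤ s) (hm : 1 ≤ m) {α : ℝ}
    {ν : ℝ → Measure (StatePath s m)} [∀ P, IsProbabilityMeasure (ν P)] (hν : IsMixedCSIT α ν)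
    {P B η V ε : ℝ} (hP : 1 ≤ P) (hB : 0 ≤ B) (hη : 0 < η) (hη1 : η ≤ 1)
    (hvar : ∀ t : ℕ, ∃ v : Fin s → ℝ≥0, (∀ k, 0 < v k) ∧ ((ν P).map (estErr t) =
      Measure.pi (fun k : Fin s => Measure.pi (fun _ : Fin m => complexGaussian (v k)))) ∧
      ∀ k, Real.log (1 + (v k : ℝ)⁻¹) ≤ V)
    (hfad : ∀ (t : ℕ) (k : Fin s),
      ∫⁻ θ, ENNReal.ofReal (Real.log (1 + normSq ((θ t).1 k))) ∂ν P ≤ ENNReal.ofReal B)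
    (hpow : c.PowerConstraint (ν P) P) (hε : 0 ≤ ε)
    (herr : c.errorProb (ν P) ≤ ENNReal.ofReal ε) {e : ℕ → Fin s} (he : Set.InjOn e (Set.Iio s)) :
    ∑ l ∈ Finset.range s, ((1 - ε) * Real.log (c.M (e l)) - Real.log 2) / ((l : ℝ) + 1) ≤
      (Real.log c.L + n * (-Real.log η + (1 + η) * (B + Real.log (1 + P) + 3))) +
      n * (Real.log (8 * m / η) + V + 1 + B + η * (B + Real.log (1 + P) + 3)) *
        ∑ l ∈ Finset.range (s - 1), 1 / ((l : ℝ) + 2) := by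
  set c₁ := -Real.log η + (1 + η) * (B + Real.log (1 + P) + 3) with hc₁
  set Δ := Real.log (8 * m / η) + V + 1 + B + η * (B + Real.log (1 + P) + 3) with hΔ
  have hμ := measurable_mean c.measurable_signal
  have hpow' := c.lintegral_signal_le (ν P) hpow
  set J : ℕ → Finset (Fin s) := fun k => (Finset.range k).image e with hJ
  set O : ℕ → Finset (Fin n × Fin s) := fun k => block e n k with hO
  have hJs : ∀ k, J (k + 1) = insert (e k) (J k) := fun k => by
    simp only [hJ, Finset.range_add_one, Finset.image_insert]
  have hJn : ∀ k, k < s → e k ∉ J k := fun k hk h => by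
    obtain ⟨l, hl, h⟩ := Finset.mem_image.1 h
    have hl := Finset.mem_range.1 hl
    have := he (Set.mem_Iio.2 (hl.trans hk)) (Set.mem_Iio.2 hk) h
    omega
  -- The Fano loss is set against the gain `log M` of the message entropy.
  have hfano : ∀ k, k < s → c.hSide (ν P) (J (k + 1)) (O (k + 1)) - c.hMsg (ν P) (J (k + 1)) ∅ ≤
      c.hSide (ν P) (J k) (O (k + 1)) - c.hMsg (ν P) (J k) ∅ -
        ((1 - ε) * Real.log (c.M (e k)) - Real.log 2) := fun k hk => by
    have h1 := c.hSide_insert_le (ν P) hε herr (J k) (e k) (S := O (k + 1)) (fun t => by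
      simp only [hO, block, Finset.mem_filter, Finset.mem_univ, true_and]
      exact ⟨t.2, k, Nat.lt_succ_self k, rfl⟩)
    rw [hJs, c.hMsg_insert_empty (ν P) (hJn k hk)]
    linarith
  refine sum_range_succ_le_harmonic hs
    -- The entropy of side value and outputs of the first `k` users given their messages.
    (a := fun k => c.hSide (ν P) (J k) (O k) - c.hMsg (ν P) (J k) ∅) (C := Real.log c.L + n * c₁)
    (D := n * Δ) (f := fun l => (1 - ε) * Real.log (c.M (e l)) - Real.log 2) ?_ ?_ ?_
  · have h1 := hfano 0 (by omega)
    -- Start of the recursion: each of the `n` outputs of the first user costs at most `c₁`, and the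
    -- side value costs `log L`.
    have h2 : ∀ S, c.hSide (ν P) (J 0) S ≤ c.hSide (ν P) (J 0) ∅ + S.card * c₁ := by
      intro S
      induction S using Finset.induction_on with
      | empty => simp
      | insert a S ha ih =>
        have h3 := ent_insert_le_of_power c.measurable_signal (ν P) (c.measurable_label (J 0))
          (zero_le_one.trans hP) hB hη hη1 ha (hpow' a.1) (hfad a.1 a.2)
        rw [Finset.card_insert_of_notMem ha]
        push_cast
        unfold hSide at ih ⊢
        linarith
    have h4 : (O 1).card = n := by
      have : O 1 = Finset.univ.map ⟨fun t : Fin n => (t, e 0), fun a b h => (Prod.mk.inj h).1⟩ := by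
        ext ⟨a, b⟩
        simp only [hO, block, Finset.mem_filter, Finset.mem_univ, true_and, Finset.mem_map]
        constructor
        · rintro ⟨-, l, hl, h⟩
          obtain rfl : l = 0 := by omega
          exact ⟨a, Prod.ext rfl h.symm⟩
        · rintro ⟨t, ht⟩
          exact ⟨a.2, 0, one_pos, (Prod.mk.inj ht).2.symm⟩
      rw [this, Finset.card_map, Finset.card_univ, Fintype.card_fin]
    have h5 := h2 (O 1)
    have h6 := c.hSide_empty_le (ν P)
    have h7 : J 0 = ∅ := rfl
    rw [h4] at h5
    rw [h7] at h1 h5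
    simp only [zero_add] at h1 ⊢
    linarith
  · intro k hk1 hks
    have h1 := hfano k hks
    have hkpos : (0 : ℝ) < k := by exact_mod_cast hk1
    have h2 := mul_entropy_block_succ_le (H := c.hMsg (ν P) (J k)) (Δ := Δ)
      (fun S T U hU => ent_submodular (ν P) hμ (κ := fun _ => msgs (fun _ => 0) (J k))
        (fun _ => measurable_const) id hU)
      (fun t i j S hS hj => by
        obtain ⟨v, hv0, hv, hV⟩ := hvar t
        have := ent_insert_le_ent_insert c.measurable_signal c.causal_signal hm hν hP hB hη hη1
          t hv0 hv i j (msgs (fun _ => 0) (J k)) hS hj (hpow' t) (hfad t j)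
        have := hV i
        unfold hMsg
        linarith) (e := e) (k := k) (he.mono fun l hl => (Set.mem_Iic.1 hl).trans_lt hks)
    have h3 := c.hSide_sub_hMsg_anti (ν P) (J k) (block_mono (n := n) e n (Nat.le_succ k))
    have h4 := c.hMsg_le_hSide (ν P) (J k) (block e n k)
    -- The output entropy grows by the factor `(k + 1) / k`, while the side term does not grow.
    -- Since that term is nonnegative (`h4`), the same factor bounds the whole.
    have h5 : k * (c.hSide (ν P) (J k) (O (k + 1)) - c.hMsg (ν P) (J k) ∅) ≤
        (k + 1) * (c.hSide (ν P) (J k) (O k) - c.hMsg (ν P) (J k) ∅) + n * (k * Δ) := by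
      simp only [hO]
      nlinarith
    rw [div_add_div _ _ hkpos.ne' (by positivity), div_le_div_iff₀ (by positivity) (by positivity)]
    have h6 := mul_le_mul_of_nonneg_left h1 hkpos.le
    have h7 : (0 : ℝ) < k + 1 := by positivity
    have h8 : k * (c.hSide (ν P) (J (k + 1)) (O (k + 1)) - c.hMsg (ν P) (J (k + 1)) ∅) ≤
        (c.hSide (ν P) (J k) (O k) - c.hMsg (ν P) (J k) ∅) * (k + 1) +
        k * (n * Δ - ((1 - ε) * Real.log (c.M (e k)) - Real.log 2)) := by linarith
    have h9 := mul_le_mul_of_nonneg_right h8 h7.le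
    linarith
  · have h1 := c.hMsg_le_hSide (ν P) (J s) (O s)
    have h2 := c.hMsg_empty_le (ν P) (J s) (O s)
    linarith

end Code

/-! ### Achievable rates and averaging over orders. -/

section Rates
variable {s m : ℕ}

/-- The bound on an achievable rate tuple for a given order `e` of the users. -/
theorem Achievable.sum_div_le (hs : 1 ≤ s) (hm : 1 ≤ m) {α : ℝ}
    {ν : ℝ → Measure (StatePath s m)} [∀ P, IsProbabilityMeasure (ν P)] (hν : IsMixedCSIT α ν)
    {P B η V C : ℝ} (hP : 1 ≤ P) (hB : 0 ≤ B) (hη : 0 < η) (hη1 : η ≤ 1)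
    (hvar : ∀ t : ℕ, ∃ v : Fin s → ℝ≥0, (∀ k, 0 < v k) ∧ ((ν P).map (estErr t) =
      Measure.pi (fun k : Fin s => Measure.pi (fun _ : Fin m => complexGaussian (v k)))) ∧
      ∀ k, Real.log (1 + (v k : ℝ)⁻¹) ≤ V)
    (hfad : ∀ (t : ℕ) (k : Fin s),
      ∫⁻ θ, ENNReal.ofReal (Real.log (1 + normSq ((θ t).1 k))) ∂ν P ≤ ENNReal.ofReal B)
    {R : Fin s → ℝ} (hR : Achievable (ν P) P C R) {e : ℕ → Fin s} (he : Set.InjOn e (Set.Iio s)) :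
    ∑ l ∈ Finset.range s, R (e l) / ((l : ℝ) + 1) ≤
      (C + (-Real.log η + (1 + η) * (B + Real.log (1 + P) + 3))) +
      (Real.log (8 * m / η) + V + 1 + B + η * (B + Real.log (1 + P) + 3)) *
        ∑ l ∈ Finset.range (s - 1), 1 / ((l : ℝ) + 2) := by
  obtain ⟨hR0, hR⟩ := hR
  set c₁ := -Real.log η + (1 + η) * (B + Real.log (1 + P) + 3)
  set Δ := Real.log (8 * m / η) + V + 1 + B + η * (B + Real.log (1 + P) + 3)
  set Q := ∑ l ∈ Finset.range (s - 1), 1 / ((l : ℝ) + 2)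
  set S := ∑ l ∈ Finset.range s, R (e l) / ((l : ℝ) + 1) with hS
  have hS0 : 0 ≤ S := Finset.sum_nonneg fun l _ => div_nonneg (hR0 _) (by positivity)
  -- At error `ε`, a block length `n ≥ s log 2 / ε` reduces the Fano constants to at most `ε` per
  -- slot.
  have key : ∀ ε : ℝ, 0 < ε → ε < 1 → (1 - ε) * S ≤ C + c₁ + Δ * Q + ε := by
    intro ε hε hε1
    obtain ⟨n, ⟨c, hM, hL, hpow, herr⟩, hn1, hn2⟩ := ((hR (ENNReal.ofReal ε)
      (ENNReal.ofReal_pos.2 hε)).and ((eventually_ge_atTop 1).and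
        (tendsto_natCast_atTop_atTop.eventually_ge_atTop (s * Real.log 2 / ε)))).exists
    have hM0 : ∀ k, (0 : ℝ) < c.M k := fun k => (Real.exp_pos _).trans_le (hM k)
    have : ∀ k, NeZero (c.M k) := fun k => ⟨by exact_mod_cast (hM0 k).ne'⟩
    have h1 := c.sum_log_le hs hm hν hP hB hη hη1 hvar hfad hpow hε.le herr he
    have hn : (0 : ℝ) < n := by exact_mod_cast hn1
    have h2 : ∑ l ∈ Finset.range s, ((1 - ε) * (n * (R (e l) / ((l : ℝ) + 1))) - Real.log 2) ≤
        ∑ l ∈ Finset.range s, ((1 - ε) * Real.log (c.M (e l)) - Real.log 2) / ((l : ℝ) + 1) := by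
      refine Finset.sum_le_sum fun l _ => ?_
      have hl : (0 : ℝ) < l + 1 := by positivity
      have h3 : n * R (e l) ≤ Real.log (c.M (e l)) := (Real.le_log_iff_exp_le (hM0 _)).2 (hM _)
      have h4 := mul_le_mul_of_nonneg_left h3 (sub_nonneg.2 hε1.le)
      have h5 : Real.log 2 / ((l : ℝ) + 1) ≤ Real.log 2 :=
        div_le_self (Real.log_nonneg one_le_two) (by linarith [(Nat.cast_nonneg l : (0 : ℝ) ≤ l)])
      have h6 := div_le_div_of_nonneg_right h4 hl.le
      rw [sub_div]
      have h7 : (1 - ε) * (n * (R (e l) / ((l : ℝ) + 1))) = (1 - ε) * (n * R (e l)) / (l + 1) := by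
        ring
      linarith
    rw [Finset.sum_sub_distrib, ← Finset.mul_sum, ← Finset.mul_sum, ← hS, Finset.sum_const,
      Finset.card_range, nsmul_eq_mul] at h2
    have h3 := (div_le_iff₀ hε).1 hn2
    refine le_of_mul_le_mul_left ?_ hn
    linarith
  refine le_of_forall_pos_le_add fun δ hδ => ?_
  have h1 : 0 < 1 + S := by linarith
  -- This `ε` satisfies `ε (1 + S) ≤ δ`, which covers both the loss `ε S` and the extra `ε`.
  have h2 := key (min (1 / 2) (δ / (1 + S))) (by positivity)
    ((min_le_left _ _).trans_lt (by norm_num))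
  have h3 := (le_div_iff₀ h1).1 (min_le_right (1 / 2) (δ / (1 + S)))
  linarith

theorem sum_range_inv_eq_harmonic (s : ℕ) :
    ∑ l ∈ Finset.range s, 1 / ((l : ℝ) + 1) = ((harmonic s : ℚ) : ℝ) := by
  simp [harmonic]

theorem sum_range_pred_inv_eq_harmonic {s : ℕ} (hs : 1 ≤ s) :
    ∑ l ∈ Finset.range (s - 1), 1 / ((l : ℝ) + 2) = ((harmonic s : ℚ) : ℝ) - 1 := by
  obtain ⟨k, rfl⟩ : ∃ k, s = k + 1 := ⟨s - 1, by omega⟩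
  rw [← sum_range_inv_eq_harmonic, Finset.sum_range_succ', Nat.add_sub_cancel]
  simp only [Nat.cast_zero, zero_add, div_one, add_sub_cancel_right]
  exact Finset.sum_congr rfl fun l _ => by push_cast; ring

/-- Averaging over the cyclic orders of the users. -/
theorem harmonic_mul_sum_le (hs : 1 ≤ s) {R : Fin s → ℝ} {D : ℝ}
    (h : ∀ e : ℕ → Fin s, Set.InjOn e (Set.Iio s) →
      ∑ l ∈ Finset.range s, R (e l) / ((l : ℝ) + 1) ≤ D) :
    ((harmonic s : ℚ) : ℝ) * ∑ k, R k ≤ s * D := by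
  have : NeZero s := ⟨by omega⟩
  -- Over the `s` cyclic shifts each user occupies each position once.
  have h1 : ∑ r : Fin s, ∑ l ∈ Finset.range s, R (r + Fin.ofNat s l) / ((l : ℝ) + 1) ≤
      ∑ _r : Fin s, D := by
    refine Finset.sum_le_sum fun r _ => h _ fun a ha b hb hab => ?_
    have := congrArg Fin.val (add_left_cancel hab)
    simpa [Nat.mod_eq_of_lt (Set.mem_Iio.1 ha), Nat.mod_eq_of_lt (Set.mem_Iio.1 hb)] using this
  rw [Finset.sum_comm, Finset.sum_const, Finset.card_univ, Fintype.card_fin, nsmul_eq_mul] at h1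
  refine le_trans (le_of_eq ?_) h1
  rw [← sum_range_inv_eq_harmonic, Finset.sum_mul]
  refine Finset.sum_congr rfl fun l _ => ?_
  rw [← Finset.sum_div, Fintype.sum_equiv (Equiv.addRight (Fin.ofNat s l))
    (fun r => R (r + Fin.ofNat s l)) R fun _ => rfl]
  ring

end Rates

/-! ### High-power asymptotics. -/

section Asymptotics
variable {s m : ℕ}

theorem integral_normSq_estErr (μ : Measure (StatePath s m)) (t : ℕ) {v : Fin s → ℝ≥0}
    (hv : μ.map (estErr t) =
      Measure.pi (fun k : Fin s => Measure.pi (fun _ : Fin m => complexGaussian (v k))))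
    (k : Fin s) : ∫ ω, normSq (estErr t ω k) ∂μ = m * v k := by
  have hme : Measurable (estErr t : StatePath s m → Chan s m) := by unfold estErr; fun_prop
  have h1 : ∫⁻ ω, ENNReal.ofReal (normSq (estErr t ω k)) ∂μ = m * v k := by
    have hf : Measurable fun x : Chan s m => ENNReal.ofReal (normSq (x k)) :=
      (measurable_normSq.comp (measurable_pi_apply k)).ennreal_ofReal
    rw [← lintegral_map (f := fun x : Chan s m => ENNReal.ofReal (normSq (x k))) hf hme, hv]
    rw [(measurePreserving_eval (fun k : Fin s =>
      Measure.pi (fun _ : Fin m => complexGaussian (v k))) k).lintegral_comp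
        (f := fun y : Fin m → ℂ => ENNReal.ofReal (normSq y)) measurable_normSq.ennreal_ofReal]
    have h2 : ∀ y : Fin m → ℂ, ENNReal.ofReal (normSq y) = ∑ j, ENNReal.ofReal (‖y j‖ ^ 2) :=
      fun y => ENNReal.ofReal_sum_of_nonneg fun _ _ => by positivity
    simp only [h2]
    rw [lintegral_finsetSum _ fun j _ => by fun_prop]
    have h3 : ∀ j : Fin m, ∫⁻ y : Fin m → ℂ, ENNReal.ofReal (‖y j‖ ^ 2)
        ∂Measure.pi (fun _ : Fin m => complexGaussian (v k)) = v k := fun j => by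
      rw [(measurePreserving_eval (fun _ : Fin m => complexGaussian (v k)) j).lintegral_comp
        (f := fun z : ℂ => ENNReal.ofReal (‖z‖ ^ 2)) (by fun_prop), lintegral_norm_sq_complexGaussian]
    rw [Finset.sum_congr rfl fun j _ => h3 j, Finset.sum_const, Finset.card_univ, Fintype.card_fin,
      nsmul_eq_mul]
  rw [integral_eq_lintegral_of_nonneg_ae (ae_of_all _ fun _ => normSq_nonneg _)
    (show Measurable fun ω => normSq (estErr t ω k) from
      measurable_normSq.comp ((measurable_pi_apply k).comp hme)).aestronglyMeasurable, h1]
  simp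

/-- For `v ≥ 1` the left side is at most `log 2`; for `v ≤ 1` it is at most `log 2 - log v`, where
the hypothesis applies. -/
theorem log_one_add_inv_le {v x : ℝ} {m : ℕ} (hv : 0 < v) (hm : 1 ≤ m) (hx : 0 ≤ x)
    (h : -Real.log (m * v) ≤ x) : Real.log (1 + v⁻¹) ≤ Real.log 2 + Real.log m + x := by
  have hm0 : (0 : ℝ) < m := by exact_mod_cast hm
  have hlm : 0 ≤ Real.log m := Real.log_natCast_nonneg m
  have h0 : 0 < v⁻¹ := inv_pos.2 hv
  rcases le_total 1 v with h1 | h1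
  · have : Real.log (1 + v⁻¹) ≤ Real.log 2 :=
      Real.log_le_log (by positivity) (by linarith [inv_le_one_of_one_le₀ h1])
    linarith
  · have : Real.log (1 + v⁻¹) ≤ Real.log (2 * v⁻¹) :=
      Real.log_le_log (by positivity) (by linarith [(one_le_inv₀ hv).2 h1])
    rw [Real.log_mul two_ne_zero h0.ne', Real.log_inv] at this
    rw [Real.log_mul hm0.ne' hv.ne'] at h
    linarith

/-- The mean squared error is `m * v k`, so the quality exponent keeps the variance above `P ^ (-(α
+ δ)) / m`, in all slots at once. -/
theorem IsMixedCSIT.eventually_variance (hm : 1 ≤ m) {α : ℝ} (hα : 0 ≤ α)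
    {ν : ℝ → Measure (StatePath s m)} [∀ P, IsProbabilityMeasure (ν P)] (hν : IsMixedCSIT α ν)
    {δ : ℝ} (hδ : 0 < δ) : ∀ᶠ P : ℝ in atTop, ∀ t : ℕ, ∃ v : Fin s → ℝ≥0, (∀ k, 0 < v k) ∧
      ((ν P).map (estErr t) =
        Measure.pi (fun k : Fin s => Measure.pi (fun _ : Fin m => complexGaussian (v k)))) ∧
      ∀ k, Real.log (1 + (v k : ℝ)⁻¹) ≤ Real.log 2 + Real.log m + (α + δ) * Real.log P := by
  have hq := eventually_all.2 fun k =>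
    Metric.tendstoUniformly_iff.1 (hν.quality k) δ hδ
  filter_upwards [hq, eventually_gt_atTop 1] with P hP hP1 t
  obtain ⟨v, hv0, hv⟩ := hν.gaussian_error P hP1.le t
  refine ⟨v, hv0, hv, fun k => ?_⟩
  have hlog := Real.log_pos hP1
  refine log_one_add_inv_le (by exact_mod_cast hv0 k) hm (by positivity) ?_
  have h1 := hP k t
  rw [integral_normSq_estErr (ν P) t hv k, Real.dist_eq] at h1
  have h2 := (abs_lt.1 h1).1
  rw [← div_le_iff₀ hlog]
  linarith

/-- The upper bound on the sum rate, relative to `u = log P`. -/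
theorem tendsto_rate_bound (a b c d q : ℝ) {C : ℝ → ℝ}
    (hC : Tendsto (fun P : ℝ => C P / Real.log P) atTop (𝓝 d)) :
    Tendsto (fun P : ℝ => ((C P + (Real.log (Real.log P) + (1 + (Real.log P)⁻¹) *
        (Real.log P + a))) + (Real.log (Real.log P) + b + c * Real.log P +
          (Real.log P)⁻¹ * (Real.log P + a)) * q) / Real.log P) atTop (𝓝 (d + 1 + c * q)) := by
  have hu := Real.tendsto_log_atTop
  have hinv := tendsto_inv_atTop_zero.comp hu
  have hll : Tendsto (fun P : ℝ => Real.log (Real.log P) / Real.log P) atTop (𝓝 0) :=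
    (Real.isLittleO_log_id_atTop.tendsto_div_nhds_zero).comp hu
  have h : Tendsto (fun P : ℝ => C P / Real.log P + (Real.log (Real.log P) / Real.log P +
      (1 + (Real.log P)⁻¹) * (1 + a * (Real.log P)⁻¹)) +
      (Real.log (Real.log P) / Real.log P + b * (Real.log P)⁻¹ + c +
        (Real.log P)⁻¹ * (1 + a * (Real.log P)⁻¹)) * q) atTop
      (𝓝 (d + (0 + (1 + 0) * (1 + a * 0)) + (0 + b * 0 + c + 0 * (1 + a * 0)) * q)) := by
    have h1 : Tendsto (fun P : ℝ => (Real.log P)⁻¹) atTop (𝓝 0) := hinv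
    have h2 := (h1.const_mul a).const_add 1
    exact (hC.add (hll.add ((h1.const_add 1).mul h2))).add
      ((((hll.add (h1.const_mul b)).add_const c).add (h1.mul h2)).mul_const q)
  have h3 : d + (0 + (1 + 0) * (1 + a * 0)) + (0 + b * 0 + c + 0 * (1 + a * 0)) * q =
      d + 1 + c * q := by ring
  rw [h3] at h
  refine h.congr' ?_
  filter_upwards [eventually_gt_atTop 1] with P hP
  have := (Real.log_pos hP).ne'
  field_simp

theorem log_one_add_le_log_add {P : ℝ} (hP : 1 ≤ P) : Real.log (1 + P) ≤ Real.log P + Real.log 2 := by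
  rw [← Real.log_mul (by positivity) two_ne_zero]
  exact Real.log_le_log (by positivity) (by linarith)

theorem sumDoF_le (hs : 1 ≤ s) (hm : 1 ≤ m) {α d : ℝ} (hα : 0 ≤ α)
    {ν : ℝ → Measure (StatePath s m)} [∀ P, IsProbabilityMeasure (ν P)]
    (hν : IsMixedCSIT α ν) {C : ℝ → ℝ}
    (hC : Tendsto (fun P : ℝ => C P / Real.log P) atTop (𝓝 d)) {δ : ℝ} (hδ : 0 < δ) :
    sumDoF ν C ≤ (((s / ((harmonic s : ℚ) : ℝ)) *
      (d + 1 + (α + δ) * (((harmonic s : ℚ) : ℝ) - 1)) : ℝ) : EReal) := by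
  obtain ⟨B, hB⟩ := hν.fading
  set H : ℝ := ((harmonic s : ℚ) : ℝ) with hH
  have hH1 : 0 ≤ H - 1 := by
    rw [hH, ← sum_range_pred_inv_eq_harmonic hs]
    exact Finset.sum_nonneg fun _ _ => by positivity
  have hHpos : 0 < H := by linarith
  set B' := max B 0
  have hB'0 : 0 ≤ B' := le_max_right _ _
  have hlim := (tendsto_rate_bound (B' + Real.log 2 + 3)
    (Real.log (8 * m) + (Real.log 2 + Real.log m) + 1 + B') (α + δ) d (H - 1) hC).const_mul (s / H)
  have hlim' := (continuous_coe_real_ereal.tendsto _).comp hlim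
  rw [← hlim'.limsup_eq]
  refine limsup_le_limsup ?_
  -- For `P ≥ exp 1` the choice `η = (log P)⁻¹` is at most 1. It makes `-log η = log log P`
  -- negligible against `log P`, and `η log P` bounded.
  filter_upwards [hν.eventually_variance hm hα hδ, eventually_ge_atTop (Real.exp 1)] with P hvar hPe
  have hP1 : 1 ≤ P := (Real.one_le_exp zero_le_one).trans hPe
  have hu1 : 1 ≤ Real.log P := (Real.le_log_iff_exp_le (by positivity)).2 hPe
  have hu0 : 0 < Real.log P := by linarith
  refine iSup_le fun R => EReal.coe_le_coe_iff.2 ?_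
  have h1 := harmonic_mul_sum_le hs fun e he => R.2.sum_div_le hs hm hν hP1 hB'0
    (inv_pos.2 hu0) (inv_le_one_of_one_le₀ hu1) hvar
    (fun t k => (hB P hP1 t k).trans (ENNReal.ofReal_le_ofReal (le_max_left _ _))) he
  have h2 := log_one_add_le_log_add hP1
  have hinv : 0 < (Real.log P)⁻¹ := inv_pos.2 hu0
  rw [sum_range_pred_inv_eq_harmonic hs, ← hH, Real.log_inv, neg_neg, div_inv_eq_mul,
    Real.log_mul (by positivity) hu0.ne'] at h1
  have h3 : B' + Real.log (1 + P) + 3 ≤ Real.log P + (B' + Real.log 2 + 3) := by linarith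
  have h4 := mul_le_mul_of_nonneg_left h3 (by positivity : 0 ≤ 1 + (Real.log P)⁻¹)
  have h5 := mul_le_mul_of_nonneg_left h3 hinv.le
  dsimp only
  rw [← mul_div_assoc, div_le_div_iff_of_pos_right hu0, div_mul_eq_mul_div, le_div_iff₀ hHpos,
    mul_comm _ H]
  refine h1.trans (mul_le_mul_of_nonneg_left ?_ (Nat.cast_nonneg s))
  refine add_le_add (by linarith) (mul_le_mul_of_nonneg_right ?_ hH1)
  linarith

end Asymptotics

end
end MisoBC

theorem lemma3 (s m : ℕ) (hs : 1 ≤ s) (hm : 1 ≤ m) (α d : ℝ) (hα : α ∈ Set.Icc (0 : ℝ) 1)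
    (hd : 0 ≤ d) (ν : ℝ → Measure (MisoBC.StatePath s m)) [∀ P, IsProbabilityMeasure (ν P)]
    (hν : MisoBC.IsMixedCSIT α ν) (C : ℝ → ℝ)
    (hC : Tendsto (fun P : ℝ => C P / Real.log P) atTop (𝓝 d)) :
    MisoBC.sumDoF ν C ≤
      ((s * α + s / ((harmonic s : ℚ) : ℝ) * (1 - α + d) : ℝ) : EReal) := by
  have hH : (0 : ℝ) < ((harmonic s : ℚ) : ℝ) := by exact_mod_cast harmonic_pos (by omega)
  have h : Tendsto (fun δ : ℝ => (s / ((harmonic s : ℚ) : ℝ)) *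
      (d + 1 + (α + δ) * (((harmonic s : ℚ) : ℝ) - 1))) (𝓝[>] 0)
      (𝓝 ((s / ((harmonic s : ℚ) : ℝ)) * (d + 1 + (α + 0) * (((harmonic s : ℚ) : ℝ) - 1)))) :=
    (Continuous.tendsto (by fun_prop) 0).mono_left nhdsWithin_le_nhds
  have h0 : (s / ((harmonic s : ℚ) : ℝ)) * (d + 1 + (α + 0) * (((harmonic s : ℚ) : ℝ) - 1)) =
      s * α + s / ((harmonic s : ℚ) : ℝ) * (1 - α + d) := by
    field_simp
    ring
  rw [h0] at h
  -- The slack `δ` in the quality exponent tends to 0 from above; at `δ = 0` the bound is the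
  -- claimed one by `h0`.
  refine ge_of_tendsto ((continuous_coe_real_ereal.tendsto _).comp h) ?_
  filter_upwards [self_mem_nhdsWithin] with δ hδ
  exact MisoBC.sumDoF_le hs hm hα.1 hν hC hδ
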